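/- Let $n \ge 1$ and let $H(n,3)$ be the Hamming graph, whose vertex set is $\mathbb{Z}_3^n$ and in which two points are adjacent exactly when their Hamming distance is $1$. Let $e_1,\dots,e_n$ be the standard basis of $\mathbb{Z}_3^n$. For $i \in \{1,\dots,n\}$, a set $U \subseteq \mathbb{Z}_3^n$ is called $i$-saturated if $U \cap \{x, x+e_i, x+2e_i\} \neq \emptyset$ for all $x \in \mathbb{Z}_3^n$, i.e. every line in direction $e_i$ contains at least one point of $U$. Theorem. For all $U \subseteq \mathbb{Z}_3^n$ and all $i \in \{1,\dots,n\}$, if $U$ is $i$-saturated and the subgraph of $H(n,3)$ induced by $U$ has maximum degree at most $1$, then $|U| \le 3^{n-1}+81$. -/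

import Mathlib

/-- The Hamming graph `H(n,3)`: the vertices are the points of `ℤ₃ⁿ`, and two points are adjacent
when their Hamming distance is `1`. -/
def hammingGraph (n : ℕ) : SimpleGraph (Fin n → ZMod 3) where
  Adj x y := hammingDist x y = 1
  symm := ⟨fun x y h => by rw [hammingDist_comm]; exact h⟩
  loopless := ⟨fun x h => by simp at h⟩

instance (n : ℕ) : DecidableRel (hammingGraph n).Adj :=
  fun x y => inferInstanceAs (Decidable (hammingDist x y = 1))

/-- `U ⊆ ℤ₃ⁿ` is `i`-saturated: every line `{x, x + eᵢ, x + 2eᵢ}` in direction `eᵢ` contains at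
least one point of `U`. -/
def IsSaturated {n : ℕ} (i : Fin n) (U : Finset (Fin n → ZMod 3)) : Prop :=
  ∀ x : Fin n → ZMod 3,
    ((U : Set (Fin n → ZMod 3)) ∩
      {x, x + Pi.single i 1, x + (2 : ZMod 3) • Pi.single i 1}).Nonempty

/-! Split off the coordinate i and write a point of U as a pair (x, c) of a position and a colour.
Saturation says that every x carries a colour; a line inside U would be a triangle, so every x
carries one or two colours, and |U| is 3^(n-1) plus the number of positions with two colours, the
doubles. The claim becomes: there are at most 81 doubles.

At a double x the two points of its line are matched to each other, so every neighbouring position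
has the missing colour c and no other (`Double.hub`). Degree at most one then leaves three patterns
over two directions j, k (`Valid.trichotomy`): they alternate, with colour c + s a b at x + a e_j +
b e_k for a, b ≠ 0, or one leads the other, the colour depending only on the coordinate of the led
direction. The directions at x thus form a signed mixed graph. Its local constraints on three or
four directions are finite statements about H(4,3) and H(5,3). A verified unit-propagation search
decides them, once symmetry has normalised the signs.

Let W(x) (`altSet`) be the set of directions alternating with some direction. Each member of W(x)
leads each direction outside it, with a sign that does not depend on the leader, so moving outside
W(x) preserves the pattern up to a shift of colours (`Valid.hub_add`). Three facts follow. Two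
doubles x ≠ y differ in at least three coordinates of W(x) (`Valid.three_le_card`). The size of W(x)
is at most five (`Valid.card_altSet_le`): from size five on, W(x) is an alternating clique, and a
Ramsey argument on the K₅ seen from each vertex of a six-clique produces exceptional triangles that
exclude one another. Finally, W(x) and W(y) are comparable (`Valid.altSet_subset_or_subset`).

So all these sets lie in a largest one, of size at most five. After one of its coordinates is
dropped, the remaining four or fewer still separate the doubles, whence 3^4 = 81. -/

namespace HammingThree

/-! ### A bit-mask search for partial sets in `H(d,3)`. -/

/-- The number with the given base-three digits, least significant first. -/
def enc : List ℕ → ℕ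
  | [] => 0
  | a :: as => a + 3 * enc as

/-- The first `d` base-three digits of `v`, least significant first. -/
def dec : ℕ → ℕ → List ℕ
  | 0, _ => []
  | d + 1, v => v % 3 :: dec d (v / 3)

/-- The neighbours of a word over `{0, 1, 2}` in the Hamming graph. -/
def nbrs : List ℕ → List (List ℕ)
  | [] => []
  | a :: as => ((a + 1) % 3 :: as) :: ((a + 2) % 3 :: as) :: (nbrs as).map (a :: ·)

/-- The bit mask of a list of words. -/
def mask (l : List (List ℕ)) : ℕ := l.foldr (fun w m => Nat.lor (2 ^ enc w) m) 0

/-- Every vertex of `H(d,3)`, as a bit, with the mask of its neighbours. -/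
def rules (d : ℕ) : List (ℕ × ℕ) :=
  (List.range (3 ^ d)).map fun v => (2 ^ v, mask (nbrs (dec d v)))

/-- The lines of `H(d,3)` in the first direction, as triples of bits. -/
def lines (d : ℕ) : List (ℕ × ℕ × ℕ) :=
  (List.range (3 ^ (d - 1))).map fun v => (2 ^ (3 * v), 2 ^ (3 * v + 1), 2 ^ (3 * v + 2))

/-- Unit propagation at one vertex; `K` and `X` are the masks of the vertices known to be in,
respectively not in, the set. -/
def ruleStep (s : ℕ × ℕ) (r : ℕ × ℕ) : ℕ × ℕ :=
  -- `k` is the mask of known neighbours. `k &&& (k - 1)` clears the lowest bit, so for `k ≠ 0` it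
  -- vanishes exactly when one neighbour is known.
  let k := Nat.land s.1 r.2
  bif Nat.beq k 0 then s else
  bif Nat.beq (Nat.land s.1 r.1) 0 then
    bif Nat.beq (Nat.land k (k - 1)) 0 then s else (s.1, Nat.lor s.2 r.1)
  else
    bif Nat.beq (Nat.land k (k - 1)) 0 then (s.1, Nat.lor s.2 (Nat.xor r.2 k))
    -- A member with two known neighbours is also marked as excluded; the overlap of the two masks
    -- is the contradiction that `search` looks for.
    else (s.1, Nat.lor s.2 r.1)

/-- Unit propagation on one line. -/
def lineStep (s : ℕ × ℕ) (r : ℕ × ℕ × ℕ) : ℕ × ℕ :=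
  bif Nat.beq (Nat.land s.2 r.1) 0 then
    bif Nat.beq (Nat.land s.2 r.2.1) 0 then s
    else bif Nat.beq (Nat.land s.2 r.2.2) 0 then s else (Nat.lor s.1 r.1, s.2)
  else
    bif Nat.beq (Nat.land s.2 r.2.1) 0 then
      bif Nat.beq (Nat.land s.2 r.2.2) 0 then s else (Nat.lor s.1 r.2.1, s.2)
    else (Nat.lor s.1 r.2.2, s.2)

/-- One round of unit propagation. -/
def propagate (d : ℕ) (s : ℕ × ℕ) : ℕ × ℕ :=
  (lines d).foldl lineStep ((rules d).foldl ruleStep s)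

/-- The tail of a list of bits starting at the first undecided one. -/
def nextFree (s : ℕ × ℕ) : List ℕ → List ℕ
  | [] => []
  | b :: bs => bif Nat.beq (Nat.land (Nat.lor s.1 s.2) b) 0 then b :: bs else nextFree s bs

/-- Search for a proof that no set containing the vertices in `K` and avoiding those in `X` meets
all lines in the first direction and induces a subgraph of maximum degree at most one. -/
def search (d : ℕ) : ℕ → List ℕ → ℕ × ℕ → Bool
  | 0, _, _ => false
  | n + 1, order, s =>
    let t := propagate d s
    bif Nat.beq (Nat.land t.1 t.2) 0 then
      bif Nat.beq t.1 s.1 && Nat.beq t.2 s.2 then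
        match nextFree t order with
        | [] => false
        -- Only `bs` is passed on: everything before `b` is decided already and stays so.
        | b :: bs => search d n bs (Nat.lor t.1 b, t.2) && search d n bs (t.1, Nat.lor t.2 b)
      else search d n order t
    else true

/-- The order in which the search decides the vertices: first those over words of weight three. -/
def splitOrder (d : ℕ) : List ℕ :=
  (List.range (3 ^ d)).filter (fun v => Nat.beq ((dec d v).tail.filter (Nat.blt 0)).length 3) ++
    List.range (3 ^ d)

/-- The search started from a list of words known to be in the set. -/
def refute (d : ℕ) (facts : List (List ℕ)) : Bool :=
  facts.all (fun w => w.all (fun a => Nat.blt a 3) && Nat.beq w.length d) &&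
    -- The number 400 is fuel, one unit per round of propagation. Running out yields `false`, so
    -- soundness does not depend on it.
    search d 400 ((splitOrder d).map fun v => 2 ^ v) (mask facts, 0)

/-- The word of length `d` with the given colour and the given entries. -/
def word (d c : ℕ) (l : List (ℕ × ℕ)) : List ℕ :=
  l.foldl (fun w x => w.set (x.1 + 1) (x.2 % 3)) (c % 3 :: List.replicate (d - 1) 0)

/-- Here and in the next two definitions are the word forms of `Hub`, `Alt` and `Dom`, the hub
colour being zero: over entries `a`, `b` in positions `j`, `k` the colours are `s * a * b` in
`altWords` and `s * b` in `domWords`. -/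
def hubWords (d : ℕ) (js : List ℕ) : List (List ℕ) :=
  js.flatMap fun j => [word d 0 [(j, 1)], word d 0 [(j, 2)]]

def altWords (d j k s : ℕ) : List (List ℕ) :=
  [word d s [(j, 1), (k, 1)], word d (2 * s) [(j, 1), (k, 2)], word d (2 * s) [(j, 2), (k, 1)],
    word d s [(j, 2), (k, 2)]]

def domWords (d j k s : ℕ) : List (List ℕ) :=
  [word d s [(j, 1), (k, 1)], word d (2 * s) [(j, 1), (k, 2)], word d s [(j, 2), (k, 1)],
    word d (2 * s) [(j, 2), (k, 2)]]

/-- The words `ws` moved to the slice where the `i`-th entry is `a`, with colours shifted by `a`. -/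
def sliceWords (i a : ℕ) (ws : List (List ℕ)) : List (List ℕ) :=
  ws.map fun w => (w.headI + a) % 3 :: w.tail.set i a

/-- All the words at distance one from the word `![a, b, c]` with support `i, j, k`, in the same
orthant structure, have colour zero. -/
def zeroWords (d i j k a b c : ℕ) : List (List ℕ) :=
  [word d 0 [(i, 2 * a), (j, b), (k, c)], word d 0 [(i, a), (j, 2 * b), (k, c)],
    word d 0 [(i, a), (j, b), (k, 2 * c)]]

end HammingThree

/-! ### Soundness of the search. -/

namespace HammingThree

theorem dec_enc (l : List ℕ) (h : ∀ a ∈ l, a < 3) : dec l.length (enc l) = l := by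
  induction l with
  | nil => rfl
  | cons a l ih =>
    have ha : a < 3 := h a (by simp)
    have ih := ih fun b hb => h b (by simp [hb])
    simp only [List.length_cons, enc, dec]
    rw [show (a + 3 * enc l) % 3 = a by omega, show (a + 3 * enc l) / 3 = enc l by omega, ih]

theorem length_dec (d v : ℕ) : (dec d v).length = d := by
  induction d generalizing v with
  | zero => rfl
  | succ d ih => simp [dec, ih]

theorem lt_of_mem_dec (d v a : ℕ) (h : a ∈ dec d v) : a < 3 := by
  induction d generalizing v with
  | zero => simp [dec] at h
  | succ d ih =>
    rcases List.mem_cons.1 h with rfl | h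
    · exact Nat.mod_lt _ (by norm_num)
    · exact ih _ h

theorem length_of_mem_nbrs (w u : List ℕ) (h : u ∈ nbrs w) : u.length = w.length := by
  induction w generalizing u with
  | nil => simp [nbrs] at h
  | cons a w ih =>
    simp only [nbrs, List.mem_cons, List.mem_map] at h
    rcases h with rfl | rfl | ⟨v, hv, rfl⟩
    · simp
    · simp
    · simp [ih v hv]

theorem lt_of_mem_nbrs (w u : List ℕ) (hw : ∀ a ∈ w, a < 3) (h : u ∈ nbrs w) :
    ∀ a ∈ u, a < 3 := by
  induction w generalizing u with
  | nil => simp [nbrs] at h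
  | cons a w ih =>
    have hw' : ∀ b ∈ w, b < 3 := fun b hb => hw b (by simp [hb])
    simp only [nbrs, List.mem_cons, List.mem_map] at h
    rcases h with rfl | rfl | ⟨v, hv, rfl⟩
    · intro b hb
      rcases List.mem_cons.1 hb with rfl | hb
      · exact Nat.mod_lt _ (by norm_num)
      · exact hw' b hb
    · intro b hb
      rcases List.mem_cons.1 hb with rfl | hb
      · exact Nat.mod_lt _ (by norm_num)
      · exact hw' b hb
    · intro b hb
      rcases List.mem_cons.1 hb with rfl | hb
      · exact hw b (by simp)
      · exact ih v hw' hv b hb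

theorem testBit_mask (l : List (List ℕ)) (i : ℕ) :
    (mask l).testBit i = true ↔ ∃ w ∈ l, enc w = i := by
  induction l with
  | nil => simp [mask]
  | cons w l ih =>
    have : mask (w :: l) = 2 ^ enc w ||| mask l := rfl
    rw [this, Nat.testBit_or, Bool.or_eq_true, ih, Nat.testBit_two_pow]
    simp

theorem land_two_pow_eq_zero {k v : ℕ} : Nat.land k (2 ^ v) = 0 ↔ k.testBit v = false := by
  change k &&& 2 ^ v = 0 ↔ _
  rw [Nat.and_two_pow]
  cases k.testBit v <;> simp

theorem exists_testBit_pair {k : ℕ} (hk : k ≠ 0) (h : Nat.land k (k - 1) ≠ 0) :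
    ∃ i j, i ≠ j ∧ k.testBit i = true ∧ k.testBit j = true := by
  by_contra! hcon
  apply h
  obtain ⟨i, hi⟩ := Nat.exists_testBit_of_ne_zero hk
  have : k = 2 ^ i := by
    apply Nat.eq_of_testBit_eq
    intro j
    rw [Nat.testBit_two_pow]
    by_cases hij : i = j
    · subst hij; simpa using hi
    · have := hcon i j hij hi
      simpa [hij] using this
  rw [this]
  exact Nat.and_sub_one_eq_zero_iff_isPowerOfTwo (by positivity) |>.2 ⟨i, rfl⟩

/-- The masks `s` are correct about the set `M`. -/
def Correct (M : ℕ → Prop) (s : ℕ × ℕ) : Prop :=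
  (∀ i, s.1.testBit i = true → M i) ∧ ∀ i, s.2.testBit i = true → ¬ M i

theorem Correct.insert_fst {M : ℕ → Prop} {s : ℕ × ℕ} (hs : Correct M s) {v : ℕ} (h : M v) :
    Correct M (Nat.lor s.1 (2 ^ v), s.2) := by
  refine ⟨fun i hi => ?_, hs.2⟩
  change (s.1 ||| 2 ^ v).testBit i = true at hi
  rw [Nat.testBit_or, Bool.or_eq_true, Nat.testBit_two_pow] at hi
  rcases hi with hi | hi
  · exact hs.1 i hi
  · rw [← of_decide_eq_true hi]; exact h

theorem Correct.union_snd {M : ℕ → Prop} {s : ℕ × ℕ} (hs : Correct M s) {x : ℕ}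
    (h : ∀ i, x.testBit i = true → ¬ M i) : Correct M (s.1, Nat.lor s.2 x) := by
  refine ⟨hs.1, fun i hi => ?_⟩
  change (s.2 ||| x).testBit i = true at hi
  rw [Nat.testBit_or, Bool.or_eq_true] at hi
  exact hi.elim (hs.2 i) (h i)

theorem Correct.insert_snd {M : ℕ → Prop} {s : ℕ × ℕ} (hs : Correct M s) {v : ℕ} (h : ¬ M v) :
    Correct M (s.1, Nat.lor s.2 (2 ^ v)) := by
  refine hs.union_snd fun i hi => ?_
  rw [Nat.testBit_two_pow] at hi
  rw [← of_decide_eq_true hi]; exact h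

theorem Correct.ruleStep {M : ℕ → Prop} {s : ℕ × ℕ} (hs : Correct M s) {v m : ℕ}
    (h : ∀ i j, m.testBit i = true → m.testBit j = true → M v → M i → M j → i = j) :
    Correct M (ruleStep s (2 ^ v, m)) := by
  have hk : ∀ i, (Nat.land s.1 m).testBit i = true → M i ∧ m.testBit i = true := by
    intro i hi
    change (s.1 &&& m).testBit i = true at hi
    rw [Nat.testBit_and, Bool.and_eq_true] at hi
    exact ⟨hs.1 i hi.1, hi.2⟩
  have two : Nat.land s.1 m ≠ 0 → Nat.land (Nat.land s.1 m) (Nat.land s.1 m - 1) ≠ 0 → ¬ M v := by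
    intro h0 h2 hv
    obtain ⟨i, j, hij, hi, hj⟩ := exists_testBit_pair h0 h2
    exact hij (h i j (hk i hi).2 (hk j hj).2 hv (hk i hi).1 (hk j hj).1)
  unfold HammingThree.ruleStep
  dsimp only
  cases h0 : Nat.beq (Nat.land s.1 m) 0
  · have h0' := Nat.ne_of_beq_eq_false h0
    simp only [cond_false]
    cases h1 : Nat.beq (Nat.land s.1 (2 ^ v)) 0 <;>
      cases h2 : Nat.beq (Nat.land (Nat.land s.1 m) (Nat.land s.1 m - 1)) 0 <;>
      simp only [cond_false, cond_true]
    · exact hs.insert_snd (two h0' (Nat.ne_of_beq_eq_false h2))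
    · have hv : M v := by
        refine hs.1 v ?_
        by_contra hcon
        exact Nat.ne_of_beq_eq_false h1 (land_two_pow_eq_zero.2 (by simpa using hcon))
      obtain ⟨j, hj⟩ := Nat.exists_testBit_of_ne_zero h0'
      refine hs.union_snd fun i hi hMi => ?_
      change (m ^^^ Nat.land s.1 m).testBit i = true at hi
      rw [Nat.testBit_xor] at hi
      by_cases hmi : m.testBit i = true
      · have := h i j hmi (hk j hj).2 hv hMi (hk j hj).1
        subst this
        rw [hmi, hj] at hi
        exact absurd hi (by decide)
      · have : (Nat.land s.1 m).testBit i = false := by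
          by_contra hcon
          exact hmi (hk i (by simpa using hcon)).2
        rw [this] at hi
        exact hmi (by simpa using hi)
    · exact hs.insert_snd (two h0' (Nat.ne_of_beq_eq_false h2))
    · exact hs
  · simpa using hs

theorem Correct.lineStep {M : ℕ → Prop} {s : ℕ × ℕ} (hs : Correct M s) {a b c : ℕ}
    (h : M a ∨ M b ∨ M c) : Correct M (lineStep s (2 ^ a, 2 ^ b, 2 ^ c)) := by
  have key : ∀ v, Nat.beq (Nat.land s.2 (2 ^ v)) 0 = false → ¬ M v := by
    intro v hv
    refine hs.2 v ?_
    by_contra hcon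
    exact Nat.ne_of_beq_eq_false hv (land_two_pow_eq_zero.2 (by simpa using hcon))
  unfold HammingThree.lineStep
  dsimp only
  cases ha : Nat.beq (Nat.land s.2 (2 ^ a)) 0 <;> cases hb : Nat.beq (Nat.land s.2 (2 ^ b)) 0 <;>
    cases hc : Nat.beq (Nat.land s.2 (2 ^ c)) 0 <;> simp only [cond_false, cond_true]
  all_goals first
    | exact hs
    | (refine hs.insert_fst ?_
       have := key a
       have := key b
       have := key c
       tauto)

theorem Correct.foldl {α : Type*} {M : ℕ → Prop} {g : ℕ × ℕ → α → ℕ × ℕ} (l : List α)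
    (h : ∀ r ∈ l, ∀ s, Correct M s → Correct M (g s r)) (s : ℕ × ℕ) (hs : Correct M s) :
    Correct M (l.foldl g s) := by
  induction l generalizing s with
  | nil => exact hs
  | cons r l ih =>
    exact ih (fun r' hr' => h r' (by simp [hr'])) _ (h r (by simp) s hs)

theorem nextFree_sublist (s : ℕ × ℕ) (l : List ℕ) : ∀ b ∈ nextFree s l, b ∈ l := by
  induction l with
  | nil => simp [nextFree]
  | cons a l ih =>
    intro b hb
    unfold nextFree at hb
    cases h : Nat.beq (Nat.land (Nat.lor s.1 s.2) a) 0 <;>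
      simp only [h, cond_false, cond_true] at hb
    · exact List.mem_cons_of_mem _ (ih b hb)
    · exact hb

/-- A set of words of length `d` that meets every line in the first direction and in which every
word has at most one neighbour. -/
structure WordModel (d : ℕ) (S : List ℕ → Prop) : Prop where
  unique : ∀ w, w.length = d → (∀ a ∈ w, a < 3) → ∀ u ∈ nbrs w, ∀ u' ∈ nbrs w,
    S w → S u → S u' → u = u'
  line : ∀ w, w.length + 1 = d → (∀ a ∈ w, a < 3) → S (0 :: w) ∨ S (1 :: w) ∨ S (2 :: w)

theorem WordModel.propagate {d : ℕ} {S : List ℕ → Prop} (hS : WordModel (d + 1) S) {s : ℕ × ℕ}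
    (hs : Correct (fun i => S (dec (d + 1) i)) s) :
    Correct (fun i => S (dec (d + 1) i)) (propagate (d + 1) s) := by
  unfold HammingThree.propagate
  refine Correct.foldl _ ?_ _ (Correct.foldl _ ?_ _ hs)
  · intro r hr s hs
    simp only [lines, List.mem_map, List.mem_range] at hr
    obtain ⟨v, -, rfl⟩ := hr
    refine hs.lineStep ?_
    simp only [dec]
    rw [show 3 * v % 3 = 0 by omega, show (3 * v + 1) % 3 = 1 by omega,
      show (3 * v + 2) % 3 = 2 by omega, show 3 * v / 3 = v by omega,
      show (3 * v + 1) / 3 = v by omega, show (3 * v + 2) / 3 = v by omega]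
    exact hS.line _ (by simp [length_dec]) (lt_of_mem_dec _ _)
  · intro r hr s hs
    simp only [rules, List.mem_map, List.mem_range] at hr
    obtain ⟨v, -, rfl⟩ := hr
    refine hs.ruleStep fun i j hi hj hv hMi hMj => ?_
    rw [testBit_mask] at hi hj
    obtain ⟨u, hu, rfl⟩ := hi
    obtain ⟨u', hu', rfl⟩ := hj
    have hl := length_dec (d + 1) v
    have hlt := lt_of_mem_dec (d + 1) v
    have e : ∀ u ∈ nbrs (dec (d + 1) v), dec (d + 1) (enc u) = u := by
      intro u hu
      have := dec_enc u (lt_of_mem_nbrs _ u hlt hu)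
      rwa [length_of_mem_nbrs _ u hu, hl] at this
    rw [e u hu] at hMi
    rw [e u' hu'] at hMj
    rw [hS.unique _ hl hlt u hu u' hu' hv hMi hMj]

/-- At each split the model selects a branch along which the masks remain correct. Correct masks
never overlap, so this branch reports no contradiction. -/
theorem WordModel.search {d : ℕ} {S : List ℕ → Prop} (hS : WordModel (d + 1) S) (n : ℕ)
    (order : List ℕ) (ho : ∀ b ∈ order, ∃ v, b = 2 ^ v) (s : ℕ × ℕ)
    (hs : Correct (fun i => S (dec (d + 1) i)) s) : search (d + 1) n order s = false := by
  induction n generalizing order s with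
  | zero => rfl
  | succ n ih =>
    unfold HammingThree.search
    have ht := hS.propagate hs
    set t := HammingThree.propagate (d + 1) s
    dsimp only
    cases h1 : Nat.beq (Nat.land t.1 t.2) 0
    · exfalso
      obtain ⟨i, hi⟩ := Nat.exists_testBit_of_ne_zero (Nat.ne_of_beq_eq_false h1)
      change (t.1 &&& t.2).testBit i = true at hi
      rw [Nat.testBit_and, Bool.and_eq_true] at hi
      exact ht.2 i hi.2 (ht.1 i hi.1)
    · simp only [cond_true]
      cases Nat.beq t.1 s.1 && Nat.beq t.2 s.2
      · exact ih order ho t ht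
      · simp only [cond_true]
        have hsub := nextFree_sublist t order
        cases h : nextFree t order with
        | nil => rfl
        | cons b bs =>
          rw [h] at hsub
          obtain ⟨v, rfl⟩ := ho b (hsub b (by simp))
          have ho' : ∀ b ∈ bs, ∃ v, b = 2 ^ v := fun b hb => ho b (hsub b (by simp [hb]))
          dsimp only
          by_cases hv : S (dec (d + 1) v)
          · rw [ih bs ho' _ (ht.insert_fst hv)]; rfl
          · rw [ih bs ho' _ (ht.insert_snd hv), Bool.and_false]

theorem WordModel.refute {d : ℕ} {S : List ℕ → Prop} (hS : WordModel (d + 1) S)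
    (facts : List (List ℕ)) (hr : refute (d + 1) facts = true) : ∃ w ∈ facts, ¬ S w := by
  by_contra! hf
  unfold HammingThree.refute at hr
  rw [Bool.and_eq_true] at hr
  obtain ⟨h1, h2⟩ := hr
  have hs : Correct (fun i => S (dec (d + 1) i)) (mask facts, 0) := by
    refine ⟨fun i hi => ?_, fun i hi => by simp at hi⟩
    obtain ⟨w, hw, rfl⟩ := (testBit_mask _ _).1 hi
    have := List.all_eq_true.1 h1 w hw
    rw [Bool.and_eq_true, List.all_eq_true] at this
    have hl : w.length = d + 1 := Nat.eq_of_beq_eq_true this.2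
    have := dec_enc w fun a ha => by simpa using this.1 a ha
    rw [hl] at this
    change S _
    rw [this]
    exact hf w hw
  rw [hS.search 400 _ ?_ _ hs] at h2
  · exact absurd h2 (by simp)
  · intro b hb
    obtain ⟨v, -, rfl⟩ := List.mem_map.1 hb
    exact ⟨_, rfl⟩

end HammingThree

/-! ### Pulling a colouring back to words. -/

namespace HammingThree

variable {ι : Type*} [DecidableEq ι]

/-- Adjacency of `(x, c)` and `(y, d)` in the Hamming graph on `ℤ₃^ι × ℤ₃`. -/
def Near (x : ι → ZMod 3) (c : ZMod 3) (y : ι → ZMod 3) (d : ZMod 3) : Prop :=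
  (y = x ∧ d ≠ c) ∨ (d = c ∧ ∃ j a, a ≠ 0 ∧ y = x + Pi.single j a)

/-- `f x c` says that `(x, c)` lies in a set that meets every line in the last direction and
induces a subgraph of maximum degree at most one. -/
structure Valid (f : (ι → ZMod 3) → ZMod 3 → Prop) : Prop where
  nonempty : ∀ x, ∃ c, f x c
  unique : ∀ {x c y d z e}, f x c → f y d → f z e → Near x c y d → Near x c z e → y = z ∧ d = e

/-- The displacement in the directions `js`, with signs, given by a word. -/
def disp : List (ι × ZMod 3) → List ℕ → ι → ZMod 3
  | j :: js, a :: as => Pi.single j.1 (j.2 * (a : ZMod 3)) + disp js as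
  | _, _ => 0

theorem ne_mod_three {a : ℕ} {s : ZMod 3} (hs : s ≠ 0) (ha : a < 3) :
    ((a + 1) % 3 < 3 ∧ (a + 2) % 3 < 3) ∧
    (s * ((a + 1) % 3 : ℕ) = s * a + s ∧ s * ((a + 2) % 3 : ℕ) = s * a + 2 * s) := by
  interval_cases a <;> revert s <;> decide

theorem disp_apply_of_not_mem (js : List (ι × ZMod 3)) (as : List ℕ) (i : ι)
    (h : i ∉ js.map Prod.fst) : disp js as i = 0 := by
  induction js generalizing as with
  | nil => simp [disp]
  | cons j js ih =>
    cases as with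
    | nil => simp [disp]
    | cons a as =>
      simp only [List.map_cons, List.mem_cons, not_or] at h
      simp [disp, ih as h.2, Pi.single_eq_of_ne h.1]

theorem cast_mul_injective {s : ZMod 3} (hs : s ≠ 0) {a b : ℕ} (ha : a < 3) (hb : b < 3)
    (h : s * (a : ZMod 3) = s * b) : a = b := by
  interval_cases a <;> interval_cases b <;> first | rfl | (exfalso; revert s; decide)

theorem disp_injective (js : List (ι × ZMod 3)) (hn : (js.map Prod.fst).Nodup)
    (h0 : ∀ j ∈ js, j.2 ≠ 0) (as bs : List ℕ) (ha : as.length = js.length)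
    (hb : bs.length = js.length) (ha3 : ∀ a ∈ as, a < 3) (hb3 : ∀ a ∈ bs, a < 3)
    (h : disp js as = disp js bs) : as = bs := by
  induction js generalizing as bs with
  | nil => rw [List.length_nil, List.length_eq_zero_iff] at ha hb; rw [ha, hb]
  | cons j js ih =>
    obtain ⟨a, as, rfl⟩ := List.exists_cons_of_length_eq_add_one ha
    obtain ⟨b, bs, rfl⟩ := List.exists_cons_of_length_eq_add_one hb
    rw [List.map_cons, List.nodup_cons] at hn
    simp only [disp] at h
    have h1 := congrFun h j.1
    simp only [Pi.add_apply, Pi.single_eq_same, disp_apply_of_not_mem _ _ _ hn.1, add_zero] at h1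
    have hab := cast_mul_injective (h0 j (by simp)) (ha3 a (by simp)) (hb3 b (by simp)) h1
    subst hab
    rw [ih hn.2 (fun j hj => h0 j (by simp [hj])) as bs (by simpa using ha) (by simpa using hb)
      (fun x hx => ha3 x (by simp [hx])) (fun x hx => hb3 x (by simp [hx])) (by simpa using h)]

theorem disp_of_mem_nbrs (js : List (ι × ZMod 3)) (h0 : ∀ j ∈ js, j.2 ≠ 0) (as bs : List ℕ)
    (ha : as.length = js.length) (ha3 : ∀ a ∈ as, a < 3) (h : bs ∈ nbrs as) :
    ∃ j a, a ≠ 0 ∧ disp js bs = disp js as + Pi.single j a := by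
  induction js generalizing as bs with
  | nil =>
    rw [List.length_nil, List.length_eq_zero_iff] at ha
    subst ha
    simp [nbrs] at h
  | cons j js ih =>
    obtain ⟨a, as, rfl⟩ := List.exists_cons_of_length_eq_add_one ha
    have hj := h0 j (by simp)
    have e := (ne_mod_three hj (ha3 a (by simp))).2
    simp only [nbrs, List.mem_cons, List.mem_map] at h
    rcases h with rfl | rfl | ⟨v, hv, rfl⟩
    · refine ⟨j.1, j.2, hj, ?_⟩
      simp only [disp]
      rw [e.1, Pi.single_add]; abel
    · refine ⟨j.1, 2 * j.2, mul_ne_zero (by decide) hj, ?_⟩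
      simp only [disp]
      rw [e.2, Pi.single_add]; abel
    · obtain ⟨k, b, hb, hk⟩ := ih (fun j hj => h0 j (by simp [hj])) as v (by simpa using ha)
        (fun x hx => ha3 x (by simp [hx])) hv
      refine ⟨k, b, hb, ?_⟩
      simp only [disp]
      rw [hk]; abel

/-- The pullback of `f` to words, along directions `js` from the base point `p`, with the colours
renamed by `c ↦ c₀ + κ c`. -/
def pull (f : (ι → ZMod 3) → ZMod 3 → Prop) (p : ι → ZMod 3) (js : List (ι × ZMod 3))
    (c₀ κ : ZMod 3) : List ℕ → Prop
  | [] => False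
  | c :: as => f (p + disp js as) (c₀ + κ * c)

/-- Distinct directions with non-zero scalings, together with an affine change of colour, embed one
Hamming graph in the other and carry colour lines onto colour lines, so both properties are
inherited. -/
theorem Valid.wordModel {f : (ι → ZMod 3) → ZMod 3 → Prop} (hf : Valid f) (p : ι → ZMod 3)
    (js : List (ι × ZMod 3)) (hn : (js.map Prod.fst).Nodup) (h0 : ∀ j ∈ js, j.2 ≠ 0)
    (c₀ κ : ZMod 3) (hκ : κ ≠ 0) : WordModel (js.length + 1) (pull f p js c₀ κ) := by
  constructor
  · intro w hw hw3 u hu u' hu' hSw hSu hSu'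
    obtain ⟨c, as, rfl⟩ := List.exists_cons_of_length_eq_add_one hw
    have hc := hw3 c (by simp)
    have key : ∀ u ∈ nbrs (c :: as), ∃ d bs, u = d :: bs ∧ d < 3 ∧ bs.length = js.length ∧
        (∀ b ∈ bs, b < 3) ∧
        Near (p + disp js as) (c₀ + κ * c) (p + disp js bs) (c₀ + κ * d) := by
      intro u hu
      have hu3 := lt_of_mem_nbrs _ u hw3 hu
      have hul := length_of_mem_nbrs _ u hu
      have e := (ne_mod_three hκ hc).2
      simp only [nbrs, List.mem_cons, List.mem_map] at hu
      rcases hu with rfl | rfl | ⟨v, hv, rfl⟩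
      · refine ⟨_, _, rfl, hu3 _ (by simp), by simpa using hw, fun b hb => hu3 b (by simp [hb]),
          Or.inl ⟨rfl, ?_⟩⟩
        rw [e.1]; simpa using hκ
      · refine ⟨_, _, rfl, hu3 _ (by simp), by simpa using hw, fun b hb => hu3 b (by simp [hb]),
          Or.inl ⟨rfl, ?_⟩⟩
        rw [e.2]
        simpa using (mul_ne_zero (by decide) hκ : (2 : ZMod 3) * κ ≠ 0)
      · obtain ⟨j, a, ha, hj⟩ := disp_of_mem_nbrs js h0 as v (by simpa using hw)
          (fun x hx => hw3 x (by simp [hx])) hv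
        refine ⟨_, _, rfl, hc, ?_, fun b hb => hu3 b (by simp [hb]), Or.inr ⟨rfl, j, a, ha, ?_⟩⟩
        · rw [hw] at hul; simpa using hul
        · rw [hj, add_assoc]
    obtain ⟨d, bs, rfl, hd, hbl, hb3, hnear⟩ := key u hu
    obtain ⟨d', bs', rfl, hd', hbl', hb3', hnear'⟩ := key u' hu'
    obtain ⟨h1, h2⟩ := hf.unique hSw hSu hSu' hnear hnear'
    rw [cast_mul_injective hκ hd hd' (by simpa using h2),
      disp_injective js hn h0 bs bs' hbl hbl' hb3 hb3' (by simpa using h1)]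
  · intro as has has3
    obtain ⟨c, hc⟩ := hf.nonempty (p + disp js as)
    have : ∀ c₀ κ c : ZMod 3, κ ≠ 0 →
        c = c₀ + κ * (0 : ℕ) ∨ c = c₀ + κ * (1 : ℕ) ∨ c = c₀ + κ * (2 : ℕ) := by decide
    simp only [pull]
    rcases this c₀ κ c hκ with h | h | h <;> rw [h] at hc
    · exact Or.inl hc
    · exact Or.inr (Or.inl hc)
    · exact Or.inr (Or.inr hc)

/-- If the checker refutes a list of words, then not all of them can hold in a pullback. -/
theorem Valid.refuted {f : (ι → ZMod 3) → ZMod 3 → Prop} (hf : Valid f) {facts : List (List ℕ)}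
    {d : ℕ} (hr : refute (d + 1) facts = true) (p : ι → ZMod 3) (js : List (ι × ZMod 3))
    (hd : js.length = d) (hn : (js.map Prod.fst).Nodup) (h0 : ∀ j ∈ js, j.2 ≠ 0)
    (c₀ κ : ZMod 3) (hκ : κ ≠ 0) (hfacts : ∀ w ∈ facts, pull f p js c₀ κ w) : False := by
  subst hd
  obtain ⟨w, hw, hnw⟩ := (hf.wordModel p js hn h0 c₀ κ hκ).refute facts hr
  exact hnw (hfacts w hw)

end HammingThree

/-! ### Small configurations excluded by computation. -/

namespace HammingThree

/-- Each computation treats normalised signs. Rescaling directions and colours reduces the general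
case to them in the `Valid` lemmas below; signs that cannot be normalised run over `[1, 2]`. -/
theorem refute_cycle :
    refute 4 (hubWords 4 [0, 1, 2] ++ domWords 4 0 1 1 ++ domWords 4 1 2 1 ++ domWords 4 2 0 1)
      = true := by
  decide +kernel

theorem refute_alt_dom_dom :
    refute 4 (hubWords 4 [0, 1, 2] ++ altWords 4 0 1 1 ++ domWords 4 2 0 1 ++ domWords 4 2 1 1)
      = true := by
  decide +kernel

theorem refute_alt_dom_dom' :
    refute 4 (hubWords 4 [0, 1, 2] ++ altWords 4 0 1 1 ++ domWords 4 2 0 1 ++ domWords 4 1 2 1)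
      = true := by
  decide +kernel

theorem refute_alt_signs :
    refute 4 (hubWords 4 [0, 1, 2] ++ altWords 4 0 1 1 ++ domWords 4 0 2 1
      ++ domWords 4 1 2 2) = true := by
  decide +kernel

set_option maxRecDepth 100000 in
theorem refute_star : ∀ s ∈ [1, 2], ∀ t ∈ [1, 2], ∀ u ∈ [1, 2],
    refute 5 (hubWords 5 [0, 1, 2, 3] ++ altWords 5 0 1 1 ++ altWords 5 0 2 1
      ++ altWords 5 0 3 1 ++ domWords 5 1 2 s ++ domWords 5 1 3 t ++ domWords 5 2 3 u) = true := by
  decide +kernel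

set_option maxRecDepth 100000 in
theorem refute_paw : ∀ s ∈ [1, 2], ∀ t ∈ [1, 2], ∀ u ∈ [1, 2],
    refute 5 (hubWords 5 [0, 1, 2, 3] ++ altWords 5 0 1 1 ++ altWords 5 0 2 1
      ++ altWords 5 0 3 1 ++ altWords 5 1 2 s ++ domWords 5 1 3 t ++ domWords 5 2 3 u) = true := by
  decide +kernel

set_option maxRecDepth 100000 in
theorem refute_square : ∀ s ∈ [1, 2], ∀ t ∈ [1, 2], ∀ u ∈ [1, 2],
    refute 5 (hubWords 5 [0, 1, 2, 3] ++ altWords 5 0 1 1 ++ altWords 5 1 2 1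
      ++ altWords 5 2 3 1 ++ altWords 5 0 3 s ++ domWords 5 0 2 t ++ domWords 5 1 3 u) = true := by
  decide +kernel

set_option maxRecDepth 100000 in
theorem refute_K4 : refute 5 (hubWords 5 [0, 1, 2, 3] ++ altWords 5 0 1 1 ++ altWords 5 0 2 1
      ++ altWords 5 0 3 1 ++ altWords 5 1 2 1 ++ altWords 5 1 3 1 ++ altWords 5 2 3 1) = true := by
  decide +kernel

set_option maxRecDepth 100000 in
theorem refute_K4_minus_edge : ∀ s ∈ [1, 2], refute 5 (hubWords 5 [0, 1, 2, 3] ++ domWords 5 0 1 s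
      ++ altWords 5 0 2 1 ++ altWords 5 0 3 1 ++ altWords 5 1 2 1 ++ altWords 5 1 3 1
      ++ altWords 5 2 3 1) = true := by
  decide +kernel

set_option maxRecDepth 100000 in
theorem refute_slices : ∀ s ∈ [1, 2], ∀ t ∈ [1, 2], refute 5
    (hubWords 5 [0, 1, 2] ++ altWords 5 0 1 1 ++ altWords 5 0 2 1 ++ altWords 5 1 2 1
      ++ sliceWords 3 1 (hubWords 5 [0, 1, 2] ++ altWords 5 0 1 2 ++ altWords 5 0 2 s
        ++ altWords 5 1 2 t) ++ sliceWords 3 2 (hubWords 5 [0, 1, 2])) = true := by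
  decide +kernel

set_option maxRecDepth 100000 in
-- This is for two hubs of equal colour four directions apart (`Valid.not_four`): the colours over
-- the all-ones entries in positions 0, 1, 2 recur in the slices along position 3, shifted with the
-- slice.
theorem refute_four : ∀ s ∈ [1, 2], ∀ t ∈ [1, 2], ∀ u ∈ [1, 2],
    refute 5 (hubWords 5 [0, 1, 2, 3] ++ altWords 5 0 1 s ++ altWords 5 0 2 t ++ altWords 5 1 2 u
      ++ altWords 5 0 3 1 ++ altWords 5 1 3 1 ++ altWords 5 2 3 1
      ++ sliceWords 3 1 [word 5 s [(0, 1), (1, 1)], word 5 t [(0, 1), (2, 1)],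
        word 5 u [(1, 1), (2, 1)], word 5 0 [(0, 1), (1, 1), (2, 1)]]
      ++ sliceWords 3 2 [word 5 s [(0, 1), (1, 1)], word 5 t [(0, 1), (2, 1)],
        word 5 u [(1, 1), (2, 1)], word 5 0 [(0, 1), (1, 1), (2, 1)]]
      ++ [word 5 0 [(0, 1), (1, 1), (2, 1)]]) = true := by
  decide +kernel

set_option maxRecDepth 100000 in
theorem refute_zero_zero : ∀ s ∈ [1, 2], refute 5 (hubWords 5 [0, 1, 2, 3] ++ altWords 5 0 1 1
      ++ altWords 5 0 2 1 ++ altWords 5 1 2 1 ++ altWords 5 0 3 1 ++ altWords 5 1 3 1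
      ++ altWords 5 2 3 s ++ zeroWords 5 0 1 2 1 1 1 ++ zeroWords 5 0 1 3 1 1 1) = true := by
  decide +kernel

/-- The words one flip away from `±![a, b, c]`, where `![a, b, c]` is supported on `i, j, k`; those
where the flip is in position `m` have colour `p`, the others colour zero. -/
def mixedWords (d i j k a b c m p : ℕ) : List (List ℕ) :=
  [word d (if m = 0 then p else 0) [(i, 2 * a), (j, b), (k, c)],
    word d (if m = 0 then p else 0) [(i, a), (j, 2 * b), (k, 2 * c)],
    word d (if m = 1 then p else 0) [(i, a), (j, 2 * b), (k, c)],
    word d (if m = 1 then p else 0) [(i, 2 * a), (j, b), (k, 2 * c)],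
    word d (if m = 2 then p else 0) [(i, a), (j, b), (k, 2 * c)],
    word d (if m = 2 then p else 0) [(i, 2 * a), (j, 2 * b), (k, c)]]

set_option maxRecDepth 100000 in
theorem refute_mixed_mixed : ∀ s ∈ [1, 2], ∀ t ∈ [1, 2], ∀ m ∈ [0, 1, 2], ∀ m' ∈ [0, 1, 2],
    refute 5 (hubWords 5 [0, 1, 2, 3] ++ altWords 5 0 1 1
      ++ altWords 5 0 2 1 ++ altWords 5 1 2 1 ++ altWords 5 0 3 1 ++ altWords 5 1 3 s
      ++ altWords 5 2 3 t ++ mixedWords 5 0 1 2 1 1 1 m 1 ++ mixedWords 5 0 1 3 s 1 1 m' s)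
      = true := by
  decide +kernel

/-- All 3^6 colourings of the six points around an alternating triangle of sign one: outside the two
zero patterns and the three exceptional ones, the search finds a contradiction. -/
theorem mixed_cases : ∀ a ∈ [0, 1, 2], ∀ b ∈ [0, 1, 2], ∀ c ∈ [0, 1, 2], ∀ a' ∈ [0, 1, 2],
    ∀ b' ∈ [0, 1, 2], ∀ c' ∈ [0, 1, 2],
    (a = 0 ∧ b = 0 ∧ c = 0) ∨ (a' = 0 ∧ b' = 0 ∧ c' = 0) ∨
    (∃ m ∈ [0, 1, 2], (a = if m = 0 then 1 else 0) ∧ (a' = if m = 0 then 1 else 0) ∧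
      (b = if m = 1 then 1 else 0) ∧ (b' = if m = 1 then 1 else 0) ∧
      (c = if m = 2 then 1 else 0) ∧ (c' = if m = 2 then 1 else 0)) ∨
    refute 4 (hubWords 4 [0, 1, 2] ++ altWords 4 0 1 1 ++ altWords 4 0 2 1 ++ altWords 4 1 2 1
      ++ [word 4 a [(0, 2), (1, 1), (2, 1)], word 4 a' [(0, 1), (1, 2), (2, 2)],
        word 4 b [(0, 1), (1, 2), (2, 1)], word 4 b' [(0, 2), (1, 1), (2, 2)],
        word 4 c [(0, 1), (1, 1), (2, 2)], word 4 c' [(0, 2), (1, 2), (2, 1)]]) = true := by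
  decide +kernel

end HammingThree

/-! ### Hubs, alternating and leading pairs, and their word forms. -/

namespace HammingThree

variable {ι : Type*} [DecidableEq ι]

/-- `x` has colour `c` and no other. -/
def Only (f : (ι → ZMod 3) → ZMod 3 → Prop) (x : ι → ZMod 3) (c : ZMod 3) : Prop :=
  ∀ d, f x d ↔ d = c

/-- All the neighbours of `p` in the directions of `V` have colour `c` and no other. -/
def Hub (f : (ι → ZMod 3) → ZMod 3 → Prop) (p : ι → ZMod 3) (V : Set ι) (c : ZMod 3) : Prop :=
  ∀ j ∈ V, ∀ a ≠ 0, Only f (p + Pi.single j a) c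

/-- The colours at `p + a eⱼ + b eₖ` with `a, b ≠ 0` are `c + s a b`. -/
def Alt (f : (ι → ZMod 3) → ZMod 3 → Prop) (p : ι → ZMod 3) (c : ZMod 3) (j k : ι) (s : ZMod 3) :
    Prop :=
  s ≠ 0 ∧ ∀ a b, a ≠ 0 → b ≠ 0 → Only f (p + Pi.single j a + Pi.single k b) (c + s * a * b)

/-- The colours at `p + a eⱼ + b eₖ` with `a, b ≠ 0` are `c + s b`. -/
def Dom (f : (ι → ZMod 3) → ZMod 3 → Prop) (p : ι → ZMod 3) (c : ZMod 3) (j k : ι) (s : ZMod 3) :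
    Prop :=
  s ≠ 0 ∧ ∀ a b, a ≠ 0 → b ≠ 0 → Only f (p + Pi.single j a + Pi.single k b) (c + s * b)

variable {f : (ι → ZMod 3) → ZMod 3 → Prop} {p : ι → ZMod 3} {V : Set ι} {c s σ τ κ : ZMod 3}
  {j k : ι} {js : List (ι × ZMod 3)}

omit [DecidableEq ι] in
theorem Only.self {x : ι → ZMod 3} (h : Only f x c) : f x c := (h c).2 rfl

theorem Alt.symm (h : Alt f p c j k s) : Alt f p c k j s :=
  ⟨h.1, fun a b ha hb => by
    have := h.2 b a hb ha
    rwa [add_right_comm, mul_right_comm] at this⟩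

theorem mul_self_of_ne_zero {a : ZMod 3} (h : a ≠ 0) : a * a = 1 := by
  revert a; decide

theorem exists_sign {a : ZMod 3} (h : a ≠ 0) : ∃ t : ℕ, t ∈ [1, 2] ∧ (t : ZMod 3) = a := by
  rcases (by revert a; decide : a = 1 ∨ a = 2) with rfl | rfl
  · exact ⟨1, by decide⟩
  · exact ⟨2, by decide⟩

theorem disp_set (js : List (ι × ZMod 3)) (as : List ℕ) (i a : ℕ) (hl : as.length = js.length)
    (hj : js[i]? = some (j, σ)) (h0 : as[i]? = some 0) :
    disp js (as.set i a) = disp js as + Pi.single j (σ * a) := by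
  induction js generalizing as i with
  | nil => simp at hj
  | cons k js ih =>
    obtain ⟨b, as, rfl⟩ := List.exists_cons_of_length_eq_add_one hl
    cases i with
    | zero =>
      simp only [List.getElem?_cons_zero, Option.some.injEq] at hj h0
      subst hj h0
      simp [disp, add_comm]
    | succ i =>
      simp only [List.getElem?_cons_succ] at hj h0
      simp only [List.set_cons_succ, disp]
      rw [ih as i (by simpa using hl) hj h0, add_assoc]

theorem disp_replicate_zero (js : List (ι × ZMod 3)) (n : ℕ) :
    disp js (List.replicate n 0) = 0 := by
  induction js generalizing n with
  | nil => simp [disp]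
  | cons k js ih =>
    cases n with
    | zero => simp [disp]
    | succ n => simp [disp, List.replicate_succ, ih]

theorem natCast_mod_three (a : ℕ) : ((a % 3 : ℕ) : ZMod 3) = a := ZMod.natCast_mod a 3

theorem foldl_set_cons (l : List (ℕ × ℕ)) (c : ℕ) (as : List ℕ) :
    l.foldl (fun w x => w.set (x.1 + 1) (x.2 % 3)) (c :: as) =
      c :: l.foldl (fun w x => w.set x.1 (x.2 % 3)) as := by
  induction l generalizing as with
  | nil => rfl
  | cons x l ih => simp [ih]

theorem disp_foldl_set (js : List (ι × ZMod 3)) (l : List (ℕ × ℕ)) (as : List ℕ)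
    (hl : as.length = js.length) (hn : (l.map Prod.fst).Nodup)
    (h0 : ∀ x ∈ l, as[x.1]? = some 0) (x : ι → ZMod 3)
    (hx : x = (l.map fun y => Pi.single ((js[y.1]?.map Prod.fst).getD j)
      ((js[y.1]?.map Prod.snd).getD 0 * (y.2 : ZMod 3))).sum) :
    disp js (l.foldl (fun w x => w.set x.1 (x.2 % 3)) as) = disp js as + x := by
  induction l generalizing as x with
  | nil => simp_all
  | cons y l ih =>
    simp only [List.map_cons, List.sum_cons] at hx
    simp only [List.foldl_cons]
    have hy := h0 y (by simp)
    have hlt : y.1 < js.length := by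
      rw [← hl]; exact (List.getElem?_eq_some_iff.1 hy).1
    rw [List.map_cons, List.nodup_cons] at hn
    rw [ih (as.set y.1 (y.2 % 3)) (by simpa using hl) hn.2 ?_ _ rfl,
      disp_set js as y.1 _ hl (List.getElem?_eq_getElem hlt) hy, hx, natCast_mod_three]
    · simp [hlt, add_assoc]
    · intro z hz
      rw [List.getElem?_set_ne, h0 z (by simp [hz])]
      rintro h
      exact hn.1 (h ▸ List.mem_map_of_mem hz)

/-- The defaults `j` and `0` are never reached, since `hl` keeps all indices in range. -/
theorem pull_word_iff (l : List (ℕ × ℕ)) (t : ℕ) (hn : (l.map Prod.fst).Nodup)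
    (hl : ∀ x ∈ l, x.1 < js.length) :
    pull f p js c κ (word (js.length + 1) t l) ↔
      f (p + (l.map fun y => Pi.single ((js[y.1]?.map Prod.fst).getD j)
        ((js[y.1]?.map Prod.snd).getD 0 * (y.2 : ZMod 3))).sum) (c + κ * t) := by
  rw [word, foldl_set_cons, pull, natCast_mod_three, Nat.add_sub_cancel,
    disp_foldl_set js l _ (by simp) hn (fun x hx => by simp [hl x hx]) _ rfl,
    disp_replicate_zero, zero_add]

theorem pull_word_one {i a t : ℕ} (hi : js[i]? = some (j, σ)) :
    pull f p js c κ (word (js.length + 1) t [(i, a)]) ↔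
      f (p + Pi.single j (σ * a)) (c + κ * t) := by
  have := (List.getElem?_eq_some_iff.1 hi).1
  rw [pull_word_iff (j := j) _ _ (by simp) (by simpa)]
  simp [hi]

theorem pull_word_two {i a i' b t : ℕ} (hi : js[i]? = some (j, σ)) (hi' : js[i']? = some (k, τ))
    (hne : i ≠ i') :
    pull f p js c κ (word (js.length + 1) t [(i, a), (i', b)]) ↔
      f (p + Pi.single j (σ * a) + Pi.single k (τ * b)) (c + κ * t) := by
  have h := (List.getElem?_eq_some_iff.1 hi).1
  have h' := (List.getElem?_eq_some_iff.1 hi').1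
  rw [pull_word_iff (j := j) _ _ (by simp [hne]) (by simp [h, h'])]
  simp [hi, hi', add_assoc]

theorem pull_word_three {i a i' b i'' e t : ℕ} {l : ι} {υ : ZMod 3} (hi : js[i]? = some (j, σ))
    (hi' : js[i']? = some (k, τ)) (hi'' : js[i'']? = some (l, υ)) (hn : [i, i', i''].Nodup) :
    pull f p js c κ (word (js.length + 1) t [(i, a), (i', b), (i'', e)]) ↔
      f (p + Pi.single j (σ * a) + Pi.single k (τ * b) + Pi.single l (υ * e)) (c + κ * t) := by
  have h := (List.getElem?_eq_some_iff.1 hi).1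
  have h' := (List.getElem?_eq_some_iff.1 hi').1
  have h'' := (List.getElem?_eq_some_iff.1 hi'').1
  rw [pull_word_iff (j := j) _ _ (by simpa using hn) (by simp [h, h', h''])]
  simp [hi, hi', hi'', add_assoc]

theorem natCast_one_or_two : ∀ a ∈ [1, 2], ((a : ℕ) : ZMod 3) ≠ 0 := by decide

theorem Hub.pull (h : Hub f p V c) (h0 : ∀ j ∈ js, j.2 ≠ 0) (is : List ℕ)
    (hV : ∀ i ∈ is, ∃ x, js[i]? = some x ∧ x.1 ∈ V) :
    ∀ w ∈ hubWords (js.length + 1) is, pull f p js c κ w := by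
  intro w hw
  obtain ⟨i, hi, hw⟩ := List.mem_flatMap.1 hw
  obtain ⟨⟨j, σ⟩, hij, hj⟩ := hV i hi
  have hσ : σ ≠ 0 := h0 _ (List.mem_of_getElem? hij)
  have key : ∀ a ∈ [1, 2], HammingThree.pull f p js c κ (word (js.length + 1) 0 [(i, a)]) := by
    intro a ha
    rw [pull_word_one hij]
    have := h j hj (σ * a) (mul_ne_zero hσ (natCast_one_or_two a ha))
    simpa using this.self
  simp only [List.mem_cons, List.not_mem_nil, or_false] at hw
  rcases hw with rfl | rfl <;> exact key _ (by simp)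

/-- Scaling the two directions by σ, τ and the colours by κ replaces the sign s by s σ τ / κ, which
`ht` names t. -/
theorem Alt.pull (h : Alt f p c j k s) {i i' t : ℕ} (h0 : ∀ j ∈ js, j.2 ≠ 0)
    (hi : js[i]? = some (j, σ)) (hi' : js[i']? = some (k, τ)) (hne : i ≠ i')
    (ht : κ * t = s * σ * τ) : ∀ w ∈ altWords (js.length + 1) i i' t, pull f p js c κ w := by
  have hσ : σ ≠ 0 := h0 _ (List.mem_of_getElem? hi)
  have hτ : τ ≠ 0 := h0 _ (List.mem_of_getElem? hi')
  have key : ∀ a b m : ℕ, a ∈ [1, 2] → b ∈ [1, 2] → (m : ZMod 3) = t * a * b →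
      HammingThree.pull f p js c κ (word (js.length + 1) m [(i, a), (i', b)]) := by
    intro a b m ha hb hm
    rw [pull_word_two hi hi' hne]
    have := (h.2 (σ * a) (τ * b) (mul_ne_zero hσ (natCast_one_or_two a ha))
      (mul_ne_zero hτ (natCast_one_or_two b hb))).self
    convert this using 2
    rw [hm]; linear_combination (a * b : ZMod 3) * ht
  intro w hw
  simp only [altWords, List.mem_cons, List.not_mem_nil, or_false] at hw
  have h3 : (3 : ZMod 3) = 0 := by decide
  rcases hw with rfl | rfl | rfl | rfl <;> refine key _ _ _ (by simp) (by simp) ?_ <;> push_cast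
  · ring
  · ring
  · ring
  · linear_combination (-(t : ZMod 3)) * h3

theorem Dom.pull (h : Dom f p c j k s) {i i' t : ℕ} (h0 : ∀ j ∈ js, j.2 ≠ 0)
    (hi : js[i]? = some (j, σ)) (hi' : js[i']? = some (k, τ)) (hne : i ≠ i')
    (ht : κ * t = s * τ) : ∀ w ∈ domWords (js.length + 1) i i' t, pull f p js c κ w := by
  have hσ : σ ≠ 0 := h0 _ (List.mem_of_getElem? hi)
  have hτ : τ ≠ 0 := h0 _ (List.mem_of_getElem? hi')
  have key : ∀ a b m : ℕ, a ∈ [1, 2] → b ∈ [1, 2] → (m : ZMod 3) = t * b →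
      HammingThree.pull f p js c κ (word (js.length + 1) m [(i, a), (i', b)]) := by
    intro a b m ha hb hm
    rw [pull_word_two hi hi' hne]
    have := (h.2 (σ * a) (τ * b) (mul_ne_zero hσ (natCast_one_or_two a ha))
      (mul_ne_zero hτ (natCast_one_or_two b hb))).self
    convert this using 2
    rw [hm]; linear_combination (b : ZMod 3) * ht
  intro w hw
  simp only [domWords, List.mem_cons, List.not_mem_nil, or_false] at hw
  rcases hw with rfl | rfl | rfl | rfl <;> refine key _ _ _ (by simp) (by simp) ?_ <;> push_cast <;>
    ring

/-- Moving the base point to the slice and shifting the colours by κ a turns words of slice zero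
into words of slice a. -/
theorem pull_slice {i a : ℕ} (hi : js[i]? = some (j, σ)) {w : List ℕ}
    (hw : w.length = js.length + 1) (h0 : w[i + 1]? = some 0)
    (h : pull f (p + Pi.single j (σ * a)) js (c + κ * a) κ w) :
    pull f p js c κ ((w.headI + a) % 3 :: w.tail.set i a) := by
  obtain ⟨t, as, rfl⟩ := List.exists_cons_of_length_eq_add_one hw
  simp only [List.headI, List.tail, pull] at h ⊢
  rw [disp_set js as i a (by simpa using hw) hi (by simpa using h0), natCast_mod_three]
  convert h using 1
  · abel
  · push_cast; ring

theorem pull_sliceWords {i a : ℕ} (hi : js[i]? = some (j, σ)) {ws : List (List ℕ)}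
    (hws : ∀ w ∈ ws, w.length = js.length + 1 ∧ w[i + 1]? = some 0)
    (h : ∀ w ∈ ws, pull f (p + Pi.single j (σ * a)) js (c + κ * a) κ w) :
    ∀ w ∈ sliceWords i a ws, pull f p js c κ w := by
  intro w hw
  obtain ⟨v, hv, rfl⟩ := List.mem_map.1 hw
  exact pull_slice hi (hws v hv).1 (hws v hv).2 (h v hv)

end HammingThree

/-! ### Forbidden configurations at a hub. -/

namespace HammingThree

variable {ι : Type*} [DecidableEq ι]

variable {f : (ι → ZMod 3) → ZMod 3 → Prop} {p : ι → ZMod 3} {V : Set ι} {c s t u : ZMod 3}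
  {i j k l : ι}

/-- Rescaling the led direction absorbs the sign of a dominance. In a cycle every direction is led
exactly once, so all signs become one. -/
theorem Valid.not_cycle (hf : Valid f) (H : Hub f p V c) (hn : [i, j, k].Nodup)
    (hV : ∀ x ∈ [i, j, k], x ∈ V) (h₁ : Dom f p c i j s) (h₂ : Dom f p c j k t)
    (h₃ : Dom f p c k i u) : False := by
  have h0 : ∀ x ∈ [(i, u), (j, s), (k, t)], x.2 ≠ 0 := by simp [h₁.1, h₂.1, h₃.1]
  have e₁ := mul_self_of_ne_zero h₁.1
  have e₂ := mul_self_of_ne_zero h₂.1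
  have e₃ := mul_self_of_ne_zero h₃.1
  refine hf.refuted refute_cycle p [(i, u), (j, s), (k, t)] rfl hn h0 c 1 one_ne_zero ?_
  simp only [List.forall_mem_append]
  exact ⟨⟨⟨H.pull h0 _ (by simpa using hV), h₁.pull h0 rfl rfl (by decide) (by simp [e₁])⟩,
    h₂.pull h0 rfl rfl (by decide) (by simp [e₂])⟩, h₃.pull h0 rfl rfl (by decide) (by simp [e₃])⟩

/-- With colour scale κ, the dominances force the scalings κ t and κ u on i and j, and the
alternation then forces κ = s t u. -/
theorem Valid.not_alt_dom_dom (hf : Valid f) (H : Hub f p V c) (hn : [i, j, k].Nodup)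
    (hV : ∀ x ∈ [i, j, k], x ∈ V) (h₁ : Alt f p c i j s) (h₂ : Dom f p c k i t)
    (h₃ : Dom f p c k j u) : False := by
  have hκ : s * t * u ≠ 0 := mul_ne_zero (mul_ne_zero h₁.1 h₂.1) h₃.1
  have h0 : ∀ x ∈ [(i, s * t * u * t), (j, s * t * u * u), (k, 1)], x.2 ≠ 0 := by
    simp [h₁.1, h₂.1, h₃.1]
  have key : ∀ s t u : ZMod 3, s ≠ 0 → t ≠ 0 → u ≠ 0 →
      s * t * u * (1 : ℕ) = s * (s * t * u * t) * (s * t * u * u) ∧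
      s * t * u * (1 : ℕ) = t * (s * t * u * t) ∧ s * t * u * (1 : ℕ) = u * (s * t * u * u) := by
    decide
  obtain ⟨e₁, e₂, e₃⟩ := key s t u h₁.1 h₂.1 h₃.1
  refine hf.refuted refute_alt_dom_dom p [(i, s * t * u * t), (j, s * t * u * u), (k, 1)] rfl hn
    h0 c (s * t * u) hκ ?_
  simp only [List.forall_mem_append]
  exact ⟨⟨⟨H.pull h0 _ (by simpa using hV), h₁.pull h0 rfl rfl (by decide) e₁⟩,
    h₂.pull h0 rfl rfl (by decide) e₂⟩, h₃.pull h0 rfl rfl (by decide) e₃⟩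

theorem Valid.not_dom_alt_dom (hf : Valid f) (H : Hub f p V c) (hn : [i, j, k].Nodup)
    (hV : ∀ x ∈ [i, j, k], x ∈ V) (h₁ : Alt f p c i j s) (h₂ : Dom f p c k i t)
    (h₃ : Dom f p c j k u) : False := by
  have h0 : ∀ x ∈ [(i, t), (j, s * t), (k, u)], x.2 ≠ 0 := by
    simp [h₁.1, h₂.1, h₃.1]
  have key : ∀ s t u : ZMod 3, s ≠ 0 → t ≠ 0 → u ≠ 0 →
      1 * ((1 : ℕ) : ZMod 3) = s * t * (s * t) ∧ 1 * ((1 : ℕ) : ZMod 3) = t * t ∧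
      1 * ((1 : ℕ) : ZMod 3) = u * u := by
    decide
  obtain ⟨e₁, e₂, e₃⟩ := key s t u h₁.1 h₂.1 h₃.1
  refine hf.refuted refute_alt_dom_dom' p [(i, t), (j, s * t), (k, u)] rfl hn
    h0 c 1 one_ne_zero ?_
  simp only [List.forall_mem_append]
  exact ⟨⟨⟨H.pull h0 _ (by simpa using hV), h₁.pull h0 rfl rfl (by decide) e₁⟩,
    h₂.pull h0 rfl rfl (by decide) e₂⟩, h₃.pull h0 rfl rfl (by decide) e₃⟩

theorem one_mul_one_eq {a b : ZMod 3} (ha : a ≠ 0) (h : b = 1) :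
    1 * ((1 : ℕ) : ZMod 3) = a * b * a := by
  rw [h]; revert a; decide

/-- Different signs would be opposite; rescaling k by t makes them 1 and 2, the pair that
`refute_alt_signs` excludes. -/
theorem Valid.dom_sign_eq (hf : Valid f) (H : Hub f p V c) (hn : [i, j, k].Nodup)
    (hV : ∀ x ∈ [i, j, k], x ∈ V) (h₁ : Alt f p c i j s) (h₂ : Dom f p c i k t)
    (h₃ : Dom f p c j k u) : t = u := by
  by_contra htu
  have h0 : ∀ x ∈ [(i, 1), (j, s), (k, t)], x.2 ≠ 0 := by simp [h₁.1, h₂.1]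
  have key : ∀ t u : ZMod 3, t ≠ 0 → u ≠ 0 → t ≠ u →
      1 * ((1 : ℕ) : ZMod 3) = t * t ∧ 1 * ((2 : ℕ) : ZMod 3) = u * t := by
    decide
  obtain ⟨e₂, e₃⟩ := key t u h₂.1 h₃.1 htu
  have e₁ := one_mul_one_eq h₁.1 rfl
  refine hf.refuted refute_alt_signs p [(i, 1), (j, s), (k, t)] rfl hn h0 c 1 one_ne_zero ?_
  simp only [List.forall_mem_append]
  exact ⟨⟨⟨H.pull h0 _ (by simpa using hV), h₁.pull h0 rfl rfl (by decide) e₁⟩,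
    h₂.pull h0 rfl rfl (by decide) e₂⟩, h₃.pull h0 rfl rfl (by decide) e₃⟩

/-- Rescaling j, k, l makes the three alternations at i positive; the other three signs are
enumerated. The same normalisation serves `Valid.not_paw`. -/
theorem Valid.not_star (hf : Valid f) (H : Hub f p V c) (hn : [i, j, k, l].Nodup)
    (hV : ∀ x ∈ [i, j, k, l], x ∈ V) {a b d : ZMod 3} (h₁ : Alt f p c i j a)
    (h₂ : Alt f p c i k b) (h₃ : Alt f p c i l d) (h₄ : Dom f p c j k s) (h₅ : Dom f p c j l t)
    (h₆ : Dom f p c k l u) : False := by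
  obtain ⟨x, hx, ex⟩ := exists_sign (mul_ne_zero h₄.1 h₂.1)
  obtain ⟨y, hy, ey⟩ := exists_sign (mul_ne_zero h₅.1 h₃.1)
  obtain ⟨z, hz, ez⟩ := exists_sign (mul_ne_zero h₆.1 h₃.1)
  have h0 : ∀ x ∈ [(i, 1), (j, a), (k, b), (l, d)], x.2 ≠ 0 := by simp [h₁.1, h₂.1, h₃.1]
  refine hf.refuted (refute_star x hx y hy z hz) p [(i, 1), (j, a), (k, b), (l, d)] rfl hn h0 c 1
    one_ne_zero ?_
  simp only [List.forall_mem_append]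
  exact ⟨⟨⟨⟨⟨⟨H.pull h0 _ (by simpa using hV),
    h₁.pull h0 rfl rfl (by decide) (one_mul_one_eq h₁.1 rfl)⟩,
    h₂.pull h0 rfl rfl (by decide) (one_mul_one_eq h₂.1 rfl)⟩,
    h₃.pull h0 rfl rfl (by decide) (one_mul_one_eq h₃.1 rfl)⟩,
    h₄.pull h0 rfl rfl (by decide) (by rw [ex, one_mul])⟩,
    h₅.pull h0 rfl rfl (by decide) (by rw [ey, one_mul])⟩,
    h₆.pull h0 rfl rfl (by decide) (by rw [ez, one_mul])⟩

theorem Valid.not_paw (hf : Valid f) (H : Hub f p V c) (hn : [i, j, k, l].Nodup)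
    (hV : ∀ x ∈ [i, j, k, l], x ∈ V) {a b d : ZMod 3} (h₁ : Alt f p c i j a)
    (h₂ : Alt f p c i k b) (h₃ : Alt f p c i l d) (h₄ : Alt f p c j k s) (h₅ : Dom f p c j l t)
    (h₆ : Dom f p c k l u) : False := by
  obtain ⟨x, hx, ex⟩ := exists_sign (mul_ne_zero (mul_ne_zero h₄.1 h₁.1) h₂.1)
  obtain ⟨y, hy, ey⟩ := exists_sign (mul_ne_zero h₅.1 h₃.1)
  obtain ⟨z, hz, ez⟩ := exists_sign (mul_ne_zero h₆.1 h₃.1)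
  have h0 : ∀ x ∈ [(i, 1), (j, a), (k, b), (l, d)], x.2 ≠ 0 := by simp [h₁.1, h₂.1, h₃.1]
  refine hf.refuted (refute_paw x hx y hy z hz) p [(i, 1), (j, a), (k, b), (l, d)] rfl hn h0 c 1
    one_ne_zero ?_
  simp only [List.forall_mem_append]
  exact ⟨⟨⟨⟨⟨⟨H.pull h0 _ (by simpa using hV),
    h₁.pull h0 rfl rfl (by decide) (one_mul_one_eq h₁.1 rfl)⟩,
    h₂.pull h0 rfl rfl (by decide) (one_mul_one_eq h₂.1 rfl)⟩,
    h₃.pull h0 rfl rfl (by decide) (one_mul_one_eq h₃.1 rfl)⟩,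
    h₄.pull h0 rfl rfl (by decide) (by rw [ex, one_mul])⟩,
    h₅.pull h0 rfl rfl (by decide) (by rw [ey, one_mul])⟩,
    h₆.pull h0 rfl rfl (by decide) (by rw [ez, one_mul])⟩

theorem Valid.not_square (hf : Valid f) (H : Hub f p V c) (hn : [i, j, k, l].Nodup)
    (hV : ∀ x ∈ [i, j, k, l], x ∈ V) {a b d : ZMod 3} (h₁ : Alt f p c i j a)
    (h₂ : Alt f p c j k b) (h₃ : Alt f p c k l d) (h₄ : Alt f p c i l s) (h₅ : Dom f p c i k t)
    (h₆ : Dom f p c j l u) : False := by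
  have hab := mul_ne_zero h₁.1 h₂.1
  have habd := mul_ne_zero hab h₃.1
  obtain ⟨x, hx, ex⟩ := exists_sign (mul_ne_zero h₄.1 habd)
  obtain ⟨y, hy, ey⟩ := exists_sign (mul_ne_zero h₅.1 hab)
  obtain ⟨z, hz, ez⟩ := exists_sign (mul_ne_zero h₆.1 habd)
  have h0 : ∀ x ∈ [(i, 1), (j, a), (k, a * b), (l, a * b * d)], x.2 ≠ 0 := by
    simp [h₁.1, h₂.1, h₃.1]
  have key : ∀ a b d : ZMod 3, a ≠ 0 → b ≠ 0 → d ≠ 0 → 1 * ((1 : ℕ) : ZMod 3) = b * a * (a * b) ∧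
      1 * ((1 : ℕ) : ZMod 3) = d * (a * b) * (a * b * d) := by decide
  obtain ⟨e₂, e₃⟩ := key a b d h₁.1 h₂.1 h₃.1
  refine hf.refuted (refute_square x hx y hy z hz) p [(i, 1), (j, a), (k, a * b), (l, a * b * d)]
    rfl hn h0 c 1 one_ne_zero ?_
  simp only [List.forall_mem_append]
  exact ⟨⟨⟨⟨⟨⟨H.pull h0 _ (by simpa using hV),
    h₁.pull h0 rfl rfl (by decide) (one_mul_one_eq h₁.1 rfl)⟩,
    h₂.pull h0 rfl rfl (by decide) e₂⟩,
    h₃.pull h0 rfl rfl (by decide) e₃⟩,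
    h₄.pull h0 rfl rfl (by decide) (by rw [ex]; ring)⟩,
    h₅.pull h0 rfl rfl (by decide) (by rw [ey, one_mul])⟩,
    h₆.pull h0 rfl rfl (by decide) (by rw [ez, one_mul])⟩

/-- The six points with two of the coordinates `σ` and the others zero cannot have one colour. -/
theorem Valid.not_alt_hom (hf : Valid f) (H : Hub f p V c) (hn : [i, j, k, l].Nodup)
    (hV : ∀ x ∈ [i, j, k, l], x ∈ V) {a₁ a₂ a₃ a₄ a₅ a₆ σ₁ σ₂ σ₃ σ₄ : ZMod 3}
    (hu : u ≠ 0) (h0 : ∀ x ∈ [(i, σ₁), (j, σ₂), (k, σ₃), (l, σ₄)], x.2 ≠ 0)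
    (h₁ : Alt f p c i j a₁) (h₂ : Alt f p c i k a₂) (h₃ : Alt f p c i l a₃)
    (h₄ : Alt f p c j k a₄) (h₅ : Alt f p c j l a₅) (h₆ : Alt f p c k l a₆)
    (e₁ : a₁ * σ₁ * σ₂ = u) (e₂ : a₂ * σ₁ * σ₃ = u) (e₃ : a₃ * σ₁ * σ₄ = u)
    (e₄ : a₄ * σ₂ * σ₃ = u) (e₅ : a₅ * σ₂ * σ₄ = u) (e₆ : a₆ * σ₃ * σ₄ = u) : False := by
  refine hf.refuted refute_K4 p [(i, σ₁), (j, σ₂), (k, σ₃), (l, σ₄)] rfl hn h0 c u hu ?_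
  simp only [List.forall_mem_append]
  exact ⟨⟨⟨⟨⟨⟨H.pull h0 _ (by simpa using hV),
    h₁.pull h0 rfl rfl (by decide) (by simp [e₁])⟩,
    h₂.pull h0 rfl rfl (by decide) (by simp [e₂])⟩,
    h₃.pull h0 rfl rfl (by decide) (by simp [e₃])⟩,
    h₄.pull h0 rfl rfl (by decide) (by simp [e₄])⟩,
    h₅.pull h0 rfl rfl (by decide) (by simp [e₅])⟩,
    h₆.pull h0 rfl rfl (by decide) (by simp [e₆])⟩

theorem Valid.not_alt_hom_of_dom (hf : Valid f) (H : Hub f p V c) (hn : [i, j, k, l].Nodup)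
    (hV : ∀ x ∈ [i, j, k, l], x ∈ V) {a₁ a₂ a₃ a₄ a₅ a₆ σ₁ σ₂ σ₃ σ₄ : ZMod 3}
    (hu : u ≠ 0) (h0 : ∀ x ∈ [(i, σ₁), (j, σ₂), (k, σ₃), (l, σ₄)], x.2 ≠ 0)
    (h₁ : Dom f p c i j a₁) (h₂ : Alt f p c i k a₂) (h₃ : Alt f p c i l a₃)
    (h₄ : Alt f p c j k a₄) (h₅ : Alt f p c j l a₅) (h₆ : Alt f p c k l a₆)
    (e₂ : a₂ * σ₁ * σ₃ = u) (e₃ : a₃ * σ₁ * σ₄ = u)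
    (e₄ : a₄ * σ₂ * σ₃ = u) (e₅ : a₅ * σ₂ * σ₄ = u) (e₆ : a₆ * σ₃ * σ₄ = u) : False := by
  obtain ⟨x, hx, ex⟩ := exists_sign (mul_ne_zero (mul_ne_zero hu h₁.1) (h0 (j, σ₂) (by simp)))
  have hu2 := mul_self_of_ne_zero hu
  refine hf.refuted (refute_K4_minus_edge x hx) p [(i, σ₁), (j, σ₂), (k, σ₃), (l, σ₄)] rfl hn h0 c
    u hu ?_
  simp only [List.forall_mem_append]
  exact ⟨⟨⟨⟨⟨⟨H.pull h0 _ (by simpa using hV),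
    h₁.pull h0 rfl rfl (by decide) (by rw [ex]; linear_combination (a₁ * σ₂) * hu2)⟩,
    h₂.pull h0 rfl rfl (by decide) (by simp [e₂])⟩,
    h₃.pull h0 rfl rfl (by decide) (by simp [e₃])⟩,
    h₄.pull h0 rfl rfl (by decide) (by simp [e₄])⟩,
    h₅.pull h0 rfl rfl (by decide) (by simp [e₅])⟩,
    h₆.pull h0 rfl rfl (by decide) (by simp [e₆])⟩

/-- Let κ be the product of the signs in slice 0. With colour scale κ that triangle becomes all
positive, and the slice at κ s becomes slice 1 of `refute_slices`, where a reversed sign of i, j is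
excluded whatever the other two signs are there. -/
theorem Valid.alt_sign_slice_eq (hf : Valid f) (hn : [i, j, k, l].Nodup)
    (hV : ∀ x ∈ [i, j, k], x ∈ V) (hs : s ≠ 0)
    (H : ∀ a, Hub f (p + Pi.single l a) V (c + s * a)) {x y z : ZMod 3 → ZMod 3}
    (h₁ : ∀ a, Alt f (p + Pi.single l a) (c + s * a) i j (x a))
    (h₂ : ∀ a, Alt f (p + Pi.single l a) (c + s * a) i k (y a))
    (h₃ : ∀ a, Alt f (p + Pi.single l a) (c + s * a) j k (z a)) :
    x (x 0 * y 0 * z 0 * s) = x 0 := by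
  by_contra hne
  have hx := fun a => (h₁ a).1
  have hy := fun a => (h₂ a).1
  have hz := fun a => (h₃ a).1
  set κ := x 0 * y 0 * z 0
  have hκ : κ ≠ 0 := mul_ne_zero (mul_ne_zero (hx 0) (hy 0)) (hz 0)
  obtain ⟨b, hb, eb⟩ := exists_sign (mul_ne_zero hκ (mul_ne_zero (mul_ne_zero (hy (κ * s)) (hz 0))
    (hx 0)))
  obtain ⟨d, hd, ed⟩ := exists_sign (mul_ne_zero hκ (mul_ne_zero (mul_ne_zero (hz (κ * s)) (hy 0))
    (hx 0)))
  have hκ2 := mul_self_of_ne_zero hκ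
  have hs2 := mul_self_of_ne_zero hs
  have key : ∀ x y z : ZMod 3, x ≠ 0 → y ≠ 0 → z ≠ 0 →
      x * y * z * (1 : ℕ) = x * z * y ∧ x * y * z * (1 : ℕ) = y * z * x ∧
      x * y * z * (1 : ℕ) = z * y * x := by decide
  have key2 : ∀ x w : ZMod 3, x ≠ 0 → w ≠ 0 → w ≠ x → x * (2 : ℕ) = w := by decide
  obtain ⟨e₁, e₂, e₃⟩ := key _ _ _ (hx 0) (hy 0) (hz 0)
  have h0 : ∀ w ∈ [(i, z 0), (j, y 0), (k, x 0), (l, κ * s)], w.2 ≠ 0 := by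
    simp [hx, hy, hz, hκ, hs]
  have hcs : ∀ a : ZMod 3, c + s * (κ * s * a) = c + κ * a := by
    intro a; linear_combination κ * a * hs2
  have g₀ := H 0
  have g₁ := h₁ 0
  have g₂ := h₂ 0
  have g₃ := h₃ 0
  simp only [Pi.single_zero, mul_zero, add_zero] at g₀ g₁ g₂ g₃
  have q₁ := h₁ (κ * s * (1 : ℕ))
  have q₂ := h₂ (κ * s * (1 : ℕ))
  have q₃ := h₃ (κ * s * (1 : ℕ))
  have r₁ := H (κ * s * (1 : ℕ))
  have r₂ := H (κ * s * (2 : ℕ))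
  rw [hcs] at q₁ q₂ q₃ r₁ r₂
  have hd₁ : ∀ b ∈ [1, 2], ∀ d ∈ [1, 2], ∀ w ∈ hubWords 5 [0, 1, 2] ++ altWords 5 0 1 2 ++
      altWords 5 0 2 b ++ altWords 5 1 2 d, w.length = 5 ∧ w[4]? = some 0 := by decide
  have hd₂ : ∀ w ∈ hubWords 5 [0, 1, 2], w.length = 5 ∧ w[4]? = some 0 := by decide
  refine hf.refuted (refute_slices b hb d hd) p [(i, z 0), (j, y 0), (k, x 0), (l, κ * s)] rfl hn
    h0 c κ hκ ?_
  simp only [List.forall_mem_append]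
  refine ⟨⟨⟨⟨⟨g₀.pull h0 _ (by simpa using hV),
    g₁.pull h0 rfl rfl (by decide) e₁⟩, g₂.pull h0 rfl rfl (by decide) e₂⟩,
    g₃.pull h0 rfl rfl (by decide) e₃⟩,
    pull_sliceWords (js := [(i, z 0), (j, y 0), (k, x 0), (l, κ * s)]) rfl (hd₁ b hb d hd) ?_⟩,
    pull_sliceWords (js := [(i, z 0), (j, y 0), (k, x 0), (l, κ * s)]) rfl hd₂ ?_⟩
  · simp only [List.forall_mem_append]
    refine ⟨⟨⟨r₁.pull h0 _ (by simpa using hV), q₁.pull h0 rfl rfl (by decide) ?_⟩,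
      q₂.pull h0 rfl rfl (by decide) ?_⟩, q₃.pull h0 rfl rfl (by decide) ?_⟩
    · rw [Nat.cast_one, mul_one]
      linear_combination (y 0 * z 0) * key2 _ _ (hx 0) (hx _) hne
    · rw [eb, Nat.cast_one, mul_one]
      linear_combination (y (κ * s) * z 0 * x 0) * hκ2
    · rw [ed, Nat.cast_one, mul_one]
      linear_combination (z (κ * s) * y 0 * x 0) * hκ2
  · exact r₂.pull h0 _ (by simpa using hV)

/-- In three parallel slices whose hubs have the colours of the slices, the signs of alternating
triangles agree. -/
theorem Valid.alt_sign_eq (hf : Valid f) (hn : [i, j, k, l].Nodup)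
    (hV : ∀ x ∈ [i, j, k], x ∈ V) (hs : s ≠ 0)
    (H : ∀ a, Hub f (p + Pi.single l a) V (c + s * a)) {x y z : ZMod 3 → ZMod 3}
    (h₁ : ∀ a, Alt f (p + Pi.single l a) (c + s * a) i j (x a))
    (h₂ : ∀ a, Alt f (p + Pi.single l a) (c + s * a) i k (y a))
    (h₃ : ∀ a, Alt f (p + Pi.single l a) (c + s * a) j k (z a)) (a : ZMod 3) : x a = x 0 := by
  -- All three signs, hence also their product, persist from slice b to slice b + e. The next step
  -- therefore has the same length e, and two steps reach all slices.
  have step : ∀ b, ∃ e ≠ 0, e = x b * y b * z b * s ∧ x (b + e) = x b ∧ y (b + e) = y b ∧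
      z (b + e) = z b := by
    intro b
    have e₁ : ∀ a, p + Pi.single l b + Pi.single l a = p + Pi.single l (b + a) := by
      intro a; rw [Pi.single_add, add_assoc]
    have e₂ : ∀ a, c + s * b + s * a = c + s * (b + a) := by intro a; ring
    have H' : ∀ a, Hub f (p + Pi.single l b + Pi.single l a) V (c + s * b + s * a) := by
      intro a; rw [e₁, e₂]; exact H _
    have h₁' : ∀ a, Alt f (p + Pi.single l b + Pi.single l a) (c + s * b + s * a) i j
      (x (b + a)) := by intro a; rw [e₁, e₂]; exact h₁ _
    have h₂' : ∀ a, Alt f (p + Pi.single l b + Pi.single l a) (c + s * b + s * a) i k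
      (y (b + a)) := by intro a; rw [e₁, e₂]; exact h₂ _
    have h₃' : ∀ a, Alt f (p + Pi.single l b + Pi.single l a) (c + s * b + s * a) j k
      (z (b + a)) := by intro a; rw [e₁, e₂]; exact h₃ _
    have n₂ : [i, k, j, l].Nodup := by
      simp only [List.nodup_cons, List.mem_cons, not_or] at hn ⊢; tauto
    have n₃ : [j, k, i, l].Nodup := by
      simp only [List.nodup_cons, List.mem_cons, not_or, eq_comm] at hn ⊢; tauto
    have r₁ := hf.alt_sign_slice_eq hn hV hs H' h₁' h₂' h₃'
    have r₂ := hf.alt_sign_slice_eq n₂ (by simp at hV ⊢; tauto) hs H' h₂' h₁' fun a => (h₃' a).symm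
    have r₃ := hf.alt_sign_slice_eq n₃ (by simp at hV ⊢; tauto) hs H' h₃' (fun a => (h₁' a).symm)
      fun a => (h₂' a).symm
    simp only [add_zero] at r₁ r₂ r₃
    refine ⟨_, mul_ne_zero (mul_ne_zero (mul_ne_zero (h₁ b).1 (h₂ b).1) (h₃ b).1) hs, rfl, r₁,
      ?_, ?_⟩
    · rw [mul_comm (x b) (y b)]; exact r₂
    · rw [mul_comm (x b * y b) (z b), ← mul_assoc]; exact r₃
  obtain ⟨e, he, he', hx, hy, hz⟩ := step 0
  obtain ⟨e₂, he₂, he₂', hx₂, -, -⟩ := step (0 + e)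
  have : e₂ = e := by rw [he₂', hx, hy, hz, he']
  subst this
  have : ∀ e a : ZMod 3, e ≠ 0 → a = 0 ∨ a = 0 + e ∨ a = 0 + e + e := by decide
  rcases this e₂ a he with rfl | rfl | rfl
  · rfl
  · exact hx
  · rw [hx₂, hx]

end HammingThree

/-! ### Doubles, the trichotomy for pairs of directions, and dominance. -/

namespace HammingThree

variable {ι : Type*} [DecidableEq ι]

variable {f : (ι → ZMod 3) → ZMod 3 → Prop} {p x y : ι → ZMod 3} {V : Set ι} {c s t u a b : ZMod 3}
  {i j k l : ι}

/-- `x` has precisely two colours, and `c` is the missing one. -/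
def Double (f : (ι → ZMod 3) → ZMod 3 → Prop) (x : ι → ZMod 3) (c : ZMod 3) : Prop :=
  ∀ d, f x d ↔ d ≠ c

theorem single_eq_single {a b : ZMod 3} (ha : a ≠ 0)
    (h : (Pi.single j a : ι → ZMod 3) = Pi.single k b) : j = k ∧ a = b := by
  have hjk : j = k := by
    by_contra hne
    have := congrFun h j
    rw [Pi.single_eq_same, Pi.single_eq_of_ne hne] at this
    exact ha this
  subst hjk
  exact ⟨rfl, by simpa using congrFun h j⟩

theorem Valid.eq_of_adj (hf : Valid f) (h : f x c) (hj : f (x + Pi.single j a) c)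
    (hk : f (x + Pi.single k b) c) (ha : a ≠ 0) (hb : b ≠ 0) : j = k ∧ a = b := by
  have := (hf.unique h hj hk (Or.inr ⟨rfl, j, a, ha, rfl⟩) (Or.inr ⟨rfl, k, b, hb, rfl⟩)).1
  exact single_eq_single ha (add_left_cancel this)

theorem Valid.only_of_adj (hf : Valid f) (h : f x c) (hj : f (x + Pi.single j a) c) (ha : a ≠ 0) :
    Only f x c := by
  refine fun d => ⟨fun hd => ?_, fun hd => hd ▸ h⟩
  by_contra hne
  have := (hf.unique h hj hd (Or.inr ⟨rfl, j, a, ha, rfl⟩) (Or.inl ⟨rfl, hne⟩)).1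
  have := congrFun this j
  simp at this
  exact ha this

/-- A point adjacent to a point whose colour is repeated in another direction avoids that colour. -/
theorem Valid.not_of_adj (hf : Valid f) (h : f x c) (hj : f (x + Pi.single j a) c) (ha : a ≠ 0)
    (hb : b ≠ 0) (hjk : j ≠ k) : ¬ f (x + Pi.single k b) c :=
  fun hk => hjk (hf.eq_of_adj h hj hk ha hb).1

theorem Valid.only_of_not (hf : Valid f) (h : ∀ d ≠ c, ¬ f x d) : Only f x c := by
  obtain ⟨d, hd⟩ := hf.nonempty x
  have hdc : d = c := by_contra fun hne => h d hne hd
  subst hdc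
  exact fun e => ⟨fun he => by_contra fun hne => h e hne he, fun he => he ▸ hd⟩

/-- Each of the two points over `x` already has the other as its neighbour, so no adjacent position
may repeat either colour. -/
theorem Double.hub (hx : Double f x c) (hf : Valid f) : Hub f x Set.univ c := by
  intro j _ a ha
  refine hf.only_of_not fun d hd hjd => ?_
  have := hf.only_of_adj ((hx d).2 hd) hjd ha
  have key : ∀ c d : ZMod 3, ∃ e, e ≠ c ∧ e ≠ d := by decide
  obtain ⟨e, he, hed⟩ := key c d
  exact hed ((this e).1 ((hx e).2 he))

omit [DecidableEq ι] in
theorem Double.not_only (hx : Double f x c) : ¬ Only f x a := by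
  intro h
  have key : ∀ c d : ZMod 3, ∃ e, e ≠ c ∧ e ≠ d := by decide
  obtain ⟨e, he, hed⟩ := key c a
  exact hed ((h e).1 ((hx e).2 he))

theorem Valid.exists_double (hf : Valid f) (ha : f x a) (hb : f x b) (hab : a ≠ b) :
    ∃ c, Double f x c := by
  have key : ∀ a b : ZMod 3, a ≠ b → ∃ c, c ≠ a ∧ c ≠ b ∧ ∀ d, d ≠ c → d = a ∨ d = b := by decide
  obtain ⟨c, hca, hcb, hc⟩ := key a b hab
  refine ⟨c, fun d => ⟨fun hd hdc => ?_, fun hd => ?_⟩⟩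
  · subst hdc
    exact hcb (hf.unique ha hb hd (Or.inl ⟨rfl, hab.symm⟩) (Or.inl ⟨rfl, hca⟩)).2.symm
  · rcases hc d hd with rfl | rfl <;> assumption

/-- The colour c is excluded because p + a e_j and p + b e_k both have it and are adjacent to the
point. With two colours the point would be a double missing c, and its neighbour with j-coordinate
2a would then have the excluded colour c. -/
theorem Valid.exists_only_of_hub (hf : Valid f) (H : Hub f p V c) (hj : j ∈ V) (hk : k ∈ V)
    (hjk : j ≠ k) (ha : a ≠ 0) (hb : b ≠ 0) :
    ∃ g ≠ 0, Only f (p + Pi.single j a + Pi.single k b) (c + g) := by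
  have hc : ∀ a b, a ≠ 0 → b ≠ 0 → ¬ f (p + Pi.single j a + Pi.single k b) c := by
    intro a b ha hb h
    have h₁ : f (p + Pi.single j a + Pi.single k b + Pi.single k (-b)) c := by
      rw [add_assoc, ← Pi.single_add, add_neg_cancel, Pi.single_zero, add_zero]
      exact (H j hj a ha).self
    have h₂ : f (p + Pi.single j a + Pi.single k b + Pi.single j (-a)) c := by
      rw [add_right_comm, add_assoc p, ← Pi.single_add, add_neg_cancel, Pi.single_zero, add_zero]
      exact (H k hk b hb).self
    exact hjk (hf.eq_of_adj h h₂ h₁ (neg_ne_zero.2 ha) (neg_ne_zero.2 hb)).1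
  obtain ⟨d, hd⟩ := hf.nonempty (p + Pi.single j a + Pi.single k b)
  have hdc : d ≠ c := by rintro rfl; exact hc a b ha hb hd
  refine ⟨d - c, sub_ne_zero.2 hdc, ?_⟩
  rw [add_sub_cancel]
  refine fun e => ⟨fun he => ?_, fun he => he ▸ hd⟩
  by_contra hne
  obtain ⟨c', hD⟩ := hf.exists_double he hd hne
  have hc' : c' = c := by
    by_contra h
    exact hc a b ha hb ((hD c).2 (Ne.symm h))
  subst hc'
  have h₁ := (hD.hub hf j trivial a ha).self
  rw [add_right_comm, add_assoc p, ← Pi.single_add] at h₁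
  exact hc (a + a) b ((by decide : ∀ a : ZMod 3, a ≠ 0 → a + a ≠ 0) a ha) hb h₁

/-- The points with both coordinates non-zero form a 4-cycle in two colours, and none agrees with
both of its neighbours on the cycle. Only the alternating colouring and those constant along one of
the two directions remain. -/
theorem Valid.trichotomy (hf : Valid f) (H : Hub f p V c) (hj : j ∈ V) (hk : k ∈ V) (hjk : j ≠ k) :
    ∃ s, Alt f p c j k s ∨ Dom f p c j k s ∨ Dom f p c k j s := by
  have h1 : (1 : ZMod 3) ≠ 0 := by decide
  have h2 : (2 : ZMod 3) ≠ 0 := by decide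
  obtain ⟨g₁, n₁, o₁⟩ := hf.exists_only_of_hub H hj hk hjk h1 h1
  obtain ⟨g₂, n₂, o₂⟩ := hf.exists_only_of_hub H hj hk hjk h1 h2
  obtain ⟨g₃, n₃, o₃⟩ := hf.exists_only_of_hub H hj hk hjk h2 h1
  obtain ⟨g₄, n₄, o₄⟩ := hf.exists_only_of_hub H hj hk hjk h2 h2
  have key : ∀ a b g : ZMod 3, a ≠ 0 → b ≠ 0 → f (p + Pi.single j a + Pi.single k b) (c + g) →
      f (p + Pi.single j (a + a) + Pi.single k b) (c + g) →
      f (p + Pi.single j a + Pi.single k (b + b)) (c + g) → False := by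
    intro a b g ha hb h h' h''
    rw [Pi.single_add, ← add_assoc, add_right_comm] at h'
    rw [Pi.single_add, ← add_assoc] at h''
    exact hjk (hf.eq_of_adj h h' h'' ha hb).1
  have q₁ := key 1 1 g₁ h1 h1 o₁.self
  have q₂ := key 1 2 g₂ h1 h2 o₂.self
  have q₃ := key 2 1 g₃ h2 h1 o₃.self
  have q₄ := key 2 2 g₄ h2 h2 o₄.self
  simp only [show (1 : ZMod 3) + 1 = 2 by decide, show (2 : ZMod 3) + 2 = 1 by decide, o₁ _, o₂ _,
    o₃ _, o₄ _, add_right_inj] at q₁ q₂ q₃ q₄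
  have main : ∀ g₁ g₂ g₃ g₄ : ZMod 3, g₁ ≠ 0 ∧ g₂ ≠ 0 ∧ g₃ ≠ 0 ∧ g₄ ≠ 0 ∧
      ¬ (g₁ = g₃ ∧ g₁ = g₂) ∧ ¬ (g₂ = g₄ ∧ g₂ = g₁) ∧ ¬ (g₃ = g₁ ∧ g₃ = g₄) ∧
      ¬ (g₄ = g₂ ∧ g₄ = g₃) → (g₂ = g₁ * 2 ∧ g₃ = g₁ * 2 ∧ g₄ = g₁) ∨
      (g₂ = g₁ * 2 ∧ g₃ = g₁ ∧ g₄ = g₁ * 2) ∨ (g₂ = g₁ ∧ g₃ = g₁ * 2 ∧ g₄ = g₁ * 2) := by decide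
  have cases : ∀ a : ZMod 3, a ≠ 0 → a = 1 ∨ a = 2 := by decide
  have e : ∀ g : ZMod 3, g * 2 * 2 = g := by decide
  refine ⟨g₁, ?_⟩
  rcases main g₁ g₂ g₃ g₄ ⟨n₁, n₂, n₃, n₄, by tauto⟩ with ⟨rfl, rfl, rfl⟩ | ⟨rfl, rfl, rfl⟩ |
    ⟨rfl, rfl, rfl⟩
  · refine Or.inl ⟨n₁, fun a b ha hb => ?_⟩
    rcases cases a ha with rfl | rfl <;> rcases cases b hb with rfl | rfl <;>
      simpa only [mul_one, e]
  · refine Or.inr (Or.inl ⟨n₁, fun a b ha hb => ?_⟩)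
    rcases cases a ha with rfl | rfl <;> rcases cases b hb with rfl | rfl <;>
      simpa only [mul_one, e]
  · refine Or.inr (Or.inr ⟨n₁, fun b a hb ha => ?_⟩)
    rw [add_right_comm]
    rcases cases a ha with rfl | rfl <;> rcases cases b hb with rfl | rfl <;>
      simpa only [mul_one, e]

omit [DecidableEq ι] in
theorem Only.eq {d : ZMod 3} (h : Only f x c) (h' : Only f x d) : c = d := (h' c).1 h.self

theorem Alt.not_dom (h : Alt f p c j k s) : ¬ Dom f p c j k t := by
  intro h'
  have h2 : (2 : ZMod 3) ≠ 0 := by decide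
  have e₁ := (h.2 1 1 one_ne_zero one_ne_zero).eq (h'.2 1 1 one_ne_zero one_ne_zero)
  have e₂ := (h.2 2 1 h2 one_ne_zero).eq (h'.2 2 1 h2 one_ne_zero)
  have hs := h.1
  clear h h'
  revert s t c; decide

theorem Alt.sign_eq (h : Alt f p c j k s) (h' : Alt f p c j k t) : s = t := by
  simpa using (h.2 1 1 one_ne_zero one_ne_zero).eq (h'.2 1 1 one_ne_zero one_ne_zero)

theorem Dom.sign_eq (h : Dom f p c j k s) (h' : Dom f p c j k t) : s = t := by
  simpa using (h.2 1 1 one_ne_zero one_ne_zero).eq (h'.2 1 1 one_ne_zero one_ne_zero)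

section Fintype

variable [Fintype ι]

/-- The weighted sum of the coordinates of `r`. -/
def wsum (s r : ι → ZMod 3) : ZMod 3 := ∑ l, s l * r l

omit [DecidableEq ι] in
theorem wsum_add (s r r' : ι → ZMod 3) : wsum s (r + r') = wsum s r + wsum s r' := by
  simp [wsum, mul_add, Finset.sum_add_distrib]

theorem wsum_single (s : ι → ZMod 3) : wsum s (Pi.single j a) = s j * a := by
  simp [wsum, Pi.single_apply]

omit [DecidableEq ι] in
theorem wsum_zero (s : ι → ZMod 3) : wsum s 0 = 0 := by simp [wsum]

/-- The set of non-zero coordinates. -/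
def supp (r : ι → ZMod 3) : Finset ι := Finset.univ.filter fun l => r l ≠ 0

omit [DecidableEq ι] in
theorem mem_supp {r : ι → ZMod 3} : l ∈ supp r ↔ r l ≠ 0 := by simp [supp]

theorem supp_sub_single {r : ι → ZMod 3} (i : ι) :
    supp (r - Pi.single i (r i)) = (supp r).erase i := by
  ext l
  by_cases h : l = i
  · subst h; simp [mem_supp]
  · simp [mem_supp, h]

theorem supp_add_single {r : ι → ZMod 3} (hi : i ∈ supp r) :
    supp (r + Pi.single i (r i)) = supp r := by
  ext l
  by_cases h : l = i
  · subst h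
    have : ∀ a : ZMod 3, a ≠ 0 → a + a ≠ 0 := by decide
    simp [mem_supp] at hi ⊢
    simp [hi, this _ hi]
  · simp [mem_supp, h]

/-- Colours of the points over the directions dominated by `j`. -/
theorem Valid.only_of_dom (hf : Valid f) (H : ∀ a ≠ 0, Only f (p + Pi.single j a) c)
    {σ : ι → ZMod 3} (r : ι → ZMod 3) (hjr : j ∉ supp r) (hr : ∀ l ∈ supp r, Dom f p c j l (σ l))
    (a : ZMod 3) (ha : a ≠ 0) : Only f (p + Pi.single j a + r) (c + wsum σ r) := by
  induction hn : (supp r).card using Nat.strong_induction_on generalizing r a with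
  | _ n ih =>
  have haa : ∀ {a : ZMod 3}, a ≠ 0 → a + a ≠ 0 := by decide
  -- the faces exclude colours
  have low : ∀ r, j ∉ supp r → (∀ l ∈ supp r, Dom f p c j l (σ l)) → (supp r).card = n →
      ∀ a ≠ 0, ∀ i ∈ supp r, ¬ f (p + Pi.single j a + r) (c + wsum σ r - σ i * r i) := by
    intro r hjr hr hn a ha i hi
    have hji : j ≠ i := by rintro rfl; exact hjr hi
    have key := ih (supp (r - Pi.single i (r i))).card
      (by rw [← hn, supp_sub_single]; exact Finset.card_erase_lt_of_mem hi)
      (r - Pi.single i (r i)) (by rw [supp_sub_single]; simp [hjr])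
      (fun l hl => hr l (by rw [supp_sub_single] at hl; exact Finset.mem_of_mem_erase hl))
    have e : c + wsum σ (r - Pi.single i (r i)) = c + wsum σ r - σ i * r i := by
      have := wsum_add σ (r - Pi.single i (r i)) (Pi.single i (r i))
      rw [sub_add_cancel, wsum_single] at this
      rw [this]; ring
    -- Without coordinate i the colour does not depend on a. It is repeated along j, so the
    -- neighbour in direction i avoids it.
    have h₁ := (key a ha rfl).self
    have h₂ := (key (a + a) (haa ha) rfl).self
    rw [e] at h₁ h₂
    have h₂' : f (p + Pi.single j a + (r - Pi.single i (r i)) + Pi.single j a)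
        (c + wsum σ r - σ i * r i) := by
      convert h₂ using 1
      rw [Pi.single_add]; abel
    have := hf.not_of_adj h₁ h₂' ha (mem_supp.1 hi) hji
    convert this using 2
    abel
  -- Two coordinates with different contributions exclude two different colours and leave the
  -- asserted one.
  have mixed : ∀ r, j ∉ supp r → (∀ l ∈ supp r, Dom f p c j l (σ l)) → (supp r).card = n →
      ∀ a ≠ 0, ∀ i ∈ supp r, ∀ k ∈ supp r, σ i * r i ≠ σ k * r k →
      Only f (p + Pi.single j a + r) (c + wsum σ r) := by
    intro r hjr hr hn a ha i hi k hk hik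
    refine hf.only_of_not fun d hd h => ?_
    have h₁ := low r hjr hr hn a ha i hi
    have h₂ := low r hjr hr hn a ha k hk
    have m₁ := mul_ne_zero (hr i hi).1 (mem_supp.1 hi)
    have m₂ := mul_ne_zero (hr k hk).1 (mem_supp.1 hk)
    have key : ∀ w d x y : ZMod 3, d ≠ w ∧ x ≠ y ∧ x ≠ 0 ∧ y ≠ 0 → d = w - x ∨ d = w - y := by
      decide
    rcases key _ _ _ _ ⟨hd, hik, m₁, m₂⟩ with h' | h' <;> rw [h'] at h
    exacts [h₁ h, h₂ h]
  rcases (supp r).eq_empty_or_nonempty with h0 | ⟨i, hi⟩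
  · have : r = 0 := by
      ext l
      by_contra hl
      exact Finset.notMem_empty l (h0 ▸ mem_supp.2 hl)
    subst this
    rw [wsum_zero, add_zero, add_zero]
    exact H a ha
  by_cases h1 : ∀ k ∈ supp r, k = i
  · have : r = Pi.single i (r i) := by
      ext l
      by_cases hl : l = i
      · subst hl; simp
      · rw [Pi.single_eq_of_ne hl]
        by_contra h
        exact hl (h1 l (mem_supp.2 h))
    rw [this, wsum_single]
    exact (hr i hi).2 a (r i) ha (mem_supp.1 hi)
  push Not at h1
  obtain ⟨k, hk, hki⟩ := h1
  by_cases hik : σ i * r i = σ k * r k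
  swap
  · exact mixed r hjr hr hn a ha i hi k hk hik
  have hji : j ≠ i := by rintro rfl; exact hjr hi
  have hs := supp_add_single hi
  have m₁ := mul_ne_zero (hr i hi).1 (mem_supp.1 hi)
  -- When the contributions at i and k agree, flip the sign of coordinate i: now they differ and
  -- `mixed` applies. The colour found there is repeated along j, so it gives the second colour
  -- excluded over `r`.
  have key := mixed (r + Pi.single i (r i)) (by rwa [hs]) (by rwa [hs]) (by rwa [hs])
  rw [hs] at key
  have h₁ := fun a ha => (key a ha i hi k hk (by
    rw [Pi.add_apply, Pi.add_apply, Pi.single_eq_same, Pi.single_eq_of_ne hki, add_zero, ← hik]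
    intro h
    apply m₁
    linear_combination h)).self
  have h₂ := h₁ a ha
  have h₃ : f (p + Pi.single j a + (r + Pi.single i (r i)) + Pi.single j a)
        (c + wsum σ (r + Pi.single i (r i))) := by
    convert h₁ (a + a) (haa ha) using 1
    rw [Pi.single_add]; abel
  have h₄ := hf.not_of_adj h₂ h₃ ha (haa (mem_supp.1 hi)) hji
  have h₅ := low r hjr hr hn a ha i hi
  have e : p + Pi.single j a + (r + Pi.single i (r i)) + Pi.single i (r i + r i) =
      p + Pi.single j a + r := by
    have : ∀ a : ZMod 3, a + (a + a) = 0 := by decide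
    rw [add_assoc, add_assoc r, ← Pi.single_add, this, Pi.single_zero, add_zero]
  rw [e, wsum_add, wsum_single] at h₄
  refine hf.only_of_not fun d hd h => ?_
  have key : ∀ c w d x : ZMod 3, d ≠ c + w ∧ x ≠ 0 → d = c + w - x ∨ d = c + (w + x) := by
    decide
  rcases key _ _ _ _ ⟨hd, m₁⟩ with h' | h' <;> rw [h'] at h
  exacts [h₅ h, h₄ h]

end Fintype

/-- A dominance persists at an adjacent hub of another colour. -/
theorem Valid.dom_slice (hf : Valid f) {d : ZMod 3} (hl : t ≠ 0)
    (H : Hub f (p + Pi.single l t) V d) (hcd : c ≠ d) (hj : j ∈ V) (hk : k ∈ V)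
    (hn : [j, k, l].Nodup) (h : Dom f p c j k s) : Dom f (p + Pi.single l t) d j k s := by
  have hn' : j ≠ k ∧ j ≠ l ∧ k ≠ l := by simpa [and_assoc] using hn
  obtain ⟨hjk, hjl, hkl⟩ := hn'
  have haa : ∀ {a : ZMod 3}, a ≠ 0 → a + a ≠ 0 := by decide
  -- Each of these colours is repeated along j at p, hence forbidden at the same place in the slice
  -- t. Of the patterns of the trichotomy, only the same dominance survives.
  have ex : ∀ a b, a ≠ 0 → b ≠ 0 →
      ¬ f (p + Pi.single l t + Pi.single j a + Pi.single k b) (c + s * b) := by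
    intro a b ha hb
    have h₁ := (h.2 a b ha hb).self
    have h₂ : f (p + Pi.single j a + Pi.single k b + Pi.single j a) (c + s * b) := by
      convert (h.2 (a + a) b (haa ha) hb).self using 1
      rw [Pi.single_add]; abel
    convert hf.not_of_adj h₁ h₂ ha hl hjl using 2
    abel
  have h1 : (1 : ZMod 3) ≠ 0 := by decide
  have h2 : (2 : ZMod 3) ≠ 0 := by decide
  obtain ⟨u, h' | h' | h'⟩ := hf.trichotomy H hj hk hjk
  · exfalso
    have e : ∀ a b, a ≠ 0 → b ≠ 0 → d + u * a * b ≠ c + s * b := fun a b ha hb e =>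
      ex a b ha hb (e ▸ (h'.2 a b ha hb).self)
    have e₁ := e 1 1 h1 h1
    have e₂ := e 1 2 h1 h2
    have e₃ := e 2 1 h2 h1
    have e₄ := e 2 2 h2 h2
    have key : ∀ d u c s : ZMod 3, c ≠ d ∧ u ≠ 0 ∧ s ≠ 0 ∧ d + u * 1 * 1 ≠ c + s * 1 ∧
      d + u * 1 * 2 ≠ c + s * 2 ∧ d + u * 2 * 1 ≠ c + s * 1 ∧ d + u * 2 * 2 ≠ c + s * 2 →
      False := by
      decide
    exact key d u c s ⟨hcd, h'.1, h.1, e₁, e₂, e₃, e₄⟩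
  · have e : ∀ b, b ≠ 0 → d + u * b ≠ c + s * b := fun b hb e =>
      ex 1 b h1 hb (e ▸ (h'.2 1 b h1 hb).self)
    have key : ∀ d u c s : ZMod 3, c ≠ d ∧ u ≠ 0 ∧ s ≠ 0 ∧ d + u * 1 ≠ c + s * 1 ∧
      d + u * 2 ≠ c + s * 2 → u = s := by decide
    rwa [key d u c s ⟨hcd, h'.1, h.1, e 1 h1, e 2 h2⟩] at h'
  · exfalso
    have e : ∀ a b, a ≠ 0 → b ≠ 0 → d + u * a ≠ c + s * b := by
      intro a b ha hb e
      apply ex a b ha hb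
      rw [← e, add_right_comm]
      exact (h'.2 b a hb ha).self
    have e₁ := e 1 1 h1 h1
    have e₂ := e 1 2 h1 h2
    have e₃ := e 2 1 h2 h1
    have e₄ := e 2 2 h2 h2
    have key : ∀ d u c s : ZMod 3, c ≠ d ∧ u ≠ 0 ∧ s ≠ 0 ∧ d + u * 1 ≠ c + s * 1 ∧
      d + u * 1 ≠ c + s * 2 ∧ d + u * 2 ≠ c + s * 1 ∧ d + u * 2 ≠ c + s * 2 → False := by
      decide
    exact key d u c s ⟨hcd, h'.1, h.1, e₁, e₂, e₃, e₄⟩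

end HammingThree

/-! ### The mixed graph of directions at a full hub. -/

namespace HammingThree

variable {ι : Type*} [DecidableEq ι]

variable {f : (ι → ZMod 3) → ZMod 3 → Prop} {p x y : ι → ZMod 3} {V : Set ι}
  {c d s t u a b : ZMod 3}
  {i j k l m m' : ι}

/-- The directions `j` and `k` alternate at the hub `p`. -/
def Adj (f : (ι → ZMod 3) → ZMod 3 → Prop) (p : ι → ZMod 3) (c : ZMod 3) (j k : ι) : Prop :=
  j ≠ k ∧ ∃ s, Alt f p c j k s

/-- The direction `j` leads the direction `k` at the hub `p`. -/
def Leads (f : (ι → ZMod 3) → ZMod 3 → Prop) (p : ι → ZMod 3) (c : ZMod 3) (j k : ι) : Prop :=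
  j ≠ k ∧ ∃ s, Dom f p c j k s

theorem Adj.symm (h : Adj f p c j k) : Adj f p c k j :=
  ⟨h.1.symm, h.2.imp fun _ => Alt.symm⟩

theorem Adj.not_leads (h : Adj f p c j k) : ¬ Leads f p c j k := fun h' =>
  h.2.choose_spec.not_dom h'.2.choose_spec

theorem Adj.not_leads' (h : Adj f p c j k) : ¬ Leads f p c k j := h.symm.not_leads

theorem Valid.adj_or_leads (hf : Valid f) (H : Hub f p V c) (hj : j ∈ V) (hk : k ∈ V)
    (hjk : j ≠ k) : Adj f p c j k ∨ Leads f p c j k ∨ Leads f p c k j := by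
  obtain ⟨s, h | h | h⟩ := hf.trichotomy H hj hk hjk
  exacts [Or.inl ⟨hjk, s, h⟩, Or.inr (Or.inl ⟨hjk, s, h⟩), Or.inr (Or.inr ⟨hjk.symm, s, h⟩)]

section Hub

variable (hf : Valid f) (H : Hub f p Set.univ c)
include hf H

theorem Valid.leads_trans (h₁ : Leads f p c i j) (h₂ : Leads f p c j k) (hik : i ≠ k) :
    ¬ Leads f p c k i := by
  rintro ⟨-, u, h₃⟩
  obtain ⟨hij, s, h₁⟩ := h₁
  obtain ⟨hjk, t, h₂⟩ := h₂
  exact hf.not_cycle H (by simp [hij, hjk, hik]) (by simp) h₁ h₂ h₃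

/-- Both orientations of the pair l, k complete a configuration excluded by computation. -/
theorem Valid.adj_of_leads (h₁ : Adj f p c j k) (h₂ : Leads f p c l j) (hlk : l ≠ k) :
    Adj f p c l k := by
  obtain ⟨hjk, s, h₁⟩ := h₁
  obtain ⟨hlj, t, h₂⟩ := h₂
  have hn : [j, k, l].Nodup := by simp [hjk, hlj.symm, hlk.symm]
  rcases hf.adj_or_leads H (Set.mem_univ l) (Set.mem_univ k) hlk with h | h | h
  · exact h
  · obtain ⟨-, u, h⟩ := h
    exact (hf.not_alt_dom_dom H hn (by simp) h₁ h₂ h).elim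
  · obtain ⟨-, u, h⟩ := h
    exact (hf.not_dom_alt_dom H hn (by simp) h₁ h₂ h).elim

theorem Valid.not_adj_star (h₁ : Adj f p c i j) (h₂ : Adj f p c i k) (h₃ : Adj f p c i l)
    (h₄ : Leads f p c j k) (h₅ : Leads f p c j l) (h₆ : Leads f p c k l) : False := by
  obtain ⟨n₁, _, h₁⟩ := h₁
  obtain ⟨n₂, _, h₂⟩ := h₂
  obtain ⟨n₃, _, h₃⟩ := h₃
  obtain ⟨n₄, _, h₄⟩ := h₄
  obtain ⟨n₅, _, h₅⟩ := h₅
  obtain ⟨n₆, _, h₆⟩ := h₆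
  exact hf.not_star H (by simp [*]) (by simp) h₁ h₂ h₃ h₄ h₅ h₆

theorem Valid.not_adj_paw (h₁ : Adj f p c i j) (h₂ : Adj f p c i k) (h₃ : Adj f p c i l)
    (h₄ : Adj f p c j k) (h₅ : Leads f p c j l) (h₆ : Leads f p c k l) : False := by
  obtain ⟨n₁, _, h₁⟩ := h₁
  obtain ⟨n₂, _, h₂⟩ := h₂
  obtain ⟨n₃, _, h₃⟩ := h₃
  obtain ⟨n₄, _, h₄⟩ := h₄
  obtain ⟨n₅, _, h₅⟩ := h₅
  obtain ⟨n₆, _, h₆⟩ := h₆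
  exact hf.not_paw H (by simp [*]) (by simp) h₁ h₂ h₃ h₄ h₅ h₆

theorem Valid.not_adj_square (h₁ : Adj f p c i j) (h₂ : Adj f p c j k) (h₃ : Adj f p c k l)
    (h₄ : Adj f p c i l) (h₅ : Leads f p c i k) (h₆ : Leads f p c j l) : False := by
  obtain ⟨n₁, _, h₁⟩ := h₁
  obtain ⟨n₂, _, h₂⟩ := h₂
  obtain ⟨n₃, _, h₃⟩ := h₃
  obtain ⟨n₄, _, h₄⟩ := h₄
  obtain ⟨n₅, _, h₅⟩ := h₅
  obtain ⟨n₆, _, h₆⟩ := h₆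
  exact hf.not_square H (by simp [*]) (by simp) h₁ h₂ h₃ h₄ h₅ h₆

/-- Two directions `k, l` with `k` leading `l` and a common neighbour `j`. -/
theorem Valid.leads_or_adj_of_path (hk : Adj f p c j k) (hl : Adj f p c j l)
    (hkl : Leads f p c k l) (mj : m ≠ j) (mk : m ≠ k) (ml : m ≠ l) :
    (Leads f p c j m ∧ Leads f p c k m ∧ Leads f p c l m) ∨
      (Adj f p c m j ∧ Adj f p c m k ∧ Adj f p c m l) := by
  have F := fun {j k l} => hf.adj_of_leads H (j := j) (k := k) (l := l)
  have nkl : ¬ Adj f p c k l := fun h => h.not_leads hkl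
  have nlk : ¬ Adj f p c l k := fun h => h.not_leads' hkl
  have T := fun k (h : m ≠ k) => hf.adj_or_leads H (Set.mem_univ m) (Set.mem_univ k) h
  -- Every other combination of relations of m to j, l, k closes a star, paw, square or directed
  -- triangle, or forces a leading pair to alternate.
  rcases T j mj with hmj | hmj | hmj
  · rcases T l ml with hml | hml | hml
    · exact Or.inr ⟨hmj, F hml.symm hkl mk.symm |>.symm, hml⟩
    · rcases T k mk with hmk | hmk | hmk
      · exact (hf.not_adj_paw H hmj.symm hk hl hmk hml hkl).elim
      · exact (hf.not_adj_star H hmj.symm hk hl hmk hml hkl).elim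
      · exact (hf.not_adj_star H hk hmj.symm hl hmk hkl hml).elim
    · rcases T k mk with hmk | hmk | hmk
      · exact (nlk (F hmk hml hkl.1.symm)).elim
      · exact (hf.leads_trans H hmk hkl ml hml).elim
      · exact (hf.not_adj_star H hk hl hmj.symm hkl hmk hml).elim
  · exact (hf.not_adj_square H (F hk hmj mk) hk.symm hl (F hl hmj ml) hmj hkl).elim
  · left
    have nmj : ¬ Adj f p c m j := fun h => h.not_leads' hmj
    rcases T k mk with hmk | hmk | hmk
    · rcases T l ml with hml | hml | hml
      · exact (hf.not_adj_square H hk hmk.symm hml hl hmj hkl).elim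
      · exact (nmj (F hl.symm hml mj)).elim
      · exact (nlk (F hmk hml hkl.1.symm)).elim
    · exact (nmj (F hk.symm hmk mj)).elim
    · rcases T l ml with hml | hml | hml
      · exact (nkl (F hml hmk hkl.1)).elim
      · exact (nmj (F hl.symm hml mj)).elim
      · exact ⟨hmj, hmk, hml⟩

/-- Were m led by j, k, l, its partner m' would alternate with k and l by `Valid.adj_of_leads`. The
dichotomy for the path k, m', l then makes m' lead m, or m alternate with k; both are contradictory.
-/
theorem Valid.adj_of_path (hk : Adj f p c j k) (hl : Adj f p c j l)
    (hkl : Leads f p c k l) (mj : m ≠ j) (mk : m ≠ k) (ml : m ≠ l) (hm : Adj f p c m m') :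
    Adj f p c m j ∧ Adj f p c m k ∧ Adj f p c m l := by
  rcases hf.leads_or_adj_of_path H hk hl hkl mj mk ml with ⟨h₁, h₂, h₃⟩ | h
  · have n₁ : j ≠ m' := by rintro rfl; exact hm.not_leads' h₁
    have n₂ : k ≠ m' := by rintro rfl; exact hm.not_leads' h₂
    have n₃ : l ≠ m' := by rintro rfl; exact hm.not_leads' h₃
    have g₂ := hf.adj_of_leads H hm h₂ n₂
    have g₃ := hf.adj_of_leads H hm h₃ n₃
    rcases hf.leads_or_adj_of_path H g₂.symm g₃.symm hkl hm.1 mk ml with g | g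
    · exact (hm.symm.not_leads g.1).elim
    · exact (g.2.1.not_leads' h₂).elim
  · exact h

/-- A non-alternating pair of directions is joined to every other direction that alternates with
some direction. -/
theorem Valid.adj_pair (hkl : Leads f p c k l) (hl : ∃ i, Adj f p c l i) (hm : ∃ i, Adj f p c m i)
    (mk : m ≠ k) (ml : m ≠ l) : Adj f p c m k ∧ Adj f p c m l := by
  obtain ⟨j, hj⟩ := hl
  have hkj : k ≠ j := by rintro rfl; exact hj.not_leads' hkl
  have hk := hf.adj_of_leads H hj hkl hkj
  by_cases hmj : m = j
  · subst hmj; exact ⟨hk.symm, hj.symm⟩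
  · obtain ⟨i, hi⟩ := hm
    exact (hf.adj_of_path H hk.symm hj.symm hkl hmj mk ml hi).2

theorem Valid.adj_of_pair (hkl : Leads f p c k l) (hl : ∃ i, Adj f p c l i)
    (hi : ∃ j, Adj f p c i j) (hm : ∃ i, Adj f p c m i) (ik : i ≠ k) (il : i ≠ l)
    (mk : m ≠ k) (ml : m ≠ l) (hmi : m ≠ i) : Adj f p c m i := by
  obtain ⟨h₁, h₂⟩ := hf.adj_pair H hkl hl hi ik il
  obtain ⟨j, hj⟩ := hm
  exact (hf.adj_of_path H h₁ h₂ hkl hmi mk ml hj).1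

/-- Equality means that the triangles k, i, m and l, i, m have equal sign products. Rescaling then
makes all five alternations equal, against `Valid.not_alt_hom_of_dom`. -/
theorem Valid.sign_ne_of_pair {a₁ a₂ b₁ b₂ : ZMod 3} (hn : [k, l, i, m].Nodup)
    (h : Dom f p c k l s) (h₁ : Alt f p c k i a₁) (h₂ : Alt f p c k m a₂) (h₃ : Alt f p c l i b₁)
    (h₄ : Alt f p c l m b₂) (h₅ : Alt f p c i m u) : a₁ * b₁ ≠ a₂ * b₂ := by
  intro he
  have key₁ : ∀ a₁ a₂ u : ZMod 3, a₁ ≠ 0 ∧ a₂ ≠ 0 ∧ u ≠ 0 → a₁ * a₂ * u ≠ 0 := by decide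
  have key : ∀ a₁ a₂ b₁ b₂ : ZMod 3, a₁ ≠ 0 ∧ a₂ ≠ 0 ∧ b₁ ≠ 0 ∧ b₂ ≠ 0 ∧ a₁ * b₁ = a₂ * b₂ →
      ∃ σ ≠ 0, b₁ * σ * a₂ = a₁ * a₂ ∧ b₂ * σ * a₁ = a₁ * a₂ := by decide
  obtain ⟨σ, hσ, e₁, e₂⟩ := key _ _ _ _ ⟨h₁.1, h₂.1, h₃.1, h₄.1, he⟩
  refine hf.not_alt_hom_of_dom H hn (by simp) (σ₁ := u) (σ₂ := σ * u) (σ₃ := a₂) (σ₄ := a₁)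
    (key₁ a₁ a₂ u ⟨h₁.1, h₂.1, h₅.1⟩) ?_ h h₁ h₂ h₃ h₄ h₅ ?_ ?_ ?_ ?_ ?_
  · simp [h₁.1, h₂.1, h₅.1, hσ]
  · ring
  · ring
  · linear_combination u * e₁
  · linear_combination u * e₂
  · ring

/-- By `Valid.sign_ne_of_pair` the products of the signs towards k and l are distinct for distinct
further directions, but only two non-zero values exist. -/
theorem Valid.not_three_of_pair {i₁ i₂ i₃ : ι} (hn : [k, l, i₁, i₂, i₃].Nodup)
    (hkl : Leads f p c k l) (hl : ∃ i, Adj f p c l i)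
    (h₁ : ∃ j, Adj f p c i₁ j) (h₂ : ∃ j, Adj f p c i₂ j) (h₃ : ∃ j, Adj f p c i₃ j) : False := by
  simp only [List.nodup_cons, List.mem_cons, not_or, List.not_mem_nil, or_false, not_false_eq_true,
    List.nodup_nil, and_true] at hn
  obtain ⟨⟨n₁, n₂, n₃, n₄⟩, ⟨n₅, n₆, n₇⟩, ⟨n₈, n₉⟩, n₁₀⟩ := hn
  obtain ⟨⟨-, a₁, p₁⟩, ⟨-, b₁, q₁⟩⟩ := hf.adj_pair H hkl hl h₁ (Ne.symm n₂) (Ne.symm n₅)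
  obtain ⟨⟨-, a₂, p₂⟩, ⟨-, b₂, q₂⟩⟩ := hf.adj_pair H hkl hl h₂ (Ne.symm n₃) (Ne.symm n₆)
  obtain ⟨⟨-, a₃, p₃⟩, ⟨-, b₃, q₃⟩⟩ := hf.adj_pair H hkl hl h₃ (Ne.symm n₄) (Ne.symm n₇)
  obtain ⟨-, u₁, r₁⟩ := hf.adj_of_pair H hkl hl h₂ h₁ (Ne.symm n₃) (Ne.symm n₆) (Ne.symm n₂)
    (Ne.symm n₅) n₈
  obtain ⟨-, u₂, r₂⟩ := hf.adj_of_pair H hkl hl h₃ h₁ (Ne.symm n₄) (Ne.symm n₇) (Ne.symm n₂)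
    (Ne.symm n₅) n₉
  obtain ⟨-, u₃, r₃⟩ := hf.adj_of_pair H hkl hl h₃ h₂ (Ne.symm n₄) (Ne.symm n₇) (Ne.symm n₃)
    (Ne.symm n₆) n₁₀
  obtain ⟨-, s, hs⟩ := hkl
  have e₁ := hf.sign_ne_of_pair H (by simp [*]) hs p₁.symm p₂.symm q₁.symm q₂.symm r₁
  have e₂ := hf.sign_ne_of_pair H (by simp [*]) hs p₁.symm p₃.symm q₁.symm q₃.symm r₂
  have e₃ := hf.sign_ne_of_pair H (by simp [*]) hs p₂.symm p₃.symm q₂.symm q₃.symm r₃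
  have key : ∀ x y z : ZMod 3, x ≠ 0 ∧ y ≠ 0 ∧ z ≠ 0 → x = y ∨ x = z ∨ y = z := by decide
  rcases key (a₁ * b₁) (a₂ * b₂) (a₃ * b₃) ⟨mul_ne_zero p₁.1 q₁.1, mul_ne_zero p₂.1 q₂.1,
    mul_ne_zero p₃.1 q₃.1⟩ with h | h | h
  exacts [e₁ h, e₂ h, e₃ h]

end Hub

/-! ### The set of alternating directions, and moves outside it. -/

section Fintype

variable [Fintype ι]

open Classical in
/-- The directions that alternate with some other direction. -/
noncomputable def altSet (f : (ι → ZMod 3) → ZMod 3 → Prop) (p : ι → ZMod 3) (c : ZMod 3) :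
    Finset ι := Finset.univ.filter fun j => ∃ k, Adj f p c j k

theorem mem_altSet : j ∈ altSet f p c ↔ ∃ k, Adj f p c j k := by
  simp [altSet]

theorem Valid.leads_of_notMem (hf : Valid f) (H : Hub f p Set.univ c) (hj : j ∈ altSet f p c)
    (hl : l ∉ altSet f p c) : Leads f p c j l := by
  rw [mem_altSet] at hj hl
  push Not at hl
  obtain ⟨k, hjk⟩ := hj
  have hjl : j ≠ l := by rintro rfl; exact hl k hjk
  rcases hf.adj_or_leads H (Set.mem_univ j) (Set.mem_univ l) hjl with h | h | h
  · exact (hl j h.symm).elim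
  · exact h
  · have hlk : l ≠ k := by rintro rfl; exact hl j hjk.symm
    exact (hl k (hf.adj_of_leads H hjk h hlk)).elim

/-- Alternating leaders of l have equal signs by `Valid.dom_sign_eq`. If i leads j, a partner k of j
also alternates with i, and the sign at k links the two. -/
theorem Valid.exists_sign_of_notMem (hf : Valid f) (H : Hub f p Set.univ c)
    (hl : l ∉ altSet f p c) : ∃ s, ∀ j ∈ altSet f p c, Dom f p c j l s := by
  have adj : ∀ i j s t, Adj f p c i j → Dom f p c i l s → Dom f p c j l t → s = t := by
    rintro i j s t hij h₁ h₂
    have hi : i ≠ l := by rintro rfl; exact hl (mem_altSet.2 ⟨j, hij⟩)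
    have hj : j ≠ l := by rintro rfl; exact hl (mem_altSet.2 ⟨i, hij.symm⟩)
    exact hf.dom_sign_eq H (by simp [hij.1, hi, hj]) (by simp) hij.2.choose_spec h₁ h₂
  rcases (altSet f p c).eq_empty_or_nonempty with h0 | ⟨i, hi⟩
  · exact ⟨0, by simp [h0]⟩
  obtain ⟨-, s, hs⟩ := hf.leads_of_notMem H hi hl
  refine ⟨s, fun j hj => ?_⟩
  obtain ⟨-, t, ht⟩ := hf.leads_of_notMem H hj hl
  suffices s = t by rwa [this]
  by_cases hij : i = j
  · subst hij; exact hs.sign_eq ht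
  have lead : ∀ i j s t, i ∈ altSet f p c → j ∈ altSet f p c → Leads f p c i j →
      Dom f p c i l s → Dom f p c j l t → s = t := by
    intro i j s t hi hj hij h₁ h₂
    obtain ⟨k, hk⟩ := mem_altSet.1 hj
    have hik : i ≠ k := by rintro rfl; exact hk.not_leads' hij
    have hik := hf.adj_of_leads H hk hij hik
    obtain ⟨-, u, hu⟩ := hf.leads_of_notMem H (mem_altSet.2 ⟨_, hk.symm⟩) hl
    rw [adj _ _ _ _ hik h₁ hu, adj _ _ _ _ hk h₂ hu]
  rcases hf.adj_or_leads H (Set.mem_univ i) (Set.mem_univ j) hij with h | h | h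
  · exact adj _ _ _ _ h hs ht
  · exact lead _ _ _ _ hi hj h hs ht
  · exact (lead _ _ _ _ hj hi h ht hs).symm

theorem Valid.exists_signs (hf : Valid f) (H : Hub f p Set.univ c) :
    ∃ σ : ι → ZMod 3, ∀ l ∉ altSet f p c, ∀ j ∈ altSet f p c, Dom f p c j l (σ l) := by
  have := fun l (hl : l ∉ altSet f p c) => hf.exists_sign_of_notMem H hl
  choose! σ hσ using this
  exact ⟨σ, hσ⟩

/-- Moving from a double in directions outside the alternating ones keeps a hub. -/
theorem Valid.hub_add (hf : Valid f) (H : Hub f p Set.univ c) {σ : ι → ZMod 3}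
    (hσ : ∀ l ∉ altSet f p c, ∀ j ∈ altSet f p c, Dom f p c j l (σ l)) {r : ι → ZMod 3}
    (hr : Disjoint (supp r) (altSet f p c)) :
    Hub f (p + r) (altSet f p c) (c + wsum σ r) := by
  intro j hj a ha
  rw [add_right_comm]
  exact hf.only_of_dom (H j trivial) r (fun h => Finset.disjoint_left.1 hr h hj)
    (fun l hl => hσ l (Finset.disjoint_left.1 hr hl) j hj) a ha

/-- Change one coordinate outside the alternating set at a time: consecutive hubs have different
colours, because σ is non-zero there, so `Valid.dom_slice` applies. -/
theorem Valid.dom_add (hf : Valid f) (H : Hub f p Set.univ c) {σ : ι → ZMod 3}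
    (hσ : ∀ l ∉ altSet f p c, ∀ j ∈ altSet f p c, Dom f p c j l (σ l)) (n : ℕ)
    (r r' : ι → ZMod 3) (hr : Disjoint (supp r) (altSet f p c))
    (hr' : Disjoint (supp r') (altSet f p c)) (hn : (supp (r' - r)).card = n)
    (hj : j ∈ altSet f p c) (hk : k ∈ altSet f p c) (hjk : j ≠ k)
    (h : Dom f (p + r) (c + wsum σ r) j k s) : Dom f (p + r') (c + wsum σ r') j k s := by
  induction n generalizing r with
  | zero =>
    have : r' = r := by
      ext l
      by_contra hl
      have : l ∈ supp (r' - r) := mem_supp.2 (sub_ne_zero.2 hl)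
      rw [Finset.card_eq_zero.1 hn] at this
      simp at this
    rwa [this]
  | succ n ih =>
    obtain ⟨i, hi⟩ := Finset.card_pos.1 (by omega : 0 < (supp (r' - r)).card)
    obtain ⟨q, hq⟩ : ∃ q, q = r' - r := ⟨_, rfl⟩
    rw [← hq] at hi hn
    have hiA : i ∉ altSet f p c := by
      intro hiA
      have e₁ : r i = 0 := by
        by_contra h; exact Finset.disjoint_left.1 hr (mem_supp.2 h) hiA
      have e₂ : r' i = 0 := by
        by_contra h; exact Finset.disjoint_left.1 hr' (mem_supp.2 h) hiA
      exact mem_supp.1 hi (by simp [hq, e₁, e₂])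
    have hd : Disjoint (supp (r + Pi.single i (q i))) (altSet f p c) := by
      rw [Finset.disjoint_left]
      intro l hl hlA
      have hli : l ≠ i := by rintro rfl; exact hiA hlA
      refine Finset.disjoint_left.1 hr (mem_supp.2 ?_) hlA
      simpa [hli] using mem_supp.1 hl
    have e : r' - (r + Pi.single i (q i)) = q - Pi.single i (q i) := by
      rw [hq, sub_sub]
    have step := ih (r + Pi.single i (q i)) (by exact hd)
    refine step ?_ ?_
    · rw [e, supp_sub_single, Finset.card_erase_of_mem hi, hn, Nat.add_sub_cancel]
    · have hub := hf.hub_add H hσ hd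
      rw [wsum_add, wsum_single, ← add_assoc p] at hub ⊢
      refine hf.dom_slice (mem_supp.1 hi) hub ?_ hj hk ?_ h
      · have := mul_ne_zero (hσ i hiA j hj).1 (mem_supp.1 hi)
        rw [ne_eq, ← add_assoc, left_eq_add]; exact this
      · have hji : j ≠ i := by rintro rfl; exact hiA hj
        have hki : k ≠ i := by rintro rfl; exact hiA hk
        simp [hjk, hji, hki]

omit [DecidableEq ι] in
theorem supp_zero : supp (0 : ι → ZMod 3) = ∅ := by
  ext; simp [mem_supp]

/-- Any dominance at p + r could be carried back to p by `Valid.dom_add`, where the pair alternates.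
-/
theorem Valid.alt_add (hf : Valid f) (H : Hub f p Set.univ c) {σ : ι → ZMod 3}
    (hσ : ∀ l ∉ altSet f p c, ∀ j ∈ altSet f p c, Dom f p c j l (σ l)) {r : ι → ZMod 3}
    (hr : Disjoint (supp r) (altSet f p c)) (h : Adj f p c j k) :
    Adj f (p + r) (c + wsum σ r) j k := by
  have hj := mem_altSet.2 ⟨k, h⟩
  have hk := mem_altSet.2 ⟨j, h.symm⟩
  rcases hf.adj_or_leads (hf.hub_add H hσ hr) hj hk h.1 with g | ⟨-, s, g⟩ | ⟨-, s, g⟩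
  · exact g
  · have := hf.dom_add H hσ _ r 0 hr (by simp [supp_zero]) rfl hj hk h.1 g
    rw [wsum_zero, add_zero, add_zero] at this
    exact (h.not_leads ⟨h.1, s, this⟩).elim
  · have := hf.dom_add H hσ _ r 0 hr (by simp [supp_zero]) rfl hk hj h.1.symm g
    rw [wsum_zero, add_zero, add_zero] at this
    exact (h.not_leads' ⟨h.1.symm, s, this⟩).elim

omit [Fintype ι] in
-- Without alternation the relation is a tournament free of directed triangles, hence transitive,
-- and has a source.
theorem Valid.exists_leader (hf : Valid f) (H : Hub f p Set.univ c) {S : Finset ι}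
    (hS : S.Nonempty) (h : ∀ j ∈ S, ∀ k ∈ S, ¬ Adj f p c j k) :
    ∃ j ∈ S, ∀ k ∈ S, k ≠ j → Leads f p c j k := by
  induction hS using Finset.Nonempty.cons_induction with
  | singleton a => exact ⟨a, by simp⟩
  | cons a S haS _ ih =>
    obtain ⟨j, hj, hlead⟩ := ih fun j hj k hk => h j (by simp [hj]) k (by simp [hk])
    have hja : j ≠ a := by rintro rfl; exact haS hj
    rcases hf.adj_or_leads H (Set.mem_univ j) (Set.mem_univ a) hja with g | g | g
    · exact (h j (by simp [hj]) a (by simp) g).elim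
    · refine ⟨j, by simp [hj], fun k hk hkj => ?_⟩
      rcases Finset.mem_cons.1 hk with rfl | hk
      exacts [g, hlead k hk hkj]
    · refine ⟨a, by simp, fun k hk hka => ?_⟩
      have hk : k ∈ S := (Finset.mem_cons.1 hk).resolve_left hka
      by_cases hkj : k = j
      · rw [hkj]; exact g
      have hjk := hlead k hk hkj
      rcases hf.adj_or_leads H (Set.mem_univ a) (Set.mem_univ k) hka.symm with g' | g' | g'
      · exact (h a (by simp) k (by simp [hk]) g').elim
      · exact g'
      · exact (hf.leads_trans H g hjk hka.symm g').elim

/-- With at most one alternating direction in the support of y - x, some direction there leads all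
the others, and `Valid.only_of_dom` gives y a single colour. With two, moving along the others keeps
a hub, from which `Valid.exists_only_of_hub` gives the same. But y is a double. -/
theorem Valid.three_le_card (hf : Valid f) (hx : Double f x c) (hy : Double f y d) (hxy : x ≠ y) :
    3 ≤ (supp (y - x) ∩ altSet f x c).card := by
  have H := hx.hub hf
  set W := altSet f x c
  set S := supp (y - x)
  have hS : S.Nonempty := by
    rw [Finset.nonempty_iff_ne_empty]
    intro h
    apply hxy
    ext l
    by_contra hl
    have : l ∈ S := mem_supp.2 (sub_ne_zero.2 (Ne.symm hl))
    simp [h] at this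
  have main : ∀ j ∈ S, ¬ ∀ k ∈ S, k ≠ j → Leads f x c j k := by
    intro j hj hlead
    have : ∀ k ∈ S.erase j, ∃ s, Dom f x c j k s := fun k hk =>
      (hlead k (Finset.mem_of_mem_erase hk) (Finset.ne_of_mem_erase hk)).2
    choose! σ hσ using this
    have hs := supp_sub_single (r := y - x) j
    have := hf.only_of_dom (H j trivial) (y - x - Pi.single j ((y - x) j))
      (by rw [hs]; exact Finset.notMem_erase j _)
      (by rw [hs]; exact hσ) _ (mem_supp.1 hj)
    rw [add_assoc, add_sub_cancel, add_sub_cancel] at this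
    exact hy.not_only this
  by_contra! hlt
  have hRW : ∀ j k, j ∉ W → ¬ Adj f x c j k := fun j k hj h => hj (mem_altSet.2 ⟨k, h⟩)
  interval_cases hcard : (S ∩ W).card
  · have h0 := Finset.card_eq_zero.1 hcard
    have hd : ∀ j ∈ S, j ∉ W := fun j hj hjW => by
      have : j ∈ S ∩ W := Finset.mem_inter.2 ⟨hj, hjW⟩
      simp [h0] at this
    obtain ⟨j, hj, hlead⟩ := hf.exists_leader H hS fun j hj k _ => hRW j k (hd j hj)
    exact main j hj hlead
  · obtain ⟨j, h1⟩ := Finset.card_eq_one.1 hcard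
    have hj : j ∈ S ∩ W := by simp [h1]
    rw [Finset.mem_inter] at hj
    refine main j hj.1 fun k hk hkj => hf.leads_of_notMem H hj.2 fun hkW => hkj ?_
    have : k ∈ S ∩ W := Finset.mem_inter.2 ⟨hk, hkW⟩
    simpa [h1] using this
  · obtain ⟨j, k, hjk, h2⟩ := Finset.card_eq_two.1 hcard
    have hj : j ∈ S ∩ W := by simp [h2]
    have hk : k ∈ S ∩ W := by simp [h2]
    rw [Finset.mem_inter] at hj hk
    obtain ⟨σ, hσ⟩ := hf.exists_signs H
    set r := y - x - Pi.single j ((y - x) j) - Pi.single k ((y - x) k) with hr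
    have hd : Disjoint (supp r) W := by
      rw [Finset.disjoint_left]
      intro l hl hlW
      have hl := mem_supp.1 hl
      by_cases hlj : l = j
      · subst hlj; simp [hr, hjk] at hl
      by_cases hlk : l = k
      · subst hlk; simp [hr, hlj] at hl
      have : l ∈ S ∩ W := Finset.mem_inter.2 ⟨mem_supp.2 (by simpa [hr, hlj, hlk] using hl), hlW⟩
      simp [h2, hlj, hlk] at this
    obtain ⟨g, -, hg⟩ := hf.exists_only_of_hub (hf.hub_add H hσ hd) hj.2 hk.2 hjk
      (mem_supp.1 hj.1) (mem_supp.1 hk.1)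
    have e : x + r + Pi.single j ((y - x) j) + Pi.single k ((y - x) k) = y := by
      rw [hr]; abel
    rw [e] at hg
    exact hy.not_only hg

end Fintype

end HammingThree

/-! ### Zero patterns and exceptional alternating triangles. -/

namespace HammingThree

variable {ι : Type*} [DecidableEq ι]

variable {f : (ι → ZMod 3) → ZMod 3 → Prop} {p : ι → ZMod 3} {c s t u x y z w : ZMod 3}
  {i j k l v : ι}

/-- The three points obtained from `p + x eᵢ + y eⱼ + z eₖ` by flipping one sign have colour `c`. -/
def ZeroAt (f : (ι → ZMod 3) → ZMod 3 → Prop) (p : ι → ZMod 3) (c : ZMod 3) (i j k : ι)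
    (x y z : ZMod 3) : Prop :=
  f (p + Pi.single i (-x) + Pi.single j y + Pi.single k z) c ∧
  f (p + Pi.single i x + Pi.single j (-y) + Pi.single k z) c ∧
  f (p + Pi.single i x + Pi.single j y + Pi.single k (-z)) c

/-- The colours of the points obtained from `p ± (x eᵢ + y eⱼ + z eₖ)` by flipping one sign. -/
def MixedAt (f : (ι → ZMod 3) → ZMod 3 → Prop) (p : ι → ZMod 3) (c : ZMod 3) (i j k : ι)
    (x y z a b d : ZMod 3) : Prop :=
  (f (p + Pi.single i (-x) + Pi.single j y + Pi.single k z) (c + a) ∧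
    f (p + Pi.single i x + Pi.single j (-y) + Pi.single k (-z)) (c + a)) ∧
  (f (p + Pi.single i x + Pi.single j (-y) + Pi.single k z) (c + b) ∧
    f (p + Pi.single i (-x) + Pi.single j y + Pi.single k (-z)) (c + b)) ∧
  (f (p + Pi.single i x + Pi.single j y + Pi.single k (-z)) (c + d) ∧
    f (p + Pi.single i (-x) + Pi.single j (-y) + Pi.single k z) (c + d))

/-- The exceptional alternating triangles. -/
def Mixed (f : (ι → ZMod 3) → ZMod 3 → Prop) (p : ι → ZMod 3) (c : ZMod 3) (i j k : ι) : Prop :=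
  ∃ x y z u a b d : ZMod 3, (x ≠ 0 ∧ y ≠ 0 ∧ z ≠ 0 ∧ u ≠ 0) ∧
    (Alt f p c i j (u * x * y) ∧ Alt f p c i k (u * x * z) ∧ Alt f p c j k (u * y * z)) ∧
    ((a = u ∧ b = 0 ∧ d = 0) ∨ (a = 0 ∧ b = u ∧ d = 0) ∨ (a = 0 ∧ b = 0 ∧ d = u)) ∧
    MixedAt f p c i j k x y z a b d

theorem ZeroAt.swap (h : ZeroAt f p c i j k x y z) : ZeroAt f p c i k j x z y := by
  obtain ⟨h₁, h₂, h₃⟩ := h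
  refine ⟨?_, ?_, ?_⟩ <;> rw [add_right_comm] <;> assumption

theorem MixedAt.swap {a b d : ZMod 3} (h : MixedAt f p c i j k x y z a b d) :
    MixedAt f p c i k j x z y a d b := by
  obtain ⟨⟨h₁, h₂⟩, ⟨h₃, h₄⟩, ⟨h₅, h₆⟩⟩ := h
  refine ⟨⟨?_, ?_⟩, ⟨?_, ?_⟩, ⟨?_, ?_⟩⟩ <;> rw [add_right_comm] <;> assumption

theorem MixedAt.swap' {a b d : ZMod 3} (h : MixedAt f p c i j k x y z a b d) :
    MixedAt f p c j i k y x z b a d := by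
  obtain ⟨⟨h₁, h₂⟩, ⟨h₃, h₄⟩, ⟨h₅, h₆⟩⟩ := h
  refine ⟨⟨?_, ?_⟩, ⟨?_, ?_⟩, ⟨?_, ?_⟩⟩ <;> rw [add_right_comm p] <;> assumption

theorem MixedAt.neg {a b d : ZMod 3} (h : MixedAt f p c i j k x y z a b d) :
    MixedAt f p c i j k (-x) (-y) (-z) a b d := by
  obtain ⟨⟨h₁, h₂⟩, ⟨h₃, h₄⟩, ⟨h₅, h₆⟩⟩ := h
  refine ⟨⟨?_, ?_⟩, ⟨?_, ?_⟩, ⟨?_, ?_⟩⟩ <;> simpa only [neg_neg]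

theorem Mixed.swap (h : Mixed f p c i j k) : Mixed f p c i k j := by
  obtain ⟨x, y, z, u, a, b, d, ⟨hx, hy, hz, hu⟩, ⟨h₁, h₂, h₃⟩, h₄, h₅⟩ := h
  refine ⟨x, z, y, u, a, d, b, ⟨hx, hz, hy, hu⟩, ⟨h₂, h₁, ?_⟩, by tauto, h₅.swap⟩
  rw [mul_right_comm]; exact h₃.symm

theorem Mixed.swap' (h : Mixed f p c i j k) : Mixed f p c j i k := by
  obtain ⟨x, y, z, u, a, b, d, ⟨hx, hy, hz, hu⟩, ⟨h₁, h₂, h₃⟩, h₄, h₅⟩ := h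
  refine ⟨y, x, z, u, b, a, d, ⟨hy, hx, hz, hu⟩, ⟨?_, h₃, h₂⟩, by tauto, h₅.swap'⟩
  rw [mul_right_comm]; exact h₁.symm

theorem pull_mixedWords {js : List (ι × ZMod 3)} {i' j' k' m q a' b' d' : ℕ}
    {a b d κ σ₁ σ₂ σ₃ : ZMod 3}
    (hi : js[i']? = some (i, σ₁)) (hj : js[j']? = some (j, σ₂)) (hk : js[k']? = some (k, σ₃))
    (hn : [i', j', k'].Nodup) (hx : x = σ₁ * a') (hy : y = σ₂ * b') (hz : z = σ₃ * d')
    (ha : a = κ * ((if m = 0 then q else 0 : ℕ) : ZMod 3))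
    (hb : b = κ * ((if m = 1 then q else 0 : ℕ) : ZMod 3))
    (hd : d = κ * ((if m = 2 then q else 0 : ℕ) : ZMod 3)) (h : MixedAt f p c i j k x y z a b d) :
    ∀ w ∈ mixedWords (js.length + 1) i' j' k' a' b' d' m q, pull f p js c κ w := by
  obtain ⟨⟨h₁, h₂⟩, ⟨h₃, h₄⟩, ⟨h₅, h₆⟩⟩ := h
  have e : ∀ (σ : ZMod 3) (a : ℕ), σ * (2 * a : ℕ) = - (σ * a) := by
    intro σ a
    have h3 : (3 : ZMod 3) = 0 := by decide
    push_cast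
    linear_combination σ * a * h3
  simp only [mixedWords, List.forall_mem_cons, List.not_mem_nil, false_imp_iff, implies_true,
      and_true, pull_word_three hi hj hk hn, e, ← hx, ← hy, ← hz, ← ha, ← hb, ← hd]
  exact ⟨h₁, h₂, h₃, h₄, h₅, h₆⟩

section Hub

variable (hf : Valid f) (H : Hub f p Set.univ c)
include hf H

/-- Rescaling by x, y, z, w puts both zero patterns at the all-ones vector and makes every sign
except that of k, l positive; the last sign is enumerated. -/
theorem Valid.not_zeroAt_zeroAt (hn : [i, j, k, l].Nodup) (hx : x ≠ 0) (hy : y ≠ 0) (hz : z ≠ 0)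
    (hw : w ≠ 0) (hu : u ≠ 0) (hij : Alt f p c i j (u * x * y)) (hik : Alt f p c i k (u * x * z))
    (hjk : Alt f p c j k (u * y * z)) (hil : Alt f p c i l (u * x * w))
    (hjl : Alt f p c j l (u * y * w)) (hkl : Alt f p c k l s) (h₁ : ZeroAt f p c i j k x y z)
    (h₂ : ZeroAt f p c i j l x y w) : False := by
  have h0 : ∀ q ∈ [(i, x), (j, y), (k, z), (l, w)], q.2 ≠ 0 := by simp [*]
  obtain ⟨q, hq, eq⟩ := exists_sign (mul_ne_zero hu (mul_ne_zero (mul_ne_zero hkl.1 hz) hw))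
  have key : ∀ u x y : ZMod 3, x ≠ 0 → y ≠ 0 → u * (1 : ℕ) = u * x * y * x * y := by decide
  have hu2 := mul_self_of_ne_zero hu
  have e₁ : ∀ x : ZMod 3, x * (1 : ℕ) = x := by decide
  have e₂ : ∀ x : ZMod 3, x * (2 * 1 : ℕ) = -x := by decide
  obtain ⟨a₁, a₂, a₃⟩ := h₁
  obtain ⟨b₁, b₂, b₃⟩ := h₂
  refine hf.refuted (refute_zero_zero q hq) p [(i, x), (j, y), (k, z), (l, w)] rfl hn h0 c u hu ?_
  simp only [List.forall_mem_append]
  refine ⟨⟨⟨⟨⟨⟨⟨⟨H.pull h0 _ (by simp), hij.pull h0 rfl rfl (by decide) (key _ _ _ hx hy)⟩,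
    hik.pull h0 rfl rfl (by decide) (key _ _ _ hx hz)⟩,
    hjk.pull h0 rfl rfl (by decide) (key _ _ _ hy hz)⟩,
    hil.pull h0 rfl rfl (by decide) (key _ _ _ hx hw)⟩,
    hjl.pull h0 rfl rfl (by decide) (key _ _ _ hy hw)⟩,
    hkl.pull h0 rfl rfl (by decide) (by rw [eq]; linear_combination (s * z * w) * hu2)⟩, ?_⟩, ?_⟩
  all_goals
    simp only [zeroWords, List.forall_mem_cons, List.not_mem_nil, false_imp_iff, implies_true,
      and_true]
    refine ⟨(pull_word_three (js := [(i, x), (j, y), (k, z), (l, w)]) rfl rfl rfl (by decide)).2 ?_,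
      (pull_word_three (js := [(i, x), (j, y), (k, z), (l, w)]) rfl rfl rfl (by decide)).2 ?_,
      (pull_word_three (js := [(i, x), (j, y), (k, z), (l, w)]) rfl rfl rfl (by decide)).2 ?_⟩
    all_goals rw [e₁, e₁, e₂, Nat.cast_zero, mul_zero, add_zero]; assumption

/-- The vector of an exceptional triangle may be negated, so the two vectors can be taken to agree
at j. The ratio q of their entries at i is then also the ratio of the two colour scales. -/
theorem Valid.not_mixed_mixed (hn : [i, j, k, l].Nodup) (hkl : Alt f p c k l s)
    (h₁ : Mixed f p c i j k) (h₂ : Mixed f p c i j l) : False := by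
  obtain ⟨x, y, z, u, a, b, d, ⟨hx, hy, hz, hu⟩, ⟨hij, hik, hjk⟩, hc, hm⟩ := h₁
  obtain ⟨x', y', w, u', a', b', d', ⟨hx', hy', hw, hu'⟩, ⟨hij', hil, hjl⟩, hc', hm'⟩ := h₂
  -- normalise the sign of the second vector
  obtain ⟨x', w, hx', hw, hij', hil, hjl, hm'⟩ : ∃ x' w, x' ≠ 0 ∧ w ≠ 0 ∧
      Alt f p c i j (u' * x' * y) ∧ Alt f p c i l (u' * x' * w) ∧ Alt f p c j l (u' * y * w) ∧
      MixedAt f p c i j l x' y w a' b' d' := by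
    have : ∀ y y' : ZMod 3, y ≠ 0 → y' ≠ 0 → y = y' ∨ y = -y' := by decide
    rcases this y y' hy hy' with rfl | rfl
    · exact ⟨x', w, hx', hw, hij', hil, hjl, hm'⟩
    · refine ⟨-x', -w, neg_ne_zero.2 hx', neg_ne_zero.2 hw, ?_, ?_, ?_, hm'.neg⟩
      · convert hij' using 1; ring
      · convert hil using 1; ring
      · convert hjl using 1; ring
  have hxx := hij.sign_eq hij'
  have h0 : ∀ q ∈ [(i, x), (j, y), (k, z), (l, w)], q.2 ≠ 0 := by simp [*]
  obtain ⟨q, hq, eq⟩ := exists_sign (mul_ne_zero hx hx')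
  obtain ⟨r, hr, er⟩ := exists_sign (mul_ne_zero hu (mul_ne_zero (mul_ne_zero hkl.1 hz) hw))
  have key : ∀ u x y : ZMod 3, x ≠ 0 → y ≠ 0 → u * (1 : ℕ) = u * x * y * x * y := by decide
  have hu2 := mul_self_of_ne_zero hu
  have hx2 := mul_self_of_ne_zero hx
  have hx2' := mul_self_of_ne_zero hx'
  have hy2 := mul_self_of_ne_zero hy
  have hw2 := mul_self_of_ne_zero hw
  have hux : u * x = u' * x' := by linear_combination y * hxx + (u' * x' - u * x) * hy2
  have huq : u' = u * q := by
    rw [eq]; linear_combination (-x') * hux - u' * hx2'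
  have pat : ∀ {a b d u v : ZMod 3} {q : ℕ}, u = v * q →
      ((a = u ∧ b = 0 ∧ d = 0) ∨ (a = 0 ∧ b = u ∧ d = 0) ∨ (a = 0 ∧ b = 0 ∧ d = u)) →
      ∃ m ∈ [0, 1, 2], a = v * ((if m = 0 then q else 0 : ℕ) : ZMod 3) ∧
        b = v * ((if m = 1 then q else 0 : ℕ) : ZMod 3) ∧
        d = v * ((if m = 2 then q else 0 : ℕ) : ZMod 3) := by
    rintro a b d u v q rfl (⟨rfl, rfl, rfl⟩ | ⟨rfl, rfl, rfl⟩ | ⟨rfl, rfl, rfl⟩)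
    · exact ⟨0, by simp⟩
    · exact ⟨1, by simp⟩
    · exact ⟨2, by simp⟩
  obtain ⟨m, hm3, ea, eb, ed⟩ := pat (q := 1) (v := u) (by simp) hc
  obtain ⟨m', hm3', ea', eb', ed'⟩ := pat huq hc'
  refine hf.refuted (refute_mixed_mixed q hq r hr m hm3 m' hm3') p [(i, x), (j, y), (k, z), (l, w)]
    rfl hn h0 c u hu ?_
  simp only [List.forall_mem_append]
  refine ⟨⟨⟨⟨⟨⟨⟨⟨H.pull h0 _ (by simp), hij.pull h0 rfl rfl (by decide) (key _ _ _ hx hy)⟩,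
    hik.pull h0 rfl rfl (by decide) (key _ _ _ hx hz)⟩,
    hjk.pull h0 rfl rfl (by decide) (key _ _ _ hy hz)⟩,
    hil.pull h0 rfl rfl (by decide) ?_⟩,
    hjl.pull h0 rfl rfl (by decide) ?_⟩,
    hkl.pull h0 rfl rfl (by decide) (by rw [er]; linear_combination (s * z * w) * hu2)⟩,
    pull_mixedWords (js := [(i, x), (j, y), (k, z), (l, w)]) rfl rfl rfl (by decide) (by simp)
      (by simp) (by simp) ea eb ed hm⟩,
    pull_mixedWords (js := [(i, x), (j, y), (k, z), (l, w)]) rfl rfl rfl (by decide) ?_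
      (by simp) (by simp) ea' eb' ed' hm'⟩
  · push_cast
    linear_combination x * w * w * hux - u * hx2 - u * x * x * hw2
  · rw [huq]
    linear_combination (-(u * q)) * hy2 - u * q * y * y * hw2
  · rw [eq]; linear_combination (-x') * hx2

theorem Valid.zeroAt_or_mixed (hn : [i, j, k].Nodup) (hx : x ≠ 0) (hy : y ≠ 0) (hz : z ≠ 0)
    (hu : u ≠ 0) (hij : Alt f p c i j (u * x * y)) (hik : Alt f p c i k (u * x * z))
    (hjk : Alt f p c j k (u * y * z)) : ZeroAt f p c i j k x y z ∨
      ZeroAt f p c i j k (-x) (-y) (-z) ∨ Mixed f p c i j k := by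
  have h0 : ∀ q ∈ [(i, x), (j, y), (k, z)], q.2 ≠ 0 := by simp [*]
  have col : ∀ q, ∃ a ∈ [0, 1, 2], f q (c + u * (a : ℕ)) := by
    intro q
    obtain ⟨e, he⟩ := hf.nonempty q
    have : ∀ e c u : ZMod 3, u ≠ 0 → ∃ a ∈ [0, 1, 2], e = c + u * (a : ℕ) := by decide
    obtain ⟨a, ha, rfl⟩ := this e c u hu
    exact ⟨a, ha, he⟩
  obtain ⟨a, ha, fa⟩ := col (p + Pi.single i (-x) + Pi.single j y + Pi.single k z)
  obtain ⟨a', ha', fa'⟩ := col (p + Pi.single i x + Pi.single j (-y) + Pi.single k (-z))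
  obtain ⟨b, hb, fb⟩ := col (p + Pi.single i x + Pi.single j (-y) + Pi.single k z)
  obtain ⟨b', hb', fb'⟩ := col (p + Pi.single i (-x) + Pi.single j y + Pi.single k (-z))
  obtain ⟨d, hd, fd⟩ := col (p + Pi.single i x + Pi.single j y + Pi.single k (-z))
  obtain ⟨d', hd', fd'⟩ := col (p + Pi.single i (-x) + Pi.single j (-y) + Pi.single k z)
  rcases mixed_cases a ha b hb d hd a' ha' b' hb' d' hd' with ⟨rfl, rfl, rfl⟩ | ⟨rfl, rfl, rfl⟩ |
    ⟨m, hm, rfl, rfl, rfl, rfl, rfl, rfl⟩ | hr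
  · rw [Nat.cast_zero, mul_zero, add_zero] at fa fb fd
    exact Or.inl ⟨fa, fb, fd⟩
  · rw [Nat.cast_zero, mul_zero, add_zero] at fa' fb' fd'
    exact Or.inr (Or.inl ⟨by rwa [neg_neg], by rwa [neg_neg], by rwa [neg_neg]⟩)
  · refine Or.inr (Or.inr ⟨x, y, z, u, _, _, _, ⟨hx, hy, hz, hu⟩, ⟨hij, hik, hjk⟩, ?_,
      ⟨fa, fa'⟩, ⟨fb, fb'⟩, ⟨fd, fd'⟩⟩)
    simp only [List.mem_cons, List.not_mem_nil, or_false] at hm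
    rcases hm with rfl | rfl | rfl <;> simp
  · exfalso
    have key : ∀ u x y : ZMod 3, x ≠ 0 → y ≠ 0 → u * (1 : ℕ) = u * x * y * x * y := by decide
    have e₁ : ∀ x : ZMod 3, x * (1 : ℕ) = x := by decide
    have e₂ : ∀ x : ZMod 3, x * (2 : ℕ) = -x := by decide
    refine hf.refuted hr p [(i, x), (j, y), (k, z)] rfl hn h0 c u hu ?_
    simp only [List.forall_mem_append]
    refine ⟨⟨⟨⟨H.pull h0 _ (by simp), hij.pull h0 rfl rfl (by decide) (key _ _ _ hx hy)⟩,
      hik.pull h0 rfl rfl (by decide) (key _ _ _ hx hz)⟩,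
      hjk.pull h0 rfl rfl (by decide) (key _ _ _ hy hz)⟩, ?_⟩
    have W : ∀ {t a b d : ℕ}, _ := fun {t a b d} => pull_word_three (f := f) (p := p) (c := c)
      (κ := u) (t := t) (a := a) (b := b) (e := d) (js := [(i, x), (j, y), (k, z)]) (i := 0)
      (i' := 1) (i'' := 2) rfl rfl rfl (by decide)
    simp only [List.forall_mem_cons, List.not_mem_nil, false_imp_iff, implies_true, and_true]
    refine ⟨W.2 ?_, W.2 ?_, W.2 ?_, W.2 ?_, W.2 ?_, W.2 ?_⟩ <;> simp only [e₁, e₂] <;> assumption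

end Hub

end HammingThree

/-! ### A Ramsey argument in an alternating clique. -/

namespace HammingThree

set_option synthInstance.maxSize 2000 in
set_option synthInstance.maxHeartbeats 400000 in
/-- A two-colouring of the edges of `K₅` without monochromatic triangle has a pentagon of each
colour. -/
theorem exists_pentagon (χ : Fin 5 → Fin 5 → Bool) (hs : ∀ i j, χ i j = χ j i)
    (h : ∀ i j k, i < j → j < k → ¬ (χ i j = χ i k ∧ χ i j = χ j k)) :
    ∃ σ : Fin 5 → Fin 5, Function.Injective σ ∧ ∀ r, χ (σ r) (σ (r + 1)) = true := by
  -- The disjuncts are the twelve Hamiltonian cycles of `K₅`.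
  have key : ∀ ab ac ad ae bc bd be cd ce de : Bool,
      ¬ (ab = ac ∧ ab = bc) ∧ ¬ (ab = ad ∧ ab = bd) ∧ ¬ (ab = ae ∧ ab = be) ∧
      ¬ (ac = ad ∧ ac = cd) ∧ ¬ (ac = ae ∧ ac = ce) ∧ ¬ (ad = ae ∧ ad = de) ∧
      ¬ (bc = bd ∧ bc = cd) ∧ ¬ (bc = be ∧ bc = ce) ∧ ¬ (bd = be ∧ bd = de) ∧
      ¬ (cd = ce ∧ cd = de) →
      (ab && bc && cd && de && ae) || (ab && bc && ce && de && ad) ||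
      (ab && bd && cd && ce && ae) || (ab && bd && de && ce && ac) ||
      (ab && be && ce && cd && ad) || (ab && be && de && cd && ac) ||
      (ac && bc && bd && de && ae) || (ac && bc && be && de && ad) ||
      (ac && cd && bd && be && ae) || (ac && ce && be && bd && ad) ||
      (ad && bd && bc && ce && ae) || (ad && cd && bc && be && ae) := by
    decide +kernel
  have := key (χ 0 1) (χ 0 2) (χ 0 3) (χ 0 4) (χ 1 2) (χ 1 3) (χ 1 4) (χ 2 3) (χ 2 4) (χ 3 4)
    ⟨h 0 1 2 (by decide) (by decide), h 0 1 3 (by decide) (by decide),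
      h 0 1 4 (by decide) (by decide), h 0 2 3 (by decide) (by decide),
      h 0 2 4 (by decide) (by decide), h 0 3 4 (by decide) (by decide),
      h 1 2 3 (by decide) (by decide), h 1 2 4 (by decide) (by decide),
      h 1 3 4 (by decide) (by decide), h 2 3 4 (by decide) (by decide)⟩
  have fin : ∀ a b c d e : Fin 5, Function.Injective ![a, b, c, d, e] → χ a b = true →
      χ b c = true → χ c d = true → χ d e = true → χ e a = true →
      ∃ σ : Fin 5 → Fin 5, Function.Injective σ ∧ ∀ r, χ (σ r) (σ (r + 1)) = true := by
    intro a b c d e hσ h₁ h₂ h₃ h₄ h₅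
    refine ⟨![a, b, c, d, e], hσ, fun r => ?_⟩
    fin_cases r <;> assumption
  simp only [Bool.or_eq_true, Bool.and_eq_true] at this
  rcases this with ((((((((((h | h) | h) | h) | h) | h) | h) | h) | h) | h) | h) | h <;>
    obtain ⟨⟨⟨⟨h₁, h₂⟩, h₃⟩, h₄⟩, h₅⟩ := h
  · exact fin 0 1 2 3 4 (by decide) h₁ h₂ h₃ h₄ (by rwa [hs])
  · exact fin 0 1 2 4 3 (by decide) h₁ h₂ h₃ (by rwa [hs]) (by rwa [hs])
  · exact fin 0 1 3 2 4 (by decide) h₁ h₂ (by rwa [hs]) h₄ (by rwa [hs])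
  · exact fin 0 1 3 4 2 (by decide) h₁ h₂ h₃ (by rwa [hs]) (by rwa [hs])
  · exact fin 0 1 4 2 3 (by decide) h₁ h₂ (by rwa [hs]) h₄ (by rwa [hs])
  · exact fin 0 1 4 3 2 (by decide) h₁ h₂ (by rwa [hs]) (by rwa [hs]) (by rwa [hs])
  · exact fin 0 2 1 3 4 (by decide) h₁ (by rwa [hs]) h₃ h₄ (by rwa [hs])
  · exact fin 0 2 1 4 3 (by decide) h₁ (by rwa [hs]) h₃ (by rwa [hs]) (by rwa [hs])
  · exact fin 0 2 3 1 4 (by decide) h₁ h₂ (by rwa [hs]) h₄ (by rwa [hs])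
  · exact fin 0 2 4 1 3 (by decide) h₁ h₂ (by rwa [hs]) h₄ (by rwa [hs])
  · exact fin 0 3 1 2 4 (by decide) h₁ (by rwa [hs]) h₃ h₄ (by rwa [hs])
  · exact fin 0 3 2 1 4 (by decide) h₁ (by rwa [hs]) (by rwa [hs]) h₄ (by rwa [hs])

variable {ι : Type*} [DecidableEq ι]

variable {f : (ι → ZMod 3) → ZMod 3 → Prop} {p : ι → ZMod 3} {c u : ZMod 3} {S : Finset ι}
  {s : ι → ι → ZMod 3} {v i j k l : ι}

/-- The product of the signs of the edges of a triangle. -/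
def tri (s : ι → ι → ZMod 3) (i j k : ι) : ZMod 3 := s i j * s i k * s j k

section Clique

variable (hf : Valid f) (H : Hub f p Set.univ c)
  (hs : ∀ i ∈ S, ∀ j ∈ S, i ≠ j → Alt f p c i j (s i j))
include hs

theorem sign_comm (hi : i ∈ S) (hj : j ∈ S) (hij : i ≠ j) : s i j = s j i :=
  (hs i hi j hj hij).sign_eq (hs j hj i hi hij.symm).symm

theorem tri_ne_zero (hi : i ∈ S) (hj : j ∈ S) (hk : k ∈ S) (hn : [i, j, k].Nodup) :
    tri s i j k ≠ 0 := by
  simp only [List.nodup_cons, List.mem_cons, not_or, List.not_mem_nil, or_false] at hn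
  exact mul_ne_zero (mul_ne_zero (hs i hi j hj hn.1.1).1 (hs i hi k hk hn.1.2).1)
    (hs j hj k hk hn.2.1).1

theorem tri_swap (hj : j ∈ S) (hk : k ∈ S) (hjk : j ≠ k) : tri s i j k = tri s i k j := by
  rw [tri, tri, sign_comm hs hj hk hjk]; ring

include hf H

/-- Rescaling by the signs at v reduces the signs among i, j, k to the triangle signs. If these all
equal u, the six alternations take the common sign u, against `Valid.not_alt_hom`. -/
theorem Valid.not_tri_eq (hS : ∀ x ∈ [v, i, j, k], x ∈ S) (hn : [v, i, j, k].Nodup) :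
    ¬ (tri s v i j = tri s v i k ∧ tri s v i j = tri s v j k) := by
  rintro ⟨h₁, h₂⟩
  have hn' := hn
  simp only [List.nodup_cons, List.mem_cons, not_or, List.not_mem_nil, or_false] at hn'
  obtain ⟨⟨n₁, n₂, n₃⟩, ⟨n₄, n₅⟩, n₆, -⟩ := hn'
  have hv := hS v (by simp)
  have hi := hS i (by simp)
  have hj := hS j (by simp)
  have hk := hS k (by simp)
  have a₁ := hs v hv i hi n₁
  have a₂ := hs v hv j hj n₂
  have a₃ := hs v hv k hk n₃
  have hu := tri_ne_zero hs hv hi hj (by simp [*])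
  have e₁ := mul_self_of_ne_zero a₁.1
  have e₂ := mul_self_of_ne_zero a₂.1
  have e₃ := mul_self_of_ne_zero a₃.1
  have eu := mul_self_of_ne_zero hu
  refine hf.not_alt_hom H hn (by simp) (σ₁ := 1) (σ₂ := tri s v i j * s v i)
    (σ₃ := tri s v i j * s v j) (σ₄ := tri s v i j * s v k) hu ?_ a₁ a₂ a₃ (hs i hi j hj n₄)
    (hs i hi k hk n₅) (hs j hj k hk n₆) ?_ ?_ ?_ ?_ ?_ ?_
  · simp [hu, a₁.1, a₂.1, a₃.1]
  · linear_combination tri s v i j * e₁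
  · linear_combination tri s v i j * e₂
  · linear_combination tri s v i j * e₃
  · linear_combination (s i j * s v i * s v j) * eu +
      (by rw [tri]; ring : s i j * s v i * s v j = tri s v i j)
  · linear_combination (s i k * s v i * s v k) * eu - h₁ +
      (by rw [tri]; ring : s i k * s v i * s v k = tri s v i k)
  · linear_combination (s j k * s v j * s v k) * eu - h₂ +
      (by rw [tri]; ring : s j k * s v j * s v k = tri s v j k)

/-- In an alternating clique on six directions, every direction lies in an exceptional triangle of
each sign. -/
theorem Valid.exists_mixed (hcard : S.card = 6) (hv : v ∈ S) (hu : u ≠ 0) :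
    ∃ i ∈ S, ∃ j ∈ S, [v, i, j].Nodup ∧ tri s v i j = u ∧ Mixed f p c v i j := by
  by_contra! hno
  have h5 : (S.erase v).card = 5 := by rw [Finset.card_erase_of_mem hv, hcard]
  set e := (Finset.equivFinOfCardEq h5).symm
  have eS : ∀ r, (e r : ι) ∈ S := fun r => Finset.mem_of_mem_erase (e r).2
  have ev : ∀ r, v ≠ e r := fun r => (Finset.ne_of_mem_erase (e r).2).symm
  have einj : ∀ r r', r ≠ r' → (e r : ι) ≠ e r' := fun r r' hr h =>
    hr (e.injective (Subtype.ext h))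
  have symm : ∀ r r', tri s v (e r) (e r') = tri s v (e r') (e r) := by
    intro r r'
    by_cases h : r = r'
    · rw [h]
    · exact tri_swap hs (eS r) (eS r') (einj r r' h)
  -- Colour the pairs of the other five directions by the sign of their triangle with v. No triangle
  -- is monochromatic, so the sign u contains a pentagon.
  obtain ⟨σ, hσ, hpent⟩ := exists_pentagon (fun r r' => decide (tri s v (e r) (e r') = u))
    (fun r r' => by rw [symm]) (by
      intro a b d hab hbd h
      have hn : [v, (e a : ι), (e b : ι), (e d : ι)].Nodup := by
        simp [ev, einj _ _ hab.ne, einj _ _ hbd.ne, einj _ _ (hab.trans hbd).ne]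
      refine hf.not_tri_eq H hs (by simp [hv, eS]) hn ?_
      have n₁ := tri_ne_zero hs hv (eS a) (eS b) (by simp [ev, einj _ _ hab.ne])
      have n₂ := tri_ne_zero hs hv (eS a) (eS d) (by simp [ev, einj _ _ (hab.trans hbd).ne])
      have n₃ := tri_ne_zero hs hv (eS b) (eS d) (by simp [ev, einj _ _ hbd.ne])
      have key : ∀ x y u : ZMod 3, x ≠ 0 → y ≠ 0 → u ≠ 0 → decide (x = u) = decide (y = u) →
        x = y := by decide
      exact ⟨key _ _ u n₁ n₂ hu h.1, key _ _ u n₁ n₃ hu h.2⟩)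
  simp only [decide_eq_true_eq] at hpent
  set w : Fin 5 → ι := fun r => e (σ r) with hw
  have wS : ∀ r, w r ∈ S := fun r => eS _
  have wv : ∀ r, v ≠ w r := fun r => ev _
  have winj : ∀ r r', r ≠ r' → w r ≠ w r' := fun r r' hr => einj _ _ (hσ.ne hr)
  have hr1 : ∀ r : Fin 5, r ≠ r + 1 := by decide
  have hr2 : ∀ r : Fin 5, r ≠ r + 1 + 1 := by decide
  have hwt : ∀ r, tri s v (w r) (w (r + 1)) = u := hpent
  have sv : ∀ r, s v (w r) * s v (w r) = 1 := fun r =>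
    mul_self_of_ne_zero (hs v hv _ (wS r) (wv r)).1
  have uu := mul_self_of_ne_zero hu
  have A₁ : ∀ (r : Fin 5) (ε : ZMod 3), ε ≠ 0 →
      Alt f p c v (w r) (u * ε * (u * s v (w r) * ε)) := by
    intro r ε hε
    have := mul_self_of_ne_zero hε
    convert hs v hv _ (wS r) (wv r) using 1
    linear_combination s v (w r) * ε * ε * uu + s v (w r) * this
  have A₂ : ∀ (r : Fin 5) (ε : ZMod 3), ε ≠ 0 →
      Alt f p c (w r) (w (r + 1)) (u * (u * s v (w r) * ε) * (u * s v (w (r + 1)) * ε)) := by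
    intro r ε hε
    have := mul_self_of_ne_zero hε
    have ht := hwt r
    rw [tri] at ht
    convert hs _ (wS r) _ (wS (r + 1)) (winj _ _ (hr1 r)) using 1
    linear_combination (u * u * u * s v (w r) * s v (w (r + 1))) * this +
      u * s v (w r) * s v (w (r + 1)) * uu - s v (w r) * s v (w (r + 1)) * ht +
      s v (w (r + 1)) * s v (w (r + 1)) * s (w r) (w (r + 1)) * sv r +
      s (w r) (w (r + 1)) * sv (r + 1)
  -- A non-exceptional triangle has a zero pattern at its sign vector or at the negative; ε records
  -- which.
  have zero : ∀ r, ∃ ε ≠ 0, ZeroAt f p c v (w r) (w (r + 1)) ε (u * s v (w r) * ε)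
      (u * s v (w (r + 1)) * ε) := by
    intro r
    have hn : [v, w r, w (r + 1)].Nodup := by simp [wv, winj _ _ (hr1 r)]
    have nz : ∀ r, u * s v (w r) * 1 ≠ 0 := fun r =>
      mul_ne_zero (mul_ne_zero hu (hs v hv _ (wS r) (wv r)).1) one_ne_zero
    rcases hf.zeroAt_or_mixed H hn one_ne_zero (nz r) (nz (r + 1)) hu (A₁ r 1 one_ne_zero)
      (A₁ (r + 1) 1 one_ne_zero) (A₂ r 1 one_ne_zero) with h | h | h
    · exact ⟨1, one_ne_zero, h⟩
    · refine ⟨-1, by decide, ?_⟩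
      simpa only [mul_neg] using h
    · exact (hno _ (wS r) _ (wS _) hn (hwt r) h).elim
  choose ε hε hz using zero
  -- Consecutive triangles share the edge v, w (r + 1). Equal ε would make their zero patterns agree
  -- on it, against `Valid.not_zeroAt_zeroAt`.
  have alt : ∀ r, ε r ≠ ε (r + 1) := by
    intro r h
    have hz₁ := (hz r).swap
    have hz₂ := hz (r + 1)
    rw [← h] at hz₂
    have nz : ∀ r', u * s v (w r') * ε r ≠ 0 := fun r' =>
      mul_ne_zero (mul_ne_zero hu (hs v hv _ (wS r') (wv r')).1) (hε r)
    have hA₂ : Alt f p c (w (r + 1)) (w r)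
        (u * (u * s v (w (r + 1)) * ε r) * (u * s v (w r) * ε r)) := by
      rw [mul_right_comm]; exact (A₂ r _ (hε r)).symm
    exact hf.not_zeroAt_zeroAt H (by simp [wv, winj _ _ (hr1 _), (winj _ _ (hr1 _)).symm,
      winj _ _ (hr2 r)]) (hε r) (nz (r + 1)) (nz r) (nz (r + 1 + 1)) hu (A₁ _ _ (hε r))
      (A₁ _ _ (hε r)) hA₂ (A₁ _ _ (hε r)) (A₂ _ _ (hε r))
      (hs _ (wS r) _ (wS (r + 1 + 1)) (winj _ _ (hr2 r))) hz₁ hz₂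
  -- Two values cannot alternate around a cycle of length five.
  have odd : ∀ a b c : ZMod 3, a ≠ 0 ∧ b ≠ 0 ∧ c ≠ 0 ∧ a ≠ b ∧ b ≠ c → a = c := by decide
  have e₁ := odd _ _ _ ⟨hε 0, hε 1, hε 2, alt 0, alt 1⟩
  have e₂ := odd _ _ _ ⟨hε 2, hε 3, hε 4, alt 2, alt 3⟩
  exact alt 4 (e₂.symm.trans e₁.symm)

end Clique

end HammingThree

/-! ### No six pairwise alternating directions. -/

namespace HammingThree

/-- In a two-colouring of the edges of `K₅` without monochromatic triangle, in which `ab` and `cd`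
have different colours. -/
theorem sign_parity {ab ac ad ae bc bd be cd ce de : ZMod 3} (hab : ab = 1) (hcd : cd = 2)
    (hac : ac ≠ 0) (had : ad ≠ 0) (hae : ae ≠ 0) (hbc : bc ≠ 0) (hbd : bd ≠ 0) (hbe : be ≠ 0)
    (hce : ce ≠ 0) (hde : de ≠ 0) (h₁ : ¬ (ab = ac ∧ ab = bc)) (h₂ : ¬ (ab = ad ∧ ab = bd))
    (h₃ : ¬ (ab = ae ∧ ab = be)) (h₄ : ¬ (ac = ad ∧ ac = cd)) (h₅ : ¬ (ac = ae ∧ ac = ce))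
    (h₆ : ¬ (ad = ae ∧ ad = de)) (h₇ : ¬ (bc = bd ∧ bc = cd)) (h₈ : ¬ (bc = be ∧ bc = ce))
    (h₉ : ¬ (bd = be ∧ bd = de)) (h₁₀ : ¬ (cd = ce ∧ cd = de)) :
    ae * ce * ac = be * de * bd ∧ ae * de * ad = be * ce * bc := by
  subst hab hcd
  have key : ∀ x : ZMod 3, x ≠ 0 → x = 1 ∨ x = 2 := by decide
  rcases key _ hac with rfl | rfl <;> rcases key _ hbc with rfl | rfl <;>
    first | exact absurd ⟨rfl, rfl⟩ h₁ | skip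
  all_goals rcases key _ had with rfl | rfl <;> rcases key _ hbd with rfl | rfl <;>
    first | exact absurd ⟨rfl, rfl⟩ h₂ | exact absurd ⟨rfl, rfl⟩ h₄ | exact absurd ⟨rfl, rfl⟩ h₇ |
      skip
  all_goals rcases key _ hae with rfl | rfl <;> rcases key _ hbe with rfl | rfl <;>
    first | exact absurd ⟨rfl, rfl⟩ h₃ | skip
  all_goals rcases key _ hce with rfl | rfl <;> rcases key _ hde with rfl | rfl <;>
    first | exact absurd ⟨rfl, rfl⟩ h₅ | exact absurd ⟨rfl, rfl⟩ h₆ | exact absurd ⟨rfl, rfl⟩ h₈ |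
      exact absurd ⟨rfl, rfl⟩ h₉ | exact absurd ⟨rfl, rfl⟩ h₁₀ | decide

variable {ι : Type*} [DecidableEq ι]

variable {f : (ι → ZMod 3) → ZMod 3 → Prop} {p : ι → ZMod 3} {c u : ZMod 3} {S : Finset ι}
  {s : ι → ι → ZMod 3} {v i j k l e a b x y : ι}

section Clique

variable (hf : Valid f) (H : Hub f p Set.univ c)
  (hs : ∀ i ∈ S, ∀ j ∈ S, i ≠ j → Alt f p c i j (s i j))
include hs

/-- The signs of three triangles of a tetrahedron determine that of the fourth. -/
theorem tri_eq_mul (hS : ∀ x ∈ [v, i, j, k], x ∈ S) (hn : [v, i, j, k].Nodup) :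
    tri s i j k = tri s v i j * tri s v i k * tri s v j k := by
  simp only [List.nodup_cons, List.mem_cons, not_or, List.not_mem_nil, or_false] at hn
  obtain ⟨⟨n₁, n₂, n₃⟩, ⟨n₄, n₅⟩, n₆, -⟩ := hn
  have hv := hS v (by simp)
  have e₁ := mul_self_of_ne_zero (hs v hv i (hS i (by simp)) n₁).1
  have e₂ := mul_self_of_ne_zero (hs v hv j (hS j (by simp)) n₂).1
  have e₃ := mul_self_of_ne_zero (hs v hv k (hS k (by simp)) n₃).1
  have : tri s v i j * tri s v i k * tri s v j k =
    (s v i * s v i) * (s v j * s v j) * (s v k * s v k) * tri s i j k := by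
    simp only [tri]; ring
  rw [this, e₁, e₂, e₃, one_mul, one_mul, one_mul]

include hf H

/-- An exceptional triangle shares no edge with another one. -/
theorem Valid.not_mixed_of_mem (hS : ∀ x ∈ [i, a, b, e], x ∈ S) (hn : [i, a, b, e].Nodup)
    (h : Mixed f p c i a b) (hxy : x ≠ y) (hx : x = i ∨ x = a ∨ x = b)
    (hy : y = i ∨ y = a ∨ y = b) : ¬ Mixed f p c e x y := by
  simp only [List.nodup_cons, List.mem_cons, not_or, List.not_mem_nil, or_false] at hn
  obtain ⟨⟨n₁, n₂, n₃⟩, ⟨n₄, n₅⟩, n₆, -⟩ := hn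
  have hi := hS i (by simp)
  have ha := hS a (by simp)
  have hb := hS b (by simp)
  have he := hS e (by simp)
  have key : ∀ x y z, x ≠ y → x ≠ z → y ≠ z → x ≠ e → y ≠ e → z ≠ e → z ∈ S →
      Mixed f p c x y z → ¬ Mixed f p c e x y := by
    intro x y z hxy hxz hyz hx hy hz hzS h h'
    exact hf.not_mixed_mixed H (by simp [*]) (hs z hzS e he hz) h h'.swap'.swap
  intro h'
  rcases hx with rfl | rfl | rfl <;> rcases hy with rfl | rfl | rfl
  · exact hxy rfl
  · exact key _ _ _ n₁ n₂ n₄ n₃ n₅ n₆ hb h h'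
  · exact key _ _ _ n₂ n₁ (Ne.symm n₄) n₃ n₆ n₅ ha h.swap h'
  · exact key _ _ _ n₁ n₂ n₄ n₃ n₅ n₆ hb h h'.swap
  · exact hxy rfl
  · exact key _ _ _ n₄ (Ne.symm n₁) (Ne.symm n₂) n₅ n₆ n₃ hi h.swap'.swap h'
  · exact key _ _ _ n₂ n₁ (Ne.symm n₄) n₃ n₆ n₅ ha h.swap h'.swap
  · exact key _ _ _ n₄ (Ne.symm n₁) (Ne.symm n₂) n₅ n₆ n₃ hi h.swap'.swap h'.swap
  · exact hxy rfl

/-- Exceptional triangles of different signs at a direction have no other direction in common. -/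
theorem Valid.ne_of_mixed {a' b' : ι} (hS : ∀ x ∈ [v, a, b, a', b'], x ∈ S)
    (hn : [v, a, b].Nodup) (hn' : [v, a', b'].Nodup) (ht : tri s v a b ≠ tri s v a' b')
    (h : Mixed f p c v a b) (h' : Mixed f p c v a' b') : a ≠ a' := by
  rintro rfl
  have hbb : b ≠ b' := by rintro rfl; exact ht rfl
  simp only [List.nodup_cons, List.mem_cons, not_or, List.not_mem_nil, or_false] at hn hn'
  exact hf.not_mixed_mixed H (by simp [hn.1, hn.2.1, hn'.1, hn'.2.1, hbb])
    (hs b (hS b (by simp)) b' (hS b' (by simp)) hbb) h h'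

/-- By `tri_eq_mul` the signs at e are products of signs at v. What remains is a property of the
two-coloured `K₅` of triangle signs at v, settled by `sign_parity`. -/
theorem Valid.tri_parity {d g : ι} (hS : ∀ x ∈ [v, a, b, d, g, e], x ∈ S)
    (hn : [v, a, b, d, g, e].Nodup) (hab : tri s v a b = 1) (hdg : tri s v d g = 2) :
    tri s e a d = tri s e b g ∧ tri s e a g = tri s e b d := by
  simp only [List.nodup_cons, List.mem_cons, not_or, List.not_mem_nil, or_false] at hn
  obtain ⟨⟨va, vb, vd, vg, ve⟩, ⟨ab, ad, ag, ae⟩, ⟨bd, bg, be⟩, ⟨dg, de⟩, ge, -⟩ := hn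
  have hv := hS v (by simp)
  have ha := hS a (by simp)
  have hb := hS b (by simp)
  have hd := hS d (by simp)
  have hg := hS g (by simp)
  have he := hS e (by simp)
  have N : ∀ {i j k}, v ≠ i → v ≠ j → v ≠ k → i ≠ j → i ≠ k → j ≠ k → i ∈ S → j ∈ S → k ∈ S →
      ¬ (tri s v i j = tri s v i k ∧ tri s v i j = tri s v j k) :=
    fun h₁ h₂ h₃ h₄ h₅ h₆ hi hj hk => hf.not_tri_eq H hs (by simp [hi, hj, hk, hv])
      (by simp [h₁, h₂, h₃, h₄, h₅, h₆])
  have Z : ∀ {j k}, j ∈ S → k ∈ S → v ≠ j → v ≠ k → j ≠ k → tri s v j k ≠ 0 :=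
    fun hj hk h₁ h₂ h₃ => tri_ne_zero hs hv hj hk (by simp [h₁, h₂, h₃])
  have E : ∀ x y, x ∈ S → y ∈ S → v ≠ x → v ≠ y → x ≠ e → y ≠ e → x ≠ y →
      tri s e x y = tri s v x e * tri s v y e * tri s v x y := by
    intro x y hx hy vx vy hxe hye hxy
    rw [tri_eq_mul hs (v := v) (by simp [hx, hy, hv, he])
      (by simp [vx, vy, ve, Ne.symm hxe, Ne.symm hye, hxy]), tri_swap hs he hx (Ne.symm hxe),
      tri_swap hs he hy (Ne.symm hye)]
  rw [E a d ha hd va vd ae de ad, E b g hb hg vb vg be ge bg, E a g ha hg va vg ae ge ag,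
    E b d hb hd vb vd be de bd]
  exact sign_parity hab hdg (Z ha hd va vd ad) (Z ha hg va vg ag) (Z ha he va ve ae)
    (Z hb hd vb vd bd) (Z hb hg vb vg bg) (Z hb he vb ve be) (Z hd he vd ve de) (Z hg he vg ve ge)
    (N va vb vd ab ad bd ha hb hd) (N va vb vg ab ag bg ha hb hg) (N va vb ve ab ae be ha hb he)
    (N va vd vg ad ag dg ha hd hg) (N va vd ve ad ae de ha hd he) (N va vg ve ag ae ge ha hg he)
    (N vb vd vg bd bg dg hb hd hg) (N vb vd ve bd be de hb hd he) (N vb vg ve bg be ge hb hg he)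
    (N vd vg ve dg de ge hd hg he)

/-- There are no six pairwise alternating directions. -/
theorem Valid.card_ne_six : S.card ≠ 6 := by
  intro hcard
  obtain ⟨v, hv⟩ : S.Nonempty := Finset.card_pos.1 (by omega)
  obtain ⟨a, ha, b, hb, hn, hab, hM⟩ := hf.exists_mixed H hs hcard hv (by decide : (1 : ZMod 3) ≠ 0)
  obtain ⟨d, hd, g, hg, hn', hdg, hM'⟩ :=
    hf.exists_mixed H hs hcard hv (by decide : (2 : ZMod 3) ≠ 0)
  have ne : tri s v a b ≠ tri s v d g := by rw [hab, hdg]; decide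
  have hn₁ := hn
  have hn₂ := hn'
  simp only [List.nodup_cons, List.mem_cons, not_or, List.not_mem_nil, or_false] at hn₁ hn₂
  obtain ⟨⟨va, vb⟩, ab, -⟩ := hn₁
  obtain ⟨⟨vd, vg⟩, dg, -⟩ := hn₂
  have sab := tri_swap (i := v) hs ha hb ab
  have sdg := tri_swap (i := v) hs hd hg dg
  have ad : a ≠ d := hf.ne_of_mixed H hs (by simp [*]) hn hn' ne hM hM'
  have ag : a ≠ g := hf.ne_of_mixed H hs (by simp [*]) hn (by simp [vd, vg, Ne.symm dg])
    (by rwa [← sdg]) hM hM'.swap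
  have bd : b ≠ d := hf.ne_of_mixed H hs (by simp [*]) (by simp [va, vb, Ne.symm ab]) hn'
    (by rwa [← sab]) hM.swap hM'
  have bg : b ≠ g := hf.ne_of_mixed H hs (by simp [*]) (by simp [va, vb, Ne.symm ab])
    (by simp [vd, vg, Ne.symm dg]) (by rwa [← sab, ← sdg]) hM.swap hM'.swap
  have hT : ({v, a, b, d, g} : Finset ι) ⊆ S := by
    intro x hx
    simp only [Finset.mem_insert, Finset.mem_singleton] at hx
    rcases hx with rfl | rfl | rfl | rfl | rfl <;> assumption
  have hT5 : ({v, a, b, d, g} : Finset ι).card = 5 := by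
    simp [Finset.card_insert_of_notMem, *]
  obtain ⟨e, he⟩ := Finset.card_eq_one.1 (by
    rw [Finset.card_sdiff_of_subset hT, hcard, hT5] : (S \ {v, a, b, d, g}).card = 1)
  have heS : e ∈ S \ {v, a, b, d, g} := by simp [he]
  simp only [Finset.mem_sdiff, Finset.mem_insert, Finset.mem_singleton, not_or] at heS
  obtain ⟨heS, ev, ea, eb, ed, eg⟩ := heS
  have mem : ∀ x ∈ S, x ≠ e → x = v ∨ x = a ∨ x = b ∨ x = d ∨ x = g := by
    intro x hx hxe
    by_contra h
    have : x ∈ S \ {v, a, b, d, g} := by simpa [hx] using h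
    rw [he] at this
    exact hxe (by simpa using this)
  have n₁ : [v, a, b, e].Nodup := by simp [*, Ne.symm ev, Ne.symm ea, Ne.symm eb]
  have n₂ : [v, d, g, e].Nodup := by simp [*, Ne.symm ev, Ne.symm ed, Ne.symm eg]
  -- An exceptional triangle at e shares no edge with v, a, b or v, d, g, so it takes one direction
  -- from a, b and one from d, g.
  have split : ∀ u ≠ 0, ∃ x y, x ∈ S ∧ y ∈ S ∧ [e, x, y].Nodup ∧ (x = a ∨ x = b) ∧
      (y = d ∨ y = g) ∧ tri s e x y = u ∧ Mixed f p c e x y := by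
    intro u hu
    obtain ⟨x, hx, y, hy, hn, ht, hm⟩ := hf.exists_mixed H hs hcard heS hu
    have hxy := hn
    simp only [List.nodup_cons, List.mem_cons, not_or, List.not_mem_nil, or_false] at hxy
    have q₁ := fun hx hy => hf.not_mixed_of_mem H hs (x := x) (y := y)
      (by simp [hv, ha, hb, heS]) n₁ hM hxy.2.1 hx hy hm
    have q₂ := fun hx hy => hf.not_mixed_of_mem H hs (x := x) (y := y)
      (by simp [hv, hd, hg, heS]) n₂ hM' hxy.2.1 hx hy hm
    have m₁ := mem x hx (Ne.symm hxy.1.1)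
    have m₂ := mem y hy (Ne.symm hxy.1.2)
    have : ((x = a ∨ x = b) ∧ (y = d ∨ y = g)) ∨ ((y = a ∨ y = b) ∧ (x = d ∨ x = g)) := by
      clear * - q₁ q₂ m₁ m₂
      tauto
    rcases this with ⟨h₁, h₂⟩ | ⟨h₁, h₂⟩
    · exact ⟨x, y, hx, hy, hn, h₁, h₂, ht, hm⟩
    · exact ⟨y, x, hy, hx, by simp [hxy.1.1, hxy.1.2, Ne.symm hxy.2.1], h₁, h₂,
        by rw [tri_swap hs hy hx (Ne.symm hxy.2.1)]; exact ht, hm.swap⟩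
  obtain ⟨p₁, p₂⟩ := hf.tri_parity H hs (v := v) (a := a) (b := b) (d := d) (g := g) (e := e)
    (by simp [hv, ha, hb, hd, hg, heS])
    (by simp [va, vb, vd, vg, Ne.symm ev, ab, ad, ag, Ne.symm ea, bd, bg, Ne.symm eb, dg,
      Ne.symm ed, Ne.symm eg]) hab hdg
  obtain ⟨x, y, xS, yS, m₁, hx, hy, ht, hm⟩ := split 1 (by decide)
  obtain ⟨z, w, zS, wS, m₂, hz, hw, ht', hm'⟩ := split 2 (by decide)
  have k₁ := m₁
  have k₂ := m₂
  simp only [List.nodup_cons, List.mem_cons, not_or, List.not_mem_nil, or_false] at k₁ k₂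
  have ne' : tri s e x y ≠ tri s e z w := by rw [ht, ht']; decide
  have xz : x ≠ z := hf.ne_of_mixed H hs (by simp [heS, xS, yS, zS, wS]) m₁ m₂ ne' hm hm'
  have yw : y ≠ w := hf.ne_of_mixed H hs (by simp [heS, xS, yS, zS, wS])
    (by simp [k₁.1.1, k₁.1.2, Ne.symm k₁.2.1]) (by simp [k₂.1.1, k₂.1.2, Ne.symm k₂.2.1])
    (by rwa [← tri_swap hs xS yS k₁.2.1, ← tri_swap hs zS wS k₂.2.1]) hm.swap hm'.swap
  clear hM hM' hm hm' split mem
  -- The two triangles at e have opposite signs and meet only in e, so their other directions form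
  -- complementary pairs; by parity complementary pairs have equal signs.
  rcases hx with hx | hx <;> rcases hy with hy | hy <;> rcases hz with hz | hz <;>
    rcases hw with hw | hw <;> rw [hx, hy, hz, hw] at ne' <;>
    first
    | exact xz (hx.trans hz.symm)
    | exact yw (hy.trans hw.symm)
    | exact ne' p₁
    | exact ne' p₂
    | exact ne' p₁.symm
    | exact ne' p₂.symm

end Clique

/-- A leading pair inside the set would leave three further members, against
`Valid.not_three_of_pair`. -/
theorem Valid.adj_of_five_le [Fintype ι] (hf : Valid f) (H : Hub f p Set.univ c)
    (h5 : 5 ≤ (altSet f p c).card) (hi : i ∈ altSet f p c) (hj : j ∈ altSet f p c) (hij : i ≠ j) :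
    Adj f p c i j := by
  have main : ∀ k l, k ∈ altSet f p c → l ∈ altSet f p c → ¬ Leads f p c k l := by
    intro k l hk hl hlead
    have h3 : 2 < ((altSet f p c \ {k, l})).card := by
      have := Finset.le_card_sdiff {k, l} (altSet f p c)
      have := Finset.card_le_two (a := k) (b := l)
      omega
    obtain ⟨a, b, d, ha, hb, hd, hab, had, hbd⟩ := Finset.two_lt_card_iff.1 h3
    simp only [Finset.mem_sdiff, Finset.mem_insert, Finset.mem_singleton, not_or,
      mem_altSet] at ha hb hd
    refine hf.not_three_of_pair H (k := k) (l := l) (i₁ := a) (i₂ := b) (i₃ := d) ?_ hlead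
      (mem_altSet.1 hl) ha.1 hb.1 hd.1
    have := hlead.1
    simp [*, Ne.symm ha.2.1, Ne.symm ha.2.2, Ne.symm hb.2.1, Ne.symm hb.2.2, Ne.symm hd.2.1,
      Ne.symm hd.2.2]
  rcases hf.adj_or_leads H (Set.mem_univ i) (Set.mem_univ j) hij with h | h | h
  exacts [h, (main i j hi hj h).elim, (main j i hj hi h).elim]

theorem Valid.card_altSet_le [Fintype ι] (hf : Valid f) (H : Hub f p Set.univ c) :
    (altSet f p c).card ≤ 5 := by
  by_contra! hlt
  obtain ⟨S, hS, hcard⟩ := Finset.exists_subset_card_eq (n := 6) hlt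
  have : ∀ i j, ∃ s, i ∈ S → j ∈ S → i ≠ j → Alt f p c i j s := by
    intro i j
    by_cases h : i ∈ S ∧ j ∈ S ∧ i ≠ j
    · exact (hf.adj_of_five_le H hlt.le (hS h.1) (hS h.2.1) h.2.2).2.imp fun s hs _ _ _ => hs
    · exact ⟨0, fun h₁ h₂ h₃ => absurd ⟨h₁, h₂, h₃⟩ h⟩
  choose s hs using this
  exact hf.card_ne_six H (S := S) (s := s) (fun i hi j hj => hs i j hi hj) hcard

end HammingThree

/-! ### Two families of parallel hubs. -/

namespace HammingThree

variable {ι : Type*} [DecidableEq ι]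

variable {f : (ι → ZMod 3) → ZMod 3 → Prop} {p q : ι → ZMod 3} {c d s t a b e g θ : ZMod 3}
  {V V' : Set ι} {i j k l m : ι}

theorem Valid.not_four (hf : Valid f) (H : Hub f p V c) (hn : [i, k, m, j].Nodup)
    (hV : ∀ x ∈ [i, k, m, j], x ∈ V) {s₁ s₂ s₃ : ZMod 3} (ha : a ≠ 0) (hb : b ≠ 0) (he : e ≠ 0)
    (ht : t ≠ 0) (h₁ : Alt f p c i k s₁) (h₂ : Alt f p c i m s₂) (h₃ : Alt f p c k m s₃)
    (h₄ : Alt f p c i j (t * a)) (h₅ : Alt f p c k j (t * b)) (h₆ : Alt f p c m j (t * e))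
    (g₁ : ∀ w, f (p + Pi.single j w + Pi.single i a + Pi.single k b) (c + t * w + s₁ * a * b))
    (g₂ : ∀ w, f (p + Pi.single j w + Pi.single i a + Pi.single m e) (c + t * w + s₂ * a * e))
    (g₃ : ∀ w, f (p + Pi.single j w + Pi.single k b + Pi.single m e) (c + t * w + s₃ * b * e))
    (g₄ : ∀ w, f (p + Pi.single j w + Pi.single i a + Pi.single k b + Pi.single m e) (c + t * w)) :
    False := by
  obtain ⟨x, hx, ex⟩ := exists_sign (mul_ne_zero ht (mul_ne_zero (mul_ne_zero h₁.1 ha) hb))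
  obtain ⟨y, hy, ey⟩ := exists_sign (mul_ne_zero ht (mul_ne_zero (mul_ne_zero h₂.1 ha) he))
  obtain ⟨z, hz, ez⟩ := exists_sign (mul_ne_zero ht (mul_ne_zero (mul_ne_zero h₃.1 hb) he))
  have h0 : ∀ x ∈ [(i, a), (k, b), (m, e), (j, 1)], x.2 ≠ 0 := by simp [*]
  have tt := mul_self_of_ne_zero ht
  have aa := mul_self_of_ne_zero ha
  have bb := mul_self_of_ne_zero hb
  have ee := mul_self_of_ne_zero he
  have ex' : t * (x : ZMod 3) = s₁ * a * b := by rw [ex]; linear_combination (s₁ * a * b) * tt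
  have ey' : t * (y : ZMod 3) = s₂ * a * e := by rw [ey]; linear_combination (s₂ * a * e) * tt
  have ez' : t * (z : ZMod 3) = s₃ * b * e := by rw [ez]; linear_combination (s₃ * b * e) * tt
  have one : ∀ w : ZMod 3, w * (1 : ℕ) = w := by simp
  have sl : ∀ n : ℕ, ∀ w ∈ sliceWords 3 n [word 5 x [(0, 1), (1, 1)], word 5 y [(0, 1), (2, 1)],
        word 5 z [(1, 1), (2, 1)], word 5 0 [(0, 1), (1, 1), (2, 1)]],
        pull f p [(i, a), (k, b), (m, e), (j, 1)] c t w := by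
    intro n
    refine pull_sliceWords (js := [(i, a), (k, b), (m, e), (j, 1)]) rfl ?_ ?_
    · simp [word]
    simp only [List.forall_mem_cons, List.not_mem_nil, false_imp_iff, implies_true, and_true]
    refine ⟨(pull_word_two (js := [(i, a), (k, b), (m, e), (j, 1)]) rfl rfl (by decide)).2 ?_,
      (pull_word_two (js := [(i, a), (k, b), (m, e), (j, 1)]) rfl rfl (by decide)).2 ?_,
      (pull_word_two (js := [(i, a), (k, b), (m, e), (j, 1)]) rfl rfl (by decide)).2 ?_,
      (pull_word_three (js := [(i, a), (k, b), (m, e), (j, 1)]) rfl rfl rfl (by decide)).2 ?_⟩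
    · rw [one, one, one_mul, ex']; exact g₁ _
    · rw [one, one, one_mul, ey']; exact g₂ _
    · rw [one, one, one_mul, ez']; exact g₃ _
    · rw [one, one, one, one_mul, Nat.cast_zero, mul_zero, add_zero]; exact g₄ _
  refine hf.refuted (refute_four x hx y hy z hz) p [(i, a), (k, b), (m, e), (j, 1)] rfl hn h0 c t
    ht ?_
  simp only [List.forall_mem_append]
  refine ⟨⟨⟨⟨⟨⟨⟨⟨⟨H.pull h0 _ (by simpa using hV), h₁.pull h0 rfl rfl (by decide) ex'⟩,
    h₂.pull h0 rfl rfl (by decide) ey'⟩, h₃.pull h0 rfl rfl (by decide) ez'⟩,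
    h₄.pull h0 rfl rfl (by decide) ?_⟩, h₅.pull h0 rfl rfl (by decide) ?_⟩,
    h₆.pull h0 rfl rfl (by decide) ?_⟩, sl 1⟩, sl 2⟩, ?_⟩
  · rw [one]; linear_combination (-t) * aa
  · rw [one]; linear_combination (-t) * bb
  · rw [one]; linear_combination (-t) * ee
  · simp only [List.forall_mem_cons, List.not_mem_nil, false_imp_iff, implies_true, and_true]
    refine (pull_word_three (js := [(i, a), (k, b), (m, e), (j, 1)]) rfl rfl rfl (by decide)).2 ?_
    have := g₄ 0
    rw [Pi.single_zero, add_zero, mul_zero, add_zero] at this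
    rw [one, one, one, Nat.cast_zero, mul_zero, add_zero]
    exact this

section Cross

variable (hs : s ≠ 0) (ht : t ≠ 0) (hp : ∀ w, Hub f (p + Pi.single l w) V (c + s * w))
  (hq : ∀ w, Hub f (q + Pi.single j w) V' (d + t * w))

-- In the `cross` lemmas p varies along l and q along j, with colours moving at rates s and t; the
-- cases follow the number of coordinates where p and q differ. Here p + e_j + w e_l has colour c +
-- s w by the first family, but for w ≠ 0 a colour independent of w by the second.
include hs hp hq in
theorem cross_zero (hpq : q = p) (hj : j ∈ V) (hl : l ∈ V') : False := by
  subst hpq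
  have h1 : (1 : ZMod 3) ≠ 0 := by decide
  have h2 : (2 : ZMod 3) ≠ 0 := by decide
  have e₁ := (hp 1 j hj 1 h1).eq (by rw [add_right_comm]; exact hq 1 l hl 1 h1)
  have e₂ := (hp 2 j hj 1 h1).eq (by rw [add_right_comm]; exact hq 1 l hl 2 h2)
  apply hs
  linear_combination e₂ - e₁

-- For w ≠ 0 the point q + w e_l has colour d, yet it lies next to the hub p + w e_l of colour c + s
-- w.
include hs hp hq in
theorem cross_one (ha : a ≠ 0) (hpq : q = p + Pi.single i a) (hi : i ∈ V) (hl : l ∈ V') :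
    False := by
  subst hpq
  have h1 : (1 : ZMod 3) ≠ 0 := by decide
  have h2 : (2 : ZMod 3) ≠ 0 := by decide
  have h := hq 0
  rw [Pi.single_zero, add_zero] at h
  have e₁ := (hp 1 i hi a ha).eq (by rw [add_right_comm]; exact h l hl 1 h1)
  have e₂ := (hp 2 i hi a ha).eq (by rw [add_right_comm]; exact h l hl 2 h2)
  apply hs
  linear_combination e₂ - e₁

theorem Hub.of_single_zero (hp : ∀ w, Hub f (p + Pi.single l w) V (c + s * w)) : Hub f p V c := by
  simpa using hp 0

/-- The point p + b e_k = q - a e_i neighbours both hubs, so c = d. Then q + a e_i has colour c,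
which the hub p forbids over i, k. -/
theorem Valid.cross_two (hf : Valid f) (Hp : Hub f p V c) (Hq : Hub f q V' d) (ha : a ≠ 0)
    (hb : b ≠ 0) (hpq : q = p + Pi.single i a + Pi.single k b) (hik : i ≠ k) (hi : i ∈ V)
    (hk : k ∈ V) (hi' : i ∈ V') : False := by
  have haa : a + a ≠ 0 := (by decide : ∀ a : ZMod 3, a ≠ 0 → a + a ≠ 0) a ha
  have h₁ := Hp k hk b hb
  have h₂ := Hq i hi' (-a) (neg_ne_zero.2 ha)
  have h₃ := Hq i hi' a ha
  have e₁ : q + Pi.single i (-a) = p + Pi.single k b := by rw [hpq, Pi.single_neg]; abel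
  have e₂ : q + Pi.single i a = p + Pi.single i (a + a) + Pi.single k b := by
    rw [hpq, Pi.single_add]; abel
  rw [e₁] at h₂
  rw [e₂] at h₃
  obtain ⟨g, hg, h⟩ := hf.exists_only_of_hub Hp hi hk hik haa hb
  have := h.eq h₃
  rw [h₂.eq h₁] at this
  exact hg (by simpa using this)

/-- The colours of the points over `a eᵢ + b eₖ + e eₘ + w eⱼ` with two non-zero coordinates. -/
theorem Valid.cross_three (hf : Valid f) (ht : t ≠ 0) (Hp : Hub f p V c)
    (hq : ∀ w, Hub f (q + Pi.single j w) V' (d + t * w)) (ha : a ≠ 0) (hb : b ≠ 0) (he : e ≠ 0)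
    (hpq : q = p + Pi.single i a + Pi.single k b + Pi.single m e) (hn : [i, k, m].Nodup)
    (hV : ∀ x ∈ [i, k, m], x ∈ V) (hV' : ∀ x ∈ [i, k, m], x ∈ V') (hjV : j ∈ V)
    (hj : j ∉ V') : d - c ≠ 0 ∧
    Only f (p + Pi.single i a + Pi.single k b) (c + (d - c)) ∧
    Only f (p + Pi.single i a + Pi.single j (t * (d - c))) (c + (d - c)) := by
  have hi' := hV' i (by simp)
  have hk' := hV' k (by simp)
  have hm' := hV' m (by simp)
  have hi := hV i (by simp)
  have hk := hV k (by simp)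
  simp only [List.nodup_cons, List.mem_cons, not_or, List.not_mem_nil, or_false] at hn
  have h₁ := (Hub.of_single_zero hq) m hm' (-e) (neg_ne_zero.2 he)
  have e₁ : q + Pi.single m (-e) = p + Pi.single i a + Pi.single k b := by
    rw [hpq, Pi.single_neg]; abel
  rw [e₁] at h₁
  obtain ⟨g, hg, h⟩ := hf.exists_only_of_hub Hp hi hk hn.1.1 ha hb
  have hgd := h.eq h₁
  have hθ : d - c ≠ 0 := by
    rw [← hgd, add_sub_cancel_left]; exact hg
  refine ⟨hθ, by rwa [add_sub_cancel], ?_⟩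
  -- The multiple t (d - c) of e_j moves the hub q to colour c + 2 (d - c). The point below avoids
  -- both this colour and c, so it shows d.
  have hε := mul_ne_zero ht hθ
  have hij : i ≠ j := by rintro rfl; exact hj hi'
  obtain ⟨g₁, hg₁, h₂⟩ := hf.exists_only_of_hub Hp hi hjV hij ha hε
  obtain ⟨g₂, hg₂, h₃⟩ := hf.exists_only_of_hub (hq (t * (d - c))) hk' hm' hn.2.1
    (neg_ne_zero.2 hb) (neg_ne_zero.2 he)
  have e₂ : q + Pi.single j (t * (d - c)) + Pi.single k (-b) + Pi.single m (-e) =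
      p + Pi.single i a + Pi.single j (t * (d - c)) := by
    rw [hpq, Pi.single_neg, Pi.single_neg]; abel
  rw [e₂] at h₃
  have key := h₂.eq h₃
  have tt := mul_self_of_ne_zero ht
  have : ∀ θ g₁ g₂ : ZMod 3, θ ≠ 0 → g₁ ≠ 0 → g₂ ≠ 0 → g₁ = θ + θ + g₂ → g₁ = θ := by decide
  rwa [this (d - c) g₁ g₂ hθ hg₁ hg₂ (by linear_combination key + (d - c) * tt)] at h₂

/-- No four directions of a hub all of whose pairs show the same colour, unless two pairs of
directions do not alternate. -/
theorem Valid.not_hom {x : ι → ZMod 3} {c' : ZMod 3} (hf : Valid f) (H : Hub f p V c)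
    {S : Set ι} (hSV : S ⊆ V)
    (Hx : Hub f x Set.univ c') (hS : ∀ i ∈ S, ∃ j, Adj f x c' i j)
    (hadj : ∀ i ∈ S, ∀ j ∈ S, Adj f x c' i j → Adj f p c i j)
    (hlead : ∀ i ∈ S, ∀ j ∈ S, Leads f x c' i j → Leads f p c i j) (hn : [i, j, k, l].Nodup)
    (hL : ∀ x ∈ [i, j, k, l], x ∈ S) {σ : ι → ZMod 3} (hθ : θ ≠ 0)
    (hσ : ∀ x ∈ [i, j, k, l], σ x ≠ 0) (hval : ∀ x ∈ [i, j, k, l], ∀ y ∈ [i, j, k, l], x ≠ y →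
      Only f (p + Pi.single x (σ x) + Pi.single y (σ y)) (c + θ)) : False := by
  have sign : ∀ {x y s}, x ∈ [i, j, k, l] → y ∈ [i, j, k, l] → x ≠ y → Alt f p c x y s →
      s * σ x * σ y = θ := by
    intro x y s hx hy hxy h
    simpa using (h.2 _ _ (hσ x hx) (hσ y hy)).eq (hval x hx y hy hxy)
  -- If one pair leads, `Valid.adj_pair` and `Valid.adj_of_pair` make the other five alternate, and
  -- `Valid.not_alt_hom_of_dom` applies. So all six pairs alternate.
  have core : ∀ i' j' k' l', [i', j', k', l'].Nodup → (∀ x ∈ [i', j', k', l'], x ∈ [i, j, k, l]) →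
      ¬ Leads f x c' i' j' := by
    intro i' j' k' l' hn' hsub hl
    have hi := hsub i' (by simp)
    have hj := hsub j' (by simp)
    have hk := hsub k' (by simp)
    have hl' := hsub l' (by simp)
    have hn₁ := hn'
    simp only [List.nodup_cons, List.mem_cons, not_or, List.not_mem_nil, or_false] at hn₁
    obtain ⟨⟨n₁, n₂, n₃⟩, ⟨n₄, n₅⟩, n₆, -⟩ := hn₁
    have S' := fun x hx => hS x (hL x hx)
    obtain ⟨a₁, a₂⟩ := hf.adj_pair Hx hl (S' _ hj) (S' _ hk) (Ne.symm n₂) (Ne.symm n₄)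
    obtain ⟨a₃, a₄⟩ := hf.adj_pair Hx hl (S' _ hj) (S' _ hl') (Ne.symm n₃) (Ne.symm n₅)
    have a₅ := hf.adj_of_pair Hx hl (S' _ hj) (S' _ hl') (S' _ hk) (Ne.symm n₃) (Ne.symm n₅)
      (Ne.symm n₂) (Ne.symm n₄) n₆
    obtain ⟨-, _, b₁⟩ := (hadj _ (hL _ hk) _ (hL _ hi) a₁).symm
    obtain ⟨-, _, b₂⟩ := (hadj _ (hL _ hk) _ (hL _ hj) a₂).symm
    obtain ⟨-, _, b₃⟩ := (hadj _ (hL _ hl') _ (hL _ hi) a₃).symm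
    obtain ⟨-, _, b₄⟩ := (hadj _ (hL _ hl') _ (hL _ hj) a₄).symm
    obtain ⟨-, _, b₅⟩ := hadj _ (hL _ hk) _ (hL _ hl') a₅
    obtain ⟨-, _, b₆⟩ := hlead _ (hL _ hi) _ (hL _ hj) hl
    exact hf.not_alt_hom_of_dom H hn' (fun x hx => hSV (hL x (hsub x hx))) (σ₁ := σ i')
      (σ₂ := σ j') (σ₃ := σ k') (σ₄ := σ l') hθ (by
        simp only [List.forall_mem_cons, List.not_mem_nil, false_imp_iff, implies_true, and_true]
        exact ⟨hσ _ hi, hσ _ hj, hσ _ hk, hσ _ hl'⟩)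
      b₆ b₁ b₃ b₂ b₄ b₅ (sign hi hk n₂ b₁) (sign hi hl' n₃ b₃) (sign hj hk n₄ b₂)
      (sign hj hl' n₅ b₄) (sign hk hl' n₆ b₅)
  have hn₁ := hn
  simp only [List.nodup_cons, List.mem_cons, not_or, List.not_mem_nil, or_false] at hn₁
  obtain ⟨⟨n₁, n₂, n₃⟩, ⟨n₄, n₅⟩, n₆, -⟩ := hn₁
  have A : ∀ x y z w, [x, y, z, w].Nodup → [x, y, z, w] ⊆ [i, j, k, l] → ∃ s, Alt f p c x y s := by
    intro x' y' z w hn' hsub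
    have hx := hL _ (hsub (by simp : x' ∈ [x', y', z, w]))
    have hy := hL _ (hsub (by simp : y' ∈ [x', y', z, w]))
    have hn₂ := hn'
    simp only [List.nodup_cons, List.mem_cons, not_or, List.not_mem_nil, or_false] at hn₂
    obtain ⟨⟨n₁, n₂, n₃⟩, ⟨n₄, n₅⟩, n₆, -⟩ := hn₂
    rcases hf.adj_or_leads Hx (Set.mem_univ x') (Set.mem_univ y') n₁ with h | h | h
    · exact (hadj _ hx _ hy h).2
    · exact (core x' y' z w hn' (fun _ h => hsub h) h).elim
    · refine (core y' x' z w (by simp [*, Ne.symm n₁]) (fun u hu => hsub ?_) h).elim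
      simp only [List.mem_cons] at hu ⊢
      tauto
  obtain ⟨_, b₁⟩ := A i j k l hn (fun _ h => h)
  obtain ⟨_, b₂⟩ := A i k j l (by simp [*, Ne.symm n₄]) (by simp)
  obtain ⟨_, b₃⟩ := A i l j k (by simp [*, Ne.symm n₅, Ne.symm n₆]) (by simp)
  obtain ⟨_, b₄⟩ := A j k i l (by simp [*, Ne.symm n₁, Ne.symm n₂]) (by simp)
  obtain ⟨_, b₅⟩ := A j l i k (by simp [*, Ne.symm n₁, Ne.symm n₃, Ne.symm n₆]) (by simp)
  obtain ⟨_, b₆⟩ := A k l i j (by simp [*, Ne.symm n₂, Ne.symm n₃, Ne.symm n₄, Ne.symm n₅])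
    (by simp)
  exact hf.not_alt_hom H hn (fun x hx => hSV (hL x hx)) hθ (σ₁ := σ i) (σ₂ := σ j) (σ₃ := σ k)
    (σ₄ := σ l) (by simpa using hσ) b₁ b₂ b₃ b₄ b₅ b₆ (sign (by simp) (by simp) n₁ b₁)
    (sign (by simp) (by simp) n₂ b₂) (sign (by simp) (by simp) n₃ b₃)
    (sign (by simp) (by simp) n₄ b₄) (sign (by simp) (by simp) n₅ b₅)
    (sign (by simp) (by simp) n₆ b₆)

end Cross

end HammingThree

/-! ### Comparability of the alternating sets of two doubles. -/

namespace HammingThree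

variable {ι : Type*} [DecidableEq ι]

variable {f : (ι → ZMod 3) → ZMod 3 → Prop} {p q x y : ι → ZMod 3} {c d s t a b e g : ZMod 3}
  {V V' : Set ι} {i j k l m n : ι}

/-- If s a = -t, then p + a e_i + t μ e_j has colour c + t (t μ) + μ for every μ ≠ 0. Its neighbours
in the directions k, m, n have this colour when μ is the corresponding offset; of three non-zero
offsets two agree, giving two neighbours of one colour. -/
theorem Valid.cross_sign (hf : Valid f) (ht : t ≠ 0) (ha : a ≠ 0) (hb : b ≠ 0) (he : e ≠ 0)
    (hg : g ≠ 0)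
    (hpq : q = p + Pi.single i a + Pi.single k b + Pi.single m e + Pi.single n g)
    (hn : [k, m, n].Nodup) {s₁ s₂ s₃ : ZMod 3}
    (h₁ : ∀ w, Alt f (q + Pi.single j w) (c + t * w) k m s₁)
    (h₂ : ∀ w, Alt f (q + Pi.single j w) (c + t * w) k n s₂)
    (h₃ : ∀ w, Alt f (q + Pi.single j w) (c + t * w) m n s₃) (h : Alt f p c i j s) :
    s * a = t := by
  by_contra hne
  simp only [List.nodup_cons, List.mem_cons, not_or, List.not_mem_nil, or_false] at hn
  have hsa : s * a = -t := by
    have : ∀ x t : ZMod 3, x ≠ 0 → t ≠ 0 → x ≠ t → x = -t := by decide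
    exact this _ _ (mul_ne_zero h.1 ha) ht hne
  have hb' := neg_ne_zero.2 hb
  have he' := neg_ne_zero.2 he
  have hg' := neg_ne_zero.2 hg
  have tt := mul_self_of_ne_zero ht
  have key : ∀ μ : ZMod 3, μ ≠ 0 →
      f (p + Pi.single i a + Pi.single j (t * μ)) (c + t * (t * μ) + μ) := by
    intro μ hμ
    have := (h.2 a (t * μ) ha (mul_ne_zero ht hμ)).self
    convert this using 1
    have h3 : (3 : ZMod 3) = 0 := by decide
    linear_combination (- t * μ) * hsa + 2 * μ * tt + μ * h3
  have f₁ : ∀ w,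
      f (p + Pi.single i a + Pi.single j w + Pi.single n g) (c + t * w + s₁ * b * e) := by
    intro w
    convert ((h₁ w).2 (-b) (-e) hb' he').self using 1
    · rw [hpq, Pi.single_neg, Pi.single_neg]; abel
    · ring
  have f₂ : ∀ w,
      f (p + Pi.single i a + Pi.single j w + Pi.single m e) (c + t * w + s₂ * b * g) := by
    intro w
    convert ((h₂ w).2 (-b) (-g) hb' hg').self using 1
    · rw [hpq, Pi.single_neg, Pi.single_neg]; abel
    · ring
  have f₃ : ∀ w,
      f (p + Pi.single i a + Pi.single j w + Pi.single k b) (c + t * w + s₃ * e * g) := by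
    intro w
    convert ((h₃ w).2 (-e) (-g) he' hg').self using 1
    · rw [hpq, Pi.single_neg, Pi.single_neg]; abel
    · ring
  have n₁ := mul_ne_zero (mul_ne_zero (h₁ 0).1 hb) he
  have n₂ := mul_ne_zero (mul_ne_zero (h₂ 0).1 hb) hg
  have n₃ := mul_ne_zero (mul_ne_zero (h₃ 0).1 he) hg
  have pig : ∀ x y z : ZMod 3, x ≠ 0 → y ≠ 0 → z ≠ 0 → x = y ∨ x = z ∨ y = z := by decide
  rcases pig _ _ _ n₁ n₂ n₃ with h' | h' | h'
  · have r := f₂ (t * (s₁ * b * e))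
    rw [← h'] at r
    exact hn.2.1 (hf.eq_of_adj (key _ n₁) r (f₁ _) he hg).1
  · have r := f₃ (t * (s₁ * b * e))
    rw [← h'] at r
    exact hn.1.2 (hf.eq_of_adj (key _ n₁) r (f₁ _) hb hg).1
  · have r := f₃ (t * (s₂ * b * g))
    rw [← h'] at r
    exact hn.1.1 (hf.eq_of_adj (key _ n₂) r (f₂ _) hb he).1

/-- By `Valid.alt_sign_eq` the signs at q + w e_j do not depend on w, and `Valid.cross_sign` fixes
the alternations with j. The faces seen from q then move with w exactly as `Valid.not_four` forbids.
-/
theorem Valid.cross_four (hf : Valid f) (ht : t ≠ 0) (ha : a ≠ 0) (hb : b ≠ 0) (he : e ≠ 0)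
    (hg : g ≠ 0)
    (hpq : q = p + Pi.single i a + Pi.single k b + Pi.single m e + Pi.single n g)
    (hn : [i, k, m, n, j].Nodup) (Hp : Hub f p V c)
    (hq : ∀ w, Hub f (q + Pi.single j w) V' (c + t * w))
    (hV : ∀ x ∈ [i, k, m, n, j], x ∈ V) (hV' : ∀ x ∈ [i, k, m, n], x ∈ V')
    (hA : ∀ x ∈ [i, k, m, n, j], ∀ y ∈ [i, k, m, n, j], x ≠ y → ∃ s, Alt f p c x y s)
    (hA' : ∀ x ∈ [i, k, m, n], ∀ y ∈ [i, k, m, n], x ≠ y →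
      ∀ w, ∃ s, Alt f (q + Pi.single j w) (c + t * w) x y s) : False := by
  simp only [List.nodup_cons, List.mem_cons, not_or, List.not_mem_nil, or_false] at hn
  obtain ⟨⟨n₁, n₂, n₃, n₄⟩, ⟨n₅, n₆, n₇⟩, ⟨n₈, n₉⟩, n₁₀, -⟩ := hn
  have const : ∀ x y z, x ∈ [i, k, m, n] → y ∈ [i, k, m, n] → z ∈ [i, k, m, n] →
      [x, y, z, j].Nodup → ∃ s, ∀ w, Alt f (q + Pi.single j w) (c + t * w) x y s := by
    intro x y z hx hy hz hn'
    have hn := hn'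
    simp only [List.nodup_cons, List.mem_cons, not_or, List.not_mem_nil, or_false] at hn
    choose X hX using hA' x hx y hy hn.1.1
    choose Y hY using hA' x hx z hz hn.1.2.1
    choose Z hZ using hA' y hy z hz hn.2.1.1
    have := hf.alt_sign_eq hn' (by simp [hV' x hx, hV' y hy, hV' z hz]) ht hq hX hY hZ
    exact ⟨X 0, fun w => this w ▸ hX w⟩
  obtain ⟨s₁, c₁⟩ := const i k m (by simp) (by simp) (by simp) (by simp [*])
  obtain ⟨s₂, c₂⟩ := const i m k (by simp) (by simp) (by simp) (by simp [*, Ne.symm n₅])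
  obtain ⟨s₃, c₃⟩ := const i n m (by simp) (by simp) (by simp) (by simp [*, Ne.symm n₈])
  obtain ⟨s₄, c₄⟩ := const k m i (by simp) (by simp) (by simp)
    (by simp [*, Ne.symm n₁, Ne.symm n₂])
  obtain ⟨s₅, c₅⟩ := const k n m (by simp) (by simp) (by simp) (by simp [*, Ne.symm n₈])
  obtain ⟨s₆, c₆⟩ := const m n i (by simp) (by simp) (by simp)
    (by simp [*, Ne.symm n₂, Ne.symm n₃])
  obtain ⟨r₁, a₁⟩ := hA i (by simp) j (by simp) n₄
  obtain ⟨r₂, a₂⟩ := hA k (by simp) j (by simp) n₇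
  obtain ⟨r₃, a₃⟩ := hA m (by simp) j (by simp) n₉
  have e₁ := hf.cross_sign ht ha hb he hg hpq (by simp [*]) c₄ c₅ c₆ a₁
  have e₂ := hf.cross_sign ht hb ha he hg (by rw [hpq]; abel) (by simp [*]) c₂ c₃ c₆ a₂
  have e₃ := hf.cross_sign ht he ha hb hg (by rw [hpq]; abel) (by simp [*]) c₁ c₃ c₅ a₃
  have aa := mul_self_of_ne_zero ha
  have bb := mul_self_of_ne_zero hb
  have ee := mul_self_of_ne_zero he
  have a₁' : r₁ = t * a := by linear_combination a * e₁ - r₁ * aa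
  have a₂' : r₂ = t * b := by linear_combination b * e₂ - r₂ * bb
  have a₃' : r₃ = t * e := by linear_combination e * e₃ - r₃ * ee
  subst a₁' a₂' a₃'
  obtain ⟨u₁, b₁⟩ := hA i (by simp) k (by simp) n₁
  obtain ⟨u₂, b₂⟩ := hA i (by simp) m (by simp) n₂
  obtain ⟨u₃, b₃⟩ := hA k (by simp) m (by simp) n₅
  have face : ∀ {x y z v : ι} {a b e g s s' : ZMod 3}, a ≠ 0 → b ≠ 0 → e ≠ 0 → g ≠ 0 →
      q = p + Pi.single x a + Pi.single y b + Pi.single z e + Pi.single v g → Alt f p c x y s →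
      (∀ w, Alt f (q + Pi.single j w) (c + t * w) z v s') →
      ∀ w, f (p + Pi.single j w + Pi.single x a + Pi.single y b) (c + t * w + s * a * b) := by
    intro x y z v a b e g s s' ha hb he hg hpq h h' w
    have key : ∀ w, f (p + Pi.single j w + Pi.single x a + Pi.single y b)
        (c + t * w + s' * e * g) := by
      intro w
      convert ((h' w).2 (-e) (-g) (neg_ne_zero.2 he) (neg_ne_zero.2 hg)).self using 1
      · rw [hpq, Pi.single_neg, Pi.single_neg]; abel
      · ring
    have h0 := key 0
    rw [Pi.single_zero, add_zero, mul_zero, add_zero, h.2 a b ha hb, add_right_inj] at h0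
    rw [← h0]
    exact key w
  refine hf.not_four Hp (by simp [*]) (fun x hx => hV x (by simp at hx ⊢; tauto)) ha hb he ht b₁ b₂
    b₃ a₁ a₂ a₃ (face ha hb he hg hpq b₁ c₆) (face ha he hb hg (by rw [hpq]; abel) b₂ c₅)
    (face hb he ha hg (by rw [hpq]; abel) b₃ c₃) fun w => ?_
  convert (hq w n (hV' n (by simp)) (-g) (neg_ne_zero.2 hg)).self using 1
  rw [hpq, Pi.single_neg]; abel

section Fintype

variable [Fintype ι]

theorem eq_sum_single (r : ι → ZMod 3) : r = ∑ i ∈ supp r, Pi.single i (r i) := by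
  ext l
  rw [Finset.sum_apply]
  by_cases hl : l ∈ supp r
  · rw [Finset.sum_eq_single_of_mem l hl fun i _ hi => Pi.single_eq_of_ne hi.symm _,
      Pi.single_eq_same]
  · rw [Finset.sum_eq_zero fun i hi => Pi.single_eq_of_ne (by rintro rfl; exact hl hi) _]
    simpa [mem_supp] using hl

set_option maxHeartbeats 800000 in
/-- The sets of alternating directions of two doubles are comparable. -/
theorem Valid.altSet_subset_or_subset (hf : Valid f) (hx : Double f x c) (hy : Double f y d) :
    altSet f x c ⊆ altSet f y d ∨ altSet f y d ⊆ altSet f x c := by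
  by_contra! hno
  obtain ⟨⟨j, hjW, hjW'⟩, ⟨l, hlW', hlW⟩⟩ := And.imp Finset.not_subset.1 Finset.not_subset.1 hno
  have Hx := hx.hub hf
  have Hy := hy.hub hf
  obtain ⟨σ, hσ⟩ := hf.exists_signs Hx
  obtain ⟨τ, hτ⟩ := hf.exists_signs Hy
  set W := altSet f x c with hW
  set W' := altSet f y d with hW'
  -- x + r agrees with y off W, and y + r' agrees with x on W \ W', so the moved points differ only
  -- inside W ∩ W'. The moves avoid W and W' respectively, so hubs are kept, also along l and j.
  obtain ⟨r, hr⟩ : ∃ r : ι → ZMod 3, ∀ i, r i = if i ∈ W then 0 else y i - x i :=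
    ⟨fun i => if i ∈ W then 0 else y i - x i, fun i => rfl⟩
  obtain ⟨r', hr'⟩ : ∃ r : ι → ZMod 3, ∀ i, r i = if i ∈ W \ W' then x i - y i else 0 :=
    ⟨fun i => if i ∈ W \ W' then x i - y i else 0, fun i => rfl⟩
  have dr : ∀ w, Disjoint (supp (r + Pi.single l w)) W := by
    intro w
    refine Finset.disjoint_left.2 fun i hi hiW => mem_supp.1 hi ?_
    have : i ≠ l := by rintro rfl; exact hlW hiW
    simp [hr, hiW, this]
  have dr' : ∀ w, Disjoint (supp (r' + Pi.single j w)) W' := by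
    intro w
    refine Finset.disjoint_left.2 fun i hi hiW => mem_supp.1 hi ?_
    have : i ≠ j := by rintro rfl; exact hjW' hiW
    simp [hr', hiW, this]
  have hp : ∀ w, Hub f (x + r + Pi.single l w) W (c + wsum σ r + σ l * w) := by
    intro w
    have := hf.hub_add Hx hσ (dr w)
    rwa [wsum_add, wsum_single, ← add_assoc, ← add_assoc] at this
  have hq : ∀ w, Hub f (y + r' + Pi.single j w) W' (d + wsum τ r' + τ j * w) := by
    intro w
    have := hf.hub_add Hy hτ (dr' w)
    rwa [wsum_add, wsum_single, ← add_assoc, ← add_assoc] at this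
  have hs : σ l ≠ 0 := (hσ l hlW j hjW).1
  have ht : τ j ≠ 0 := (hτ j hjW' l hlW').1
  have hadj : ∀ i ∈ (W : Set ι), ∀ k ∈ (W : Set ι), Adj f x c i k →
      Adj f (x + r) (c + wsum σ r) i k := fun i _ k _ h =>
    hf.alt_add Hx hσ (by simpa using dr 0) h
  have hlead : ∀ i ∈ (W : Set ι), ∀ k ∈ (W : Set ι), Leads f x c i k →
      Leads f (x + r) (c + wsum σ r) i k := by
    rintro i hi k hk ⟨hik, s, h⟩
    refine ⟨hik, s, hf.dom_add Hx hσ _ 0 r (by simp [supp_zero]) (by simpa using dr 0) rfl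
      hi hk hik ?_⟩
    rwa [wsum_zero, add_zero, add_zero]
  have hadj' : ∀ w, ∀ i k, Adj f y d i k →
      Adj f (y + r' + Pi.single j w) (d + wsum τ r' + τ j * w) i k := by
    intro w i k h
    have := hf.alt_add Hy hτ (dr' w) h
    rwa [wsum_add, wsum_single, ← add_assoc, ← add_assoc] at this
  have hSW : ∀ i ∈ (W : Set ι), ∃ k, Adj f x c i k := fun i hi => mem_altSet.1 hi
  set p := x + r with hpdef
  set q := y + r' with hqdef
  set c₁ := c + wsum σ r
  set d₁ := d + wsum τ r'
  have Hp := Hub.of_single_zero hp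
  have Hq := Hub.of_single_zero hq
  set T := supp (q - p) with hTdef
  have hTW : T ⊆ W ∩ W' := by
    intro i hi
    by_contra h
    apply mem_supp.1 hi
    rw [Finset.mem_inter, not_and_or] at h
    by_cases h₁ : i ∈ W <;> by_cases h₂ : i ∈ W' <;> simp_all
  have hT₁ : ∀ i ∈ T, i ∈ W := fun i hi => (Finset.mem_inter.1 (hTW hi)).1
  have hT₂ : ∀ i ∈ T, i ∈ W' := fun i hi => (Finset.mem_inter.1 (hTW hi)).2
  have hTj : T ⊆ W.erase j := fun i hi =>
    Finset.mem_erase.2 ⟨by rintro rfl; exact hjW' (hT₂ _ hi), hT₁ i hi⟩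
  have hTl : T ⊆ W'.erase l := fun i hi =>
    Finset.mem_erase.2 ⟨by rintro rfl; exact hlW (hT₁ _ hi), hT₂ i hi⟩
  have c₁' := Finset.card_le_card hTj
  have c₂' := Finset.card_le_card hTl
  rw [Finset.card_erase_of_mem hjW] at c₁'
  rw [Finset.card_erase_of_mem hlW'] at c₂'
  have hW5 : W.card ≤ 5 := hf.card_altSet_le Hx
  have hsum := eq_sum_single (q - p)
  rw [← hTdef, sub_eq_iff_eq_add'] at hsum
  have hnz : ∀ i ∈ T, (q - p) i ≠ 0 := fun i hi => mem_supp.1 hi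
  have hTne : ∀ i ∈ T, i ≠ j := fun i hi => (Finset.mem_erase.1 (hTj hi)).1
  generalize hδ : q - p = δ at hsum hnz
  -- T lies in W, which has at most five elements, and misses j.
  have hcard : T.card ≤ 4 := by omega
  interval_cases hc : T.card
  · rw [Finset.card_eq_zero.1 hc, Finset.sum_empty, add_zero] at hsum
    exact cross_zero hs hp hq hsum hjW hlW'
  · obtain ⟨i, hi⟩ := Finset.card_eq_one.1 hc
    have hiT : i ∈ T := by simp [hi]
    rw [hi, Finset.sum_singleton] at hsum
    exact cross_one hs hp hq (hnz i hiT) hsum (hT₁ i hiT) hlW'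
  · obtain ⟨i, k, hik, hi⟩ := Finset.card_eq_two.1 hc
    have hiT : i ∈ T := by simp [hi]
    have hkT : k ∈ T := by simp [hi]
    rw [hi, Finset.sum_pair hik, ← add_assoc] at hsum
    exact hf.cross_two Hp Hq (hnz i hiT) (hnz k hkT) hsum hik (hT₁ i hiT) (hT₁ k hkT) (hT₂ i hiT)
  · obtain ⟨i, k, m, hik, him, hkm, hi⟩ := Finset.card_eq_three.1 hc
    have hiT : i ∈ T := by simp [hi]
    have hkT : k ∈ T := by simp [hi]
    have hmT : m ∈ T := by simp [hi]
    have three : ∀ u v w, [u, v, w].Nodup → T = {u, v, w} →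
        d₁ - c₁ ≠ 0 ∧ Only f (p + Pi.single u (δ u) + Pi.single v (δ v)) (c₁ + (d₁ - c₁)) ∧
        Only f (p + Pi.single u (δ u) + Pi.single j (τ j * (d₁ - c₁))) (c₁ + (d₁ - c₁)) := by
      intro u v w hn hT
      have hn' := hn
      simp only [List.nodup_cons, List.mem_cons, not_or, List.not_mem_nil, or_false] at hn'
      have hmem : ∀ x ∈ [u, v, w], x ∈ T := by simp [hT]
      refine hf.cross_three ht Hp hq (hnz u (hmem u (by simp))) (hnz v (hmem v (by simp)))
        (hnz w (hmem w (by simp))) ?_ hn (fun x hx => hT₁ x (hmem x hx))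
        (fun x hx => hT₂ x (hmem x hx)) hjW hjW'
      rw [hsum, hT, Finset.sum_insert (by simp [hn'.1]), Finset.sum_pair hn'.2.1]
      abel
    obtain ⟨hθ, v₁, v₂⟩ := three i k m (by simp [hik, him, hkm]) hi
    obtain ⟨-, v₃, v₄⟩ := three k m i (by simp [hkm, Ne.symm hik, Ne.symm him])
      (by rw [hi]; ext; simp; tauto)
    obtain ⟨-, v₅, v₆⟩ := three m i k (by simp [hik, Ne.symm him, Ne.symm hkm])
      (by rw [hi]; ext; simp; tauto)
    have hij := hTne i hiT
    have hkj := hTne k hkT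
    have hmj := hTne m hmT
    -- j joins i, k, m as fourth direction, with the entry τ j * (d₁ - c₁) at which all six pairs
    -- show the colour d₁.
    refine hf.not_hom Hp (S := W) (fun _ h => h) Hx hSW hadj hlead (i := i) (j := k) (k := m)
      (l := j) (by simp [hik, him, hkm, hij, hkj, hmj])
      (by simp only [List.forall_mem_cons]
          exact ⟨hT₁ i hiT, hT₁ k hkT, hT₁ m hmT, hjW, by simp⟩)
      (σ := Function.update δ j (τ j * (d₁ - c₁))) hθ
      ?_ ?_
    · simp [hij, hkj, hmj, hnz i hiT, hnz k hkT, hnz m hmT, ht, hθ]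
    · intro u hu v hv huv
      simp only [List.mem_cons, List.not_mem_nil, or_false] at hu hv
      rcases hu with rfl | rfl | rfl | rfl <;> rcases hv with rfl | rfl | rfl | rfl <;>
        first | exact absurd rfl huv | skip
      all_goals simp only [Function.update_self, Function.update_of_ne, ne_eq, hij, hkj, hmj,
        not_false_eq_true]
      all_goals first | assumption | (rw [add_right_comm]; assumption)
  · obtain ⟨n, T', hnT', hT', hT'c⟩ := Finset.card_eq_succ.1 hc
    obtain ⟨i, k, m, hik, him, hkm, hi⟩ := Finset.card_eq_three.1 hT'c
    rw [hi] at hT' hnT'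
    simp only [Finset.mem_insert, Finset.mem_singleton, not_or] at hnT'
    obtain ⟨hni, hnk, hnm⟩ := hnT'
    have hmem : ∀ x ∈ [i, k, m, n], x ∈ T := by simp [← hT']
    have hexp : q = p + Pi.single i (δ i) + Pi.single k (δ k) + Pi.single m (δ m) +
        Pi.single n (δ n) := by
      rw [hsum, ← hT', Finset.sum_insert (by simp [hni, hnk, hnm]),
        Finset.sum_insert (by simp [hik, him]), Finset.sum_pair hkm]
      abel
    have hnzT : ∀ x ∈ [i, k, m, n], δ x ≠ 0 := fun x hx => hnz x (hmem x hx)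
    have zi := hnzT i (by simp)
    have zk := hnzT k (by simp)
    have zm := hnzT m (by simp)
    have zn := hnzT n (by simp)
    have h5 : 5 ≤ W.card := by omega
    have h5' : 5 ≤ W'.card := by omega
    have hTW₁ : ∀ x ∈ [i, k, m, n], x ∈ W := fun x hx => hT₁ x (hmem x hx)
    have hTW₂ : ∀ x ∈ [i, k, m, n], x ∈ W' := fun x hx => hT₂ x (hmem x hx)
    have hn : [i, k, m, n].Nodup := by simp [hik, him, hkm, Ne.symm hni, Ne.symm hnk, Ne.symm hnm]
    -- If the hub colours differ, every pair of T shows the third colour, since its point avoids the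
    -- colours of both hubs.
    by_cases hdc : d₁ = c₁
    · rw [hdc] at hq hadj'
      have hWj : ∀ x ∈ [i, k, m, n, j], x ∈ W := by
        simp only [List.forall_mem_cons, List.not_mem_nil, false_imp_iff, implies_true,
          and_true] at hTW₁ ⊢
        tauto
      have hTj' : ∀ x ∈ [i, k, m, n], x ≠ j := fun x hx => hTne x (hmem x hx)
      refine hf.cross_four ht zi zk zm zn hexp ?_ Hp hq hWj hTW₂ ?_ ?_
      · simp only [List.forall_mem_cons, List.not_mem_nil, false_imp_iff, implies_true,
          and_true] at hTj'
        simp [hTj', hik, him, hkm, Ne.symm hni, Ne.symm hnk, Ne.symm hnm]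
      · intro u hu v hv huv
        exact (hadj u (hWj u hu) v (hWj v hv)
          (hf.adj_of_five_le Hx h5 (hWj u hu) (hWj v hv) huv)).2
      · intro u hu v hv huv w
        exact (hadj' w u v (hf.adj_of_five_le Hy h5' (hTW₂ u hu) (hTW₂ v hv) huv)).2
    · have hθ : (d₁ - c₁) + (d₁ - c₁) ≠ 0 := by
        have : ∀ a b : ZMod 3, a ≠ b → (a - b) + (a - b) ≠ 0 := by decide
        exact this _ _ hdc
      have val : ∀ u v w z, [u, v, w, z].Nodup → (∀ x ∈ [u, v, w, z], x ∈ [i, k, m, n]) →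
          q = p + Pi.single u (δ u) + Pi.single v (δ v) + Pi.single w (δ w) + Pi.single z (δ z) →
          Only f (p + Pi.single u (δ u) + Pi.single v (δ v)) (c₁ + (d₁ - c₁ + (d₁ - c₁))) := by
        intro u v w z hn hsub hq'
        have hu := hsub u (by simp)
        have hv := hsub v (by simp)
        have hw := hsub w (by simp)
        have hz := hsub z (by simp)
        simp only [List.nodup_cons, List.mem_cons, not_or, List.not_mem_nil, or_false] at hn
        obtain ⟨g₁, hg₁, o₁⟩ := hf.exists_only_of_hub Hp (hTW₁ u hu) (hTW₁ v hv) hn.1.1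
          (hnzT u hu) (hnzT v hv)
        obtain ⟨g₂, hg₂, o₂⟩ := hf.exists_only_of_hub Hq (hTW₂ w hw) (hTW₂ z hz) hn.2.2.1
          (neg_ne_zero.2 (hnzT w hw)) (neg_ne_zero.2 (hnzT z hz))
        have e : q + Pi.single w (-δ w) + Pi.single z (-δ z) =
            p + Pi.single u (δ u) + Pi.single v (δ v) := by
          rw [hq', Pi.single_neg, Pi.single_neg]; abel
        rw [e] at o₂
        have h := o₁.eq o₂
        have key : ∀ c d g₁ g₂ : ZMod 3, d ≠ c ∧ g₁ ≠ 0 ∧ g₂ ≠ 0 ∧ c + g₁ = d + g₂ →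
            g₁ = d - c + (d - c) := by decide
        rwa [key _ _ _ _ ⟨hdc, hg₁, hg₂, h⟩] at o₁
      have v₁ := val i k m n hn (fun _ h => h) hexp
      have v₂ := val i m k n
        (by simp [hik, him, Ne.symm hkm, Ne.symm hni, Ne.symm hnk, Ne.symm hnm])
        (by simp) (by rw [hexp]; abel)
      have v₃ := val i n k m (by simp [hik, him, hkm, hnk, hnm, Ne.symm hni]) (by simp)
        (by rw [hexp]; abel)
      have v₄ := val k m i n (by simp [hkm, Ne.symm hik, Ne.symm him, Ne.symm hni, Ne.symm hnk,
        Ne.symm hnm]) (by simp) (by rw [hexp]; abel)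
      have v₅ := val k n i m (by simp [him, hkm, hni, hnm, Ne.symm hik, Ne.symm hnk]) (by simp)
        (by rw [hexp]; abel)
      have v₆ := val m n i k
        (by simp [hik, hni, hnk, Ne.symm him, Ne.symm hkm, Ne.symm hnm]) (by simp)
        (by rw [hexp]; abel)
      refine hf.not_hom Hp (S := W) (fun _ h => h) Hx hSW hadj hlead hn hTW₁ (σ := δ) hθ hnzT ?_
      intro u hu v hv huv
      simp only [List.mem_cons, List.not_mem_nil, or_false] at hu hv
      rcases hu with rfl | rfl | rfl | rfl <;> rcases hv with rfl | rfl | rfl | rfl <;>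
        first
        | exact absurd rfl huv
        | assumption
        | (rw [add_right_comm]; assumption)

end Fintype

end HammingThree

/-! ### Counting doubles and returning to `H(n,3)`. -/

namespace HammingThree

variable {ι : Type*} [DecidableEq ι] [Fintype ι]

variable {f : (ι → ZMod 3) → ZMod 3 → Prop}

/-- There are at most `81` lines in the last direction that contain two points of the set. -/
theorem Valid.card_double_le (hf : Valid f) (D : Finset (ι → ZMod 3))
    (hD : ∀ x ∈ D, ∃ c, Double f x c) : D.card ≤ 81 := by
  choose! c hc using hD
  rcases D.eq_empty_or_nonempty with rfl | hne
  · simp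
  obtain ⟨x, hx, hmax⟩ := D.exists_max_image (fun x => (altSet f x (c x)).card) hne
  set W := altSet f x (c x)
  have hsub : ∀ y ∈ D, altSet f y (c y) ⊆ W := by
    intro y hy
    rcases hf.altSet_subset_or_subset (hc x hx) (hc y hy) with h | h
    · exact (Finset.eq_of_subset_of_card_le h (hmax y hy)).symm.subset
    · exact h
  have hW : W.card ≤ 5 := hf.card_altSet_le ((hc x hx).hub hf)
  -- One coordinate of W is forgotten (none if W is empty, by truncated subtraction). Doubles that
  -- agree on T would differ in at most one coordinate of W instead of three.
  obtain ⟨T, hTW, hT4, hT1⟩ : ∃ T ⊆ W, T.card ≤ 4 ∧ (W \ T).card ≤ 1 := by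
    obtain ⟨T, hTW, hT⟩ := Finset.exists_subset_card_eq (Nat.sub_le W.card 1)
    refine ⟨T, hTW, by omega, ?_⟩
    rw [Finset.card_sdiff_of_subset hTW]
    omega
  have hinj : Set.InjOn (fun (y : ι → ZMod 3) (i : T) => y i) D := by
    intro y hy z hz h
    by_contra hyz
    have h3 := hf.three_le_card (hc y hy) (hc z hz) hyz
    have hle : supp (z - y) ∩ altSet f y (c y) ⊆ W \ T := by
      intro i hi
      rw [Finset.mem_inter, mem_supp] at hi
      refine Finset.mem_sdiff.2 ⟨hsub y hy hi.2, fun hiT => hi.1 ?_⟩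
      rw [Pi.sub_apply, sub_eq_zero]
      exact (congrFun h ⟨i, hiT⟩).symm
    have := Finset.card_le_card hle
    omega
  calc D.card ≤ (Finset.univ : Finset (T → ZMod 3)).card :=
        Finset.card_le_card_of_injOn _ (fun _ _ => Finset.mem_coe.2 (Finset.mem_univ _)) hinj
    _ = 3 ^ T.card := by simp [ZMod.card]
    _ ≤ 3 ^ 4 := Nat.pow_le_pow_right (by norm_num) hT4

/-- A set that meets every line in the last direction and induces a subgraph of maximum degree
at most one exceeds the number of lines by at most `81`. -/
theorem Valid.sum_card_le (hf : Valid f) [∀ x, DecidablePred (f x)] :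
    ∑ x, (Finset.univ.filter (f x)).card ≤ 3 ^ Fintype.card ι + 81 := by
  classical
  set D := Finset.univ.filter fun x => ∃ c, Double f x c
  have h : ∀ x, (Finset.univ.filter (f x)).card ≤ 1 + if x ∈ D then 1 else 0 := by
    intro x
    split_ifs with hx
    · obtain ⟨c, hc⟩ := (Finset.mem_filter.1 hx).2
      have : Finset.univ.filter (f x) = Finset.univ.erase c := by
        ext d
        simp [hc d]
      rw [this, Finset.card_erase_of_mem (Finset.mem_univ c)]
      simp [ZMod.card]
    · refine Finset.card_le_one.2 fun a ha b hb => ?_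
      by_contra hab
      exact hx (Finset.mem_filter.2 ⟨Finset.mem_univ x, hf.exists_double (Finset.mem_filter.1 ha).2
        (Finset.mem_filter.1 hb).2 hab⟩)
  calc ∑ x, (Finset.univ.filter (f x)).card
      ≤ ∑ x : ι → ZMod 3, (1 + if x ∈ D then 1 else 0) := Finset.sum_le_sum fun x _ => h x
    _ = 3 ^ Fintype.card ι + D.card := by
        rw [Finset.sum_add_distrib, Finset.sum_ite_mem]
        simp [ZMod.card]
    _ ≤ 3 ^ Fintype.card ι + 81 :=
        Nat.add_le_add_left (hf.card_double_le D fun x hx => (Finset.mem_filter.1 hx).2) _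

theorem hammingDist_insertNth_of_near {m : ℕ} (i : Fin (m + 1)) {x y : Fin m → ZMod 3}
    {c d : ZMod 3} (h : Near x c y d) :
    hammingDist (i.insertNth c x : Fin (m + 1) → ZMod 3) (i.insertNth d y) = 1 := by
  rw [hammingDist, Finset.card_eq_one]
  rcases h with ⟨rfl, hdc⟩ | ⟨rfl, j, a, ha, rfl⟩
  · refine ⟨i, Finset.ext fun k => ?_⟩
    rcases i.eq_self_or_eq_succAbove k with rfl | ⟨k, rfl⟩
    · simp [hdc.symm]
    · simp [Fin.succAbove_ne]
  · refine ⟨i.succAbove j, Finset.ext fun k => ?_⟩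
    rcases i.eq_self_or_eq_succAbove k with rfl | ⟨k, rfl⟩
    · simp [(Fin.succAbove_ne k j).symm]
    · by_cases hkj : k = j
      · subst hkj; simp [ha]
      · simp [hkj]

/-- The coordinate i serves as the colour: saturation supplies a colour everywhere, and the degree
bound makes the neighbour of a point unique. -/
theorem valid_insertNth {m : ℕ} (i : Fin (m + 1)) (U : Finset (Fin (m + 1) → ZMod 3))
    (hsat : IsSaturated i U)
    (hdeg : ((hammingGraph (m + 1)).induce (U : Set (Fin (m + 1) → ZMod 3))).maxDegree ≤ 1) :
    Valid fun x c => (i.insertNth c x : Fin (m + 1) → ZMod 3) ∈ U where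
  nonempty x := by
    obtain ⟨u, hu, h⟩ := hsat (i.insertNth 0 x)
    have key : ∀ c : ZMod 3, (i.insertNth 0 x : Fin (m + 1) → ZMod 3) + Pi.single i c =
        i.insertNth c x := by
      intro c
      ext k
      rcases i.eq_self_or_eq_succAbove k with rfl | ⟨k, rfl⟩ <;> simp [Fin.succAbove_ne]
    have e : (2 : ZMod 3) • (Pi.single i 1 : Fin (m + 1) → ZMod 3) = Pi.single i 2 := by
      rw [← Pi.single_smul]
      simp
    rw [e, key, key] at h
    rcases h with rfl | rfl | rfl
    · exact ⟨0, hu⟩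
    · exact ⟨1, hu⟩
    · exact ⟨2, hu⟩
  unique := by
    intro x c y d z e hx hy hz hxy hxz
    set G := (hammingGraph (m + 1)).induce (U : Set (Fin (m + 1) → ZMod 3))
    have h := (G.degree_le_maxDegree ⟨_, hx⟩).trans hdeg
    rw [← SimpleGraph.card_neighborFinset_eq_degree] at h
    have h' := Finset.card_le_one.1 h ⟨_, hy⟩
      ((G.mem_neighborFinset _ _).2 (hammingDist_insertNth_of_near i hxy)) ⟨_, hz⟩
      ((G.mem_neighborFinset _ _).2 (hammingDist_insertNth_of_near i hxz))
    have h' := Subtype.ext_iff.1 h'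
    exact ((Fin.insertNth_inj (α := fun _ => ZMod 3)).1 h').symm

theorem card_eq_sum_card_insertNth {m : ℕ} (i : Fin (m + 1))
    (U : Finset (Fin (m + 1) → ZMod 3)) :
    U.card = ∑ x : Fin m → ZMod 3,
      (Finset.univ.filter fun c => (i.insertNth c x : Fin (m + 1) → ZMod 3) ∈ U).card := by
  rw [Finset.card_eq_sum_card_fiberwise (f := i.removeNth) (t := Finset.univ)
    fun _ _ => Finset.mem_coe.2 (Finset.mem_univ _)]
  refine Finset.sum_congr rfl fun x _ => ?_
  refine Finset.card_bij' (fun u _ => u i) (fun c _ => i.insertNth c x) ?_ ?_ ?_ ?_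
  · intro u hu
    obtain ⟨hu, rfl⟩ := Finset.mem_filter.1 hu
    simpa using hu
  · intro c hc
    simpa [Fin.removeNth_insertNth] using hc
  · intro u hu
    obtain ⟨hu, rfl⟩ := Finset.mem_filter.1 hu
    simp
  · intro c hc
    simp

end HammingThree

open HammingThree in
theorem mainTheorem1 (n : ℕ) (i : Fin n) (U : Finset (Fin n → ZMod 3))
    (hsat : IsSaturated i U)
    (hdeg : ((hammingGraph n).induce (U : Set (Fin n → ZMod 3))).maxDegree ≤ 1) :
    U.card ≤ 3 ^ (n - 1) + 81 := by
  obtain _ | m := n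
  · exact i.elim0
  rw [card_eq_sum_card_insertNth i U]
  simpa using (valid_insertNth i U hsat hdeg).sum_card_le
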